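/- Conventions. A ray is an open half-line $\{o+td : t>0\}$ in $\mathbb{R}^2$, with origin $o$ and direction $d\ne 0$. A graph is the intersection graph of a family of sets indexed by its vertices if any two distinct vertices are adjacent exactly when their sets intersect; it is a ray intersection graph if it is the intersection graph of a family of rays. An embedded tree is a finite tree $T$ with a rotation system (a clockwise cyclic order $\pi_v$ of the edges at each vertex $v$), a root $r$ and an edge $rs$ of $T$. The vertices of each level (distance from $r$) are ordered as in the breadth-first traversal of $T$ from $r$ that visits the children of $r$ in clockwise order starting with $s$, and the children of any vertex $v\neq r$ with parent $v'$ in clockwise order starting with the successor of $v'$ around $v$. Two vertices of the same level are consecutive if one immediately follows the other in this order. A leaf is a vertex of degree one. An admissible extension of $T$ is a finite graph $P$ that is a union of paths such that each path has $3$ or $4$ vertices; the endpoints of each path are two leaves of $T$ that are at the same level and consecutive; the internal vertices of the paths are not vertices of $T$; and no two of the paths share an internal vertex (they may share endpoints). $T+P$ denotes the union of $T$ and $P$, with vertex set $V(T)\cup V(P)$. Statement. (1) For every embedded tree $T$ and every admissible extension $P$ of $T$, the complement of $T+P$ is a ray intersection graph. (2) There are an algorithm and a polynomial $q$ such that the following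 holds for every embedded tree $T$ and every admissible extension $P$ of $T$, with $n=|V(T+P)|$. Given $T$ (by its clockwise lists of neighbours, $r$ and $s$) and $P$ (by its list of paths), the algorithm computes, in at most $q(n)$ bit operations, a family of rays, one for each vertex of $T+P$, whose origins and direction vectors have integer coordinates with at most $q(n)$ binary digits each, and whose intersection graph is the complement of $T+P$. -/

import Mathlib

namespace RayGraph

/-! ### Ray intersection graphs -/

/-- The open ray with origin `o` and direction `d` (the origin is not part of the ray). -/
def openRay (o d : ℝ × ℝ) : Set (ℝ × ℝ) :=
  {x | ∃ t : ℝ, 0 < t ∧ x = o + t • d}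

/-- A subset of the plane is a ray if it is an open half-line. -/
def IsRay (S : Set (ℝ × ℝ)) : Prop :=
  ∃ o d : ℝ × ℝ, d ≠ 0 ∧ S = openRay o d

/-- `G` is the intersection graph of the family of sets `S`. -/
def IsIntersectionGraph {V : Type*} (G : SimpleGraph V) (S : V → Set (ℝ × ℝ)) : Prop :=
  ∀ u v : V, u ≠ v → (G.Adj u v ↔ (S u ∩ S v).Nonempty)

/-- `G` is the intersection graph of a family of rays in the plane. -/
def IsRayIntersectionGraph {V : Type*} (G : SimpleGraph V) : Prop :=
  ∃ S : V → Set (ℝ × ℝ), (∀ v, IsRay (S v)) ∧ IsIntersectionGraph G S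

/-! ### Embedded trees, their linear order, admissible extensions -/

/-- An embedded tree with the data that fixes its linear order: a tree, a rotation system (for
every vertex the list of its neighbours in clockwise order; only the cyclic order is used, the
place where the list starts is irrelevant), a root, and an edge from the root to `second`. -/
structure EmbeddedTree (V : Type*) where
  graph : SimpleGraph V
  isTree : graph.IsTree
  rot : V → List V
  rot_nodup : ∀ v, (rot v).Nodup
  mem_rot : ∀ v w, w ∈ rot v ↔ graph.Adj v w
  root : V
  second : V
  root_adj_second : graph.Adj root second

namespace EmbeddedTree

variable {V : Type*} [DecidableEq V] (T : EmbeddedTree V)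

/-- The children of `v` in clockwise order, if `p` is the parent of `v`: the cyclic list of the
neighbours of `v`, read from the successor of `p` up to the predecessor of `p`. -/
def children (p v : V) : List V :=
  ((T.rot v).rotate ((T.rot v).idxOf p + 1)).dropLast

/-- The pairs (parent of `v`, `v`), for the vertices `v` of level `i + 1` in the order of the
breadth-first traversal. The children of the root are read clockwise from `second`. -/
def levelPairs : ℕ → List (V × V)
  | 0 => ((T.rot T.root).rotate ((T.rot T.root).idxOf T.second)).map fun u => (T.root, u)
  | i + 1 => (levelPairs i).flatMap fun a => (T.children a.1 a.2).map fun u => (a.2, u)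

/-- The vertices of level `i`, in the order of the breadth-first traversal. The linear order
on all the vertices is the concatenation of level `0`, level `1`, level `2`, and so on. -/
def level : ℕ → List V
  | 0 => [T.root]
  | i + 1 => (T.levelPairs i).map Prod.snd

/-- `v` is the immediate successor of `u` in the linear order, and both are at the same level. -/
def Next (u v : V) : Prop :=
  ∃ i, [u, v] <:+: T.level i

/-- `u` and `v` are consecutive vertices of the same level. -/
def Consecutive (u v : V) : Prop :=
  T.Next u v ∨ T.Next v u

/-- A leaf is a vertex of degree one. -/
def IsLeaf {V : Type*} (T : EmbeddedTree V) (v : V) : Prop :=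
  ∃! w, T.graph.Adj v w

/-- A path with three or four vertices (written as the list of its vertices) whose endpoints are
consecutive leaves of the same level of `T`, and whose internal vertices are new vertices. The
vertices of `T` are the `Sum.inl v`, the new vertices are the `Sum.inr w`. -/
def IsLink {N : Type*} (p : List (V ⊕ N)) : Prop :=
  ∃ u v : V, T.IsLeaf u ∧ T.IsLeaf v ∧ T.Consecutive u v ∧
    ((∃ w : N, p = [Sum.inl u, Sum.inr w, Sum.inl v]) ∨
      ∃ w w' : N, w ≠ w' ∧ p = [Sum.inl u, Sum.inr w, Sum.inr w', Sum.inl v])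

/-- `L` lists paths as above, no two of which share an internal vertex (they may share endpoints);
the new vertices are exactly their internal vertices. -/
structure IsLinkSystem {N : Type*} (L : List (List (V ⊕ N))) : Prop where
  isLink : ∀ p ∈ L, T.IsLink p
  disjoint : L.Pairwise fun p q => ∀ w : N, Sum.inr w ∈ p → Sum.inr w ∉ q
  cover : ∀ w : N, ∃ p ∈ L, Sum.inr w ∈ p

end EmbeddedTree

/-- The union of the paths in the list `L`, as a graph. -/
def pathUnion {W : Type*} (L : List (List W)) : SimpleGraph W :=
  SimpleGraph.fromRel fun x y => ∃ p ∈ L, [x, y] <:+: p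

/-- `P` is an admissible extension of `T`, with the elements of `N` as its vertices outside `T`. -/
def EmbeddedTree.IsAdmissibleExtension {V N : Type*} [DecidableEq V] (T : EmbeddedTree V)
    (P : SimpleGraph (V ⊕ N)) : Prop :=
  ∃ L : List (List (V ⊕ N)), T.IsLinkSystem L ∧ P = pathUnion L

/-- The graph `T + P`, on the vertices of `T` and the new vertices of `P`. -/
def EmbeddedTree.plus {V N : Type*} (T : EmbeddedTree V) (P : SimpleGraph (V ⊕ N)) :
    SimpleGraph (V ⊕ N) :=
  T.graph.map Function.Embedding.inl ⊔ P

/-! ### A model of computation with bit cost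

Programs work on binary trees whose leaves are integers (lists are nested pairs, ended by `0`).
Every elementary operation is charged the number of bits that it reads and writes, so that
polynomial time here is polynomial time on a Turing machine. -/

/-- The values that programs work on. -/
inductive Data : Type
  | int (z : ℤ) : Data
  | pair (a b : Data) : Data

namespace Data

/-- The number of bits of a value, up to a constant factor. -/
def size : Data → ℕ
  | int z => z.natAbs.size + 1
  | pair a b => a.size + b.size + 1

/-- Lists as values. -/
def ofList : List Data → Data
  | [] => int 0
  | a :: l => pair a (ofList l)

/-- Natural numbers as values. -/
def ofNat (n : ℕ) : Data :=
  int n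

end Data

/-- The elementary operations. -/
inductive Op : Type
  | const (z : ℤ)
  | id
  | fst
  | snd
  | isPair
  | add
  | sub
  | mul
  | div
  | le

/-- The result of an elementary operation (`0` if the argument has the wrong shape). The
arithmetic operations act on pairs of integers; `1` and `0` stand for true and false. -/
def Op.apply : Op → Data → Data
  | .const z, _ => .int z
  | .id, x => x
  | .fst, .pair a _ => a
  | .snd, .pair _ b => b
  | .isPair, .pair _ _ => .int 1
  | .add, .pair (.int a) (.int b) => .int (a + b)
  | .sub, .pair (.int a) (.int b) => .int (a - b)
  | .mul, .pair (.int a) (.int b) => .int (a * b)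
  | .div, .pair (.int a) (.int b) => .int (a / b)
  | .le, .pair (.int a) (.int b) => .int (if a ≤ b then 1 else 0)
  | _, _ => .int 0

/-- Programs: elementary operations, sequential composition, pairing of two results computed
from the same argument, case distinction, and loops. -/
inductive Prog : Type
  | op (o : Op)
  | seq (f g : Prog)
  | pair (f g : Prog)
  | cond (c f g : Prog)
  | loop (c f : Prog)

/-- `Run f x y t`: the program `f` on input `x` halts with output `y` after time `t`. The program
`loop c f` replaces its value `x` by the result of `f` on `x` as long as `c` on `x` does not give
`0`. -/
inductive Run : Prog → Data → Data → ℕ → Prop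
  | op (o : Op) (x : Data) : Run (.op o) x (o.apply x) (x.size + (o.apply x).size)
  | seq {f g : Prog} {x y z : Data} {s t : ℕ} :
      Run f x y s → Run g y z t → Run (.seq f g) x z (s + t + 1)
  | pair {f g : Prog} {x y z : Data} {s t : ℕ} :
      Run f x y s → Run g x z t → Run (.pair f g) x (.pair y z) (s + t + 1)
  | cond_true {c f g : Prog} {x b y : Data} {s t : ℕ} :
      Run c x b s → b ≠ .int 0 → Run f x y t → Run (.cond c f g) x y (s + t + 1)
  | cond_false {c f g : Prog} {x y : Data} {s t : ℕ} :
      Run c x (.int 0) s → Run g x y t → Run (.cond c f g) x y (s + t + 1)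
  | loop_step {c f : Prog} {x b y z : Data} {s t u : ℕ} :
      Run c x b s → b ≠ .int 0 → Run f x y t → Run (.loop c f) y z u →
      Run (.loop c f) x z (s + t + u + 1)
  | loop_stop {c f : Prog} {x : Data} {s : ℕ} :
      Run c x (.int 0) s → Run (.loop c f) x x (s + 1)

/-! ### Input and output of the algorithm -/

/-- A ray with integer coordinates: origin and direction vector. -/
structure IntRay where
  origin : ℤ × ℤ
  direction : ℤ × ℤ
  direction_ne_zero : direction ≠ 0

namespace IntRay

/-- The ray as a subset of the plane. -/
def toSet (ρ : IntRay) : Set (ℝ × ℝ) :=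
  openRay ((ρ.origin.1 : ℝ), (ρ.origin.2 : ℝ)) ((ρ.direction.1 : ℝ), (ρ.direction.2 : ℝ))

/-- All four coordinates have at most `b` binary digits. -/
def BitsLE (ρ : IntRay) (b : ℕ) : Prop :=
  ρ.origin.1.natAbs.size ≤ b ∧ ρ.origin.2.natAbs.size ≤ b ∧
    ρ.direction.1.natAbs.size ≤ b ∧ ρ.direction.2.natAbs.size ≤ b

/-- The ray as a value. -/
def encode (ρ : IntRay) : Data :=
  .pair (.pair (.int ρ.origin.1) (.int ρ.origin.2))
    (.pair (.int ρ.direction.1) (.int ρ.direction.2))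

end IntRay

/-- The number of a vertex of `T + P`: first the vertices of `T`, then the new ones. -/
def vertexNumber {m k : ℕ} : Fin m ⊕ Fin k → ℕ
  | .inl i => i
  | .inr j => m + j

/-- The input: the numbers of vertices of `T` and of new vertices, the root and `second`, the
clockwise lists of neighbours in `T`, and the paths of `P`. -/
def encodeInput {m k : ℕ} (T : EmbeddedTree (Fin m)) (L : List (List (Fin m ⊕ Fin k))) : Data :=
  .ofList [.ofNat m, .ofNat k, .ofNat T.root, .ofNat T.second,
    .ofList ((List.finRange m).map fun v => .ofList ((T.rot v).map fun w => .ofNat w)),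
    .ofList (L.map fun p => .ofList (p.map fun x => .ofNat (vertexNumber x)))]

/-- The output: the list of the rays, in the order of the numbers of the vertices. -/
def encodeOutput {m k : ℕ} (ρ : Fin m ⊕ Fin k → IntRay) : Data :=
  .ofList (((List.finRange m).map fun i => (ρ (.inl i)).encode) ++
    ((List.finRange k).map fun j => (ρ (.inr j)).encode))

end RayGraph

/-!
All rays are drawn in the dual plane. A line that is not vertical is a point there, a ray on it is
this point together with a cutoff slope and a side, and two rays meet exactly when the slope of the
segment between their points is on the good side of both cutoffs (`DualRay.inter_nonempty_iff`). For
the complement of `T + P`, two rays must therefore miss each other exactly when one of them cuts off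
the point of the other. The construction arranges that every vertex of the tree cuts off its parent
and nothing else, and that the internal vertices of the paths of `P` cut off nothing but neighbours,
one end of each edge the other (`Spec.Par`, `Spec.good_iff_not_par`).

The points of the vertices of one level lie on a parabola, within a small neighbourhood of a base
point, and the base points of the levels form a staircase with huge steps in two alternating
directions. The picture at every second level is reflected, so that from each level the previous one
is seen in the same way, and all others are seen at slopes on the good side of the cutoffs
(`Spec.good_of_loc_ne`). The line through the point of a vertex of level `h + 1` with its cutoff
slope is close to a secant of the parabola of level `h`. If it is nearly a tangent at position `p`,
the ray cuts off the point at `p` only, which gives the tree (`Spec.good_tree`). If it runs just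
above two consecutive positions `p < q`, the ray cuts off exactly these two points, which gives the
internal vertex of a path with three vertices (`Spec.good_mid`). For a path with four vertices, two
points high above the parabola of level `h` are used, with steep cutoffs: one ray cuts off the point
at `p`, the other one the point at `q` and the point of the first (`Spec.good_left`,
`Spec.good_right`).

The position of a child is `-M * (2 * p + c)`, where `p` is the position of its parent and `c` its
child number up to sign. Hence positions are monotone along each level of the breadth-first
traversal (`EmbeddedTree.entries_sorted`), and consecutive vertices of a level have consecutive
positions (`EmbeddedTree.gap_of_infix`). Residues modulo `M` reveal the child numbers and the
numbers of the paths, so that different rays have different slopes (`Spec.pos_ne`). Positions grow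
by a factor quadratic in the number of vertices from each level to the next, and all coordinates are
polynomials of bounded degree in a bound for the positions, so they have polynomially many digits.

For the running time, `PolyTime μ e f` says that a program computes `f γ` from `e γ` in time
polynomial in `μ γ`. This notion is closed under arithmetic, case distinctions, bounded loops
(`PolyTime.natRec`), and the usual operations on lists (`PolyTime.fold` and its consequences). The
algorithm computes the levels of the tree one after the other, with the positions and the rays,
collects them in a table, computes the rays of the paths from this table, and outputs the rays in
the order of the vertices, which it looks up one by one (`Inst.time_output`). That the output has
polynomial size follows from the running time.
-/

namespace RayGraph

/-! ### Rays as dual points with a cutoff slope -/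

/-- A point `(x, y)` of the dual plane with a cutoff slope `cut / D`. The line dual to the point is
`{(τ, D * y - τ * x)}`, and the abscissa of the common point of two such lines is `D` times the
slope of the segment between the dual points. The flag `up` says whether the ray consists of
the part of the line with abscissa above `cut` or of the part below. -/
structure DualRay where
  x : ℤ
  y : ℤ
  cut : ℤ
  up : Bool

namespace DualRay

/-- The sign of the first coordinate of the direction of the ray. -/
def sgn (e : DualRay) : ℤ := if e.up then 1 else -1

/-- The ray in the plane that is encoded by a dual point and a cutoff. -/
def toRay (D : ℤ) (e : DualRay) : IntRay where
  origin := (e.cut, D * e.y - e.cut * e.x)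
  direction := (e.sgn, -(e.sgn * e.x))
  direction_ne_zero := by
    rcases e with ⟨x, y, c, _ | _⟩ <;> simp [sgn]

/-- The slope of the segment from `e` to `f` is on the good side of the cutoff of `e`. -/
def Good (D : ℤ) (e f : DualRay) : Prop :=
  0 < e.sgn * ((D * (f.y - e.y) - e.cut * (f.x - e.x)) * (f.x - e.x))

lemma sgn_cases (e : DualRay) : e.sgn = 1 ∨ e.sgn = -1 := by
  unfold sgn; split <;> simp

lemma mem_toSet (D : ℤ) (e : DualRay) (z : ℝ × ℝ) :
    z ∈ (e.toRay D).toSet ↔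
      0 < (e.sgn : ℝ) * (z.1 - e.cut) ∧ z.2 = D * e.y - z.1 * e.x := by
  have hs : (e.sgn : ℝ) * e.sgn = 1 := by
    rcases e.sgn_cases with h | h <;> simp [h]
  obtain ⟨a, b⟩ := z
  simp only [IntRay.toSet, openRay, toRay, Set.mem_ofPred_eq, Prod.mk_add_mk, Prod.smul_mk,
    smul_eq_mul, Prod.mk.injEq]
  constructor
  · rintro ⟨t, ht, rfl, rfl⟩
    refine ⟨?_, by push_cast; ring⟩
    have : (e.sgn : ℝ) * (e.cut + t * e.sgn - e.cut) = t * (e.sgn * e.sgn) := by ring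
    rw [this, hs]; simpa using ht
  · rintro ⟨h, hb⟩
    refine ⟨(e.sgn : ℝ) * (a - e.cut), h, ?_, ?_⟩
    · have : (e.cut : ℝ) + e.sgn * (a - e.cut) * e.sgn = e.cut + (a - e.cut) * (e.sgn * e.sgn) := by
        ring
      rw [this, hs]; ring
    · rw [hb]
      push_cast
      have : (e.sgn : ℝ) * (a - e.cut) * -(e.sgn * e.x) = -(a - e.cut) * e.x * (e.sgn * e.sgn) := by
        ring
      rw [this, hs]; ring

/-- Two rays on lines of different slopes meet exactly when the slope of the segment between the
dual points is on the good side of both cutoffs. -/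
lemma inter_nonempty_iff {D : ℤ} (e f : DualRay) (h : e.x ≠ f.x) :
    ((e.toRay D).toSet ∩ (f.toRay D).toSet).Nonempty ↔ Good D e f ∧ Good D f e := by
  have hd : ((f.x : ℝ) - e.x) ≠ 0 := by
    rw [sub_ne_zero]; exact_mod_cast h.symm
  have key : ∀ (g : DualRay) (u v : ℤ), v ≠ 0 →
      ((0 : ℝ) < (g.sgn : ℝ) * ((u : ℝ) / v - g.cut) ↔ 0 < g.sgn * ((u - g.cut * v) * v)) := by
    intro g u v hv
    have hv' : (v : ℝ) ≠ 0 := by exact_mod_cast hv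
    have hvv : (0 : ℝ) < (v : ℝ) * v := mul_self_pos.2 hv'
    rw [← mul_pos_iff_of_pos_right hvv]
    have : (g.sgn : ℝ) * ((u : ℝ) / v - g.cut) * (v * v)
        = ((g.sgn * ((u - g.cut * v) * v) : ℤ) : ℝ) := by
      push_cast; field_simp
    rw [this]
    exact_mod_cast Iff.rfl
  have he := key e (D * (f.y - e.y)) (f.x - e.x) (sub_ne_zero.2 h.symm)
  have hf := key f (D * (e.y - f.y)) (e.x - f.x) (sub_ne_zero.2 h)
  have hq : ((D * (f.y - e.y) : ℤ) : ℝ) / ((f.x - e.x : ℤ) : ℝ)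
      = ((D * (e.y - f.y) : ℤ) : ℝ) / ((e.x - f.x : ℤ) : ℝ) := by
    have : ((e.x : ℝ) - f.x) ≠ 0 := by rw [sub_ne_zero]; exact_mod_cast h
    push_cast
    field_simp
    ring
  unfold Good
  rw [← he, ← hf, ← hq]
  constructor
  · rintro ⟨⟨a, b⟩, h1, h2⟩
    rw [mem_toSet] at h1 h2
    have ha : ((D * (f.y - e.y) : ℤ) : ℝ) / ((f.x - e.x : ℤ) : ℝ) = a := by
      have hd' : ((f.x - e.x : ℤ) : ℝ) ≠ 0 := by push_cast; exact hd
      rw [div_eq_iff hd']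
      push_cast
      have := h1.2.symm.trans h2.2
      simp only at this
      linarith
    rw [ha]
    exact ⟨h1.1, h2.1⟩
  · rintro ⟨h1, h2⟩
    refine ⟨(((D * (f.y - e.y) : ℤ) : ℝ) / ((f.x - e.x : ℤ) : ℝ),
      D * e.y - ((D * (f.y - e.y) : ℤ) : ℝ) / ((f.x - e.x : ℤ) : ℝ) * e.x), ?_, ?_⟩
    · rw [mem_toSet]; exact ⟨h1, rfl⟩
    · rw [mem_toSet]
      refine ⟨h2, ?_⟩
      have hd' : ((f.x : ℝ) - e.x) ≠ 0 := hd
      push_cast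
      field_simp
      ring

end DualRay

/-! ### The rays of the construction -/

/-- The size parameters of the construction: `k` bounds the indices of children and of links,
and `B` bounds all the positions. -/
structure Scale where
  k : ℤ
  B : ℤ
  one_le_k : 1 ≤ k
  k_le_B : 4096 * k * k ≤ B

namespace Scale

variable (s : Scale)

/-- The gap between the positions of vertices at the same level. -/
def M : ℤ := 64 * s.k

/-- The height by which the middle vertices of the paths with three vertices are lifted. -/
def lift : ℤ := s.B ^ 3

/-- The steepness of the rays for the paths with four vertices. -/
def Z : ℤ := s.B ^ 5

/-- The horizontal unit. -/
def R : ℤ := s.B ^ 12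

/-- The distance between levels, and the denominator of all cutoff slopes. -/
def D : ℤ := s.M * s.R * s.R

end Scale

/-- The combinatorial description of a ray. The numbers `p < q` are positions of consecutive
vertices of level `h`, and `i` is the number of a path between them. -/
inductive Spec : Type
  /-- the root -/
  | root
  /-- a vertex of level `h + 1` whose parent has position `p`; `b` is its signed child number -/
  | tree (h : ℕ) (p b : ℤ)
  /-- the internal vertex of a path with three vertices -/
  | mid (h : ℕ) (p q i : ℤ)
  /-- the internal vertex next to `p` of a path with four vertices -/
  | left (h : ℕ) (p q i : ℤ)
  /-- the internal vertex next to `q` of a path with four vertices -/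
  | right (h : ℕ) (p q i : ℤ)

namespace Spec

variable (s : Scale)

/-- The level of the location in the dual plane. -/
def loc : Spec → ℕ
  | root => 0
  | tree h _ _ => h + 1
  | mid h _ _ _ => h + 1
  | left h _ _ _ => h
  | right h _ _ _ => h

/-- The level as a vertex of the graph: one more than the level of the vertices it is hung on. -/
def lev : Spec → ℕ
  | root => 0
  | tree h _ _ => h + 1
  | mid h _ _ _ => h + 1
  | left h _ _ _ => h + 1
  | right h _ _ _ => h + 1

/-- The position along the chain of the level. -/
def pos : Spec → ℤ
  | root => 0
  | tree _ p b => -(s.M * (p + p + b))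
  | mid _ p q i => -(s.M * (p + q + i))
  | left _ p _ i => p - i
  | right _ _ q i => q - 4 * s.k + i

/-- The deviation of the abscissa from a multiple of the horizontal unit. -/
def dev : Spec → ℤ
  | mid _ _ _ _ => s.lift
  | _ => 0

/-- The abscissa relative to the base point of the location. -/
def locX (e : Spec) : ℤ := s.R * e.pos s + e.dev s

/-- The height relative to the base point of the location. -/
def locY : Spec → ℤ
  | root => 0
  | tree h p b => (pos s (tree h p b)) ^ 2
  | mid h p q i => (pos s (mid h p q i)) ^ 2 + s.lift
  | left _ p q i => q ^ 2 + s.Z * (q - p + i) - i ^ 2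
  | right _ p q i => q ^ 2 + i ^ 2 + 2 * i * (q - p) + (s.Z - 2 * i) * (4 * s.k - i)

/-- The numerator of the cutoff of a ray that is hung on the positions `p ≤ q`. -/
def hang (p q b : ℤ) : ℤ :=
  (s.M * (p + q + b)) ^ 2 - s.M * (p + q + b) ^ 2 - p * q - b * p + 1 + s.R * (s.M * (p + q + b))

/-- The numerator of the cutoff slope, in the frame of the level below. -/
def slope : Spec → ℤ
  | root => -s.D
  | tree _ p b => hang s p p b
  | mid _ p q i => hang s p q i
  | left _ p q _ => -(2 * s.Z * (q - p) * s.R)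
  | right _ _ _ i => -((s.Z - 2 * i) * (s.M * s.R))

/-- The dual point and the cutoff in global coordinates. The base points of the locations form
a staircase with steps `(-D, 0)` and `(-D, -D)`; at odd locations the picture is reflected by
`(x, y) ↦ (x, x - y)`, which exchanges the slopes `σ` and `1 - σ`. -/
def dual (e : Spec) : DualRay where
  x := -(e.loc * s.D) + e.locX s
  y := -((e.loc / 2 : ℕ) * s.D) + if e.loc % 2 = 0 then e.locY s else e.locX s - e.locY s
  cut := if e.lev % 2 = 1 then e.slope s else s.D - e.slope s
  up := e.lev % 2 = 1

/-- Abscissa in the frame of the level below `e`, relative to the base point of that level. -/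
def frX (e f : Spec) : ℤ := -(((f.loc : ℤ) + 1 - e.lev) * s.D) + f.locX s

/-- Height in the frame of the level below `e`, relative to the base point of that level. -/
def frY (e f : Spec) : ℤ :=
  -((((f.loc : ℤ) + 1 - e.lev) / 2) * s.D) +
    if ((f.loc : ℤ) + 1 - e.lev) % 2 = 0 then f.locY s else f.locX s - f.locY s

/-- In its own frame, the frame of the level that it is hung on, every ray is an upper one. -/
lemma good_iff (e f : Spec) :
    DualRay.Good s.D (e.dual s) (f.dual s) ↔
      0 < (s.D * (frY s e f - frY s e e) - e.slope s * (frX s e f - frX s e e)) *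
        (frX s e f - frX s e e) := by
  unfold DualRay.Good
  have hx : (f.dual s).x - (e.dual s).x = frX s e f - frX s e e := by
    simp only [dual, frX]; ring
  rcases Nat.mod_two_eq_zero_or_one e.lev with hl | hl
  · have hy : ∀ g : Spec, (g.dual s).x - (g.dual s).y = frY s e g - (((e.lev : ℤ)) / 2) * s.D := by
      intro g
      obtain ⟨t, ht⟩ : ∃ t, e.lev = 2 * t := ⟨e.lev / 2, by omega⟩
      simp only [dual, frY, ht]
      rcases Nat.mod_two_eq_zero_or_one g.loc with hg | hg
      · obtain ⟨a, ha⟩ : ∃ t, g.loc = 2 * t := ⟨g.loc / 2, by omega⟩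
        have h1 : ((g.loc : ℤ) + 1 - ((2 * t : ℕ) : ℤ)) / 2 = a - t := by omega
        have h2 : ¬ ((g.loc : ℤ) + 1 - ((2 * t : ℕ) : ℤ)) % 2 = 0 := by omega
        have h3 : g.loc / 2 = a := by omega
        have h4 : (((2 * t : ℕ) : ℤ)) / 2 = t := by omega
        rw [h1, h3, h4, if_neg h2, if_pos hg, ha]
        push_cast; ring
      · obtain ⟨a, ha⟩ : ∃ t, g.loc = 2 * t + 1 := ⟨g.loc / 2, by omega⟩
        have h1 : ((g.loc : ℤ) + 1 - ((2 * t : ℕ) : ℤ)) / 2 = a + 1 - t := by omega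
        have h2 : ((g.loc : ℤ) + 1 - ((2 * t : ℕ) : ℤ)) % 2 = 0 := by omega
        have h3 : g.loc / 2 = a := by omega
        have h4 : (((2 * t : ℕ) : ℤ)) / 2 = t := by omega
        rw [h1, h3, h4, if_pos h2, if_neg (by omega), ha]
        push_cast; ring
    have hs : (e.dual s).sgn = -1 := by simp [DualRay.sgn, dual, hl]
    have hc : (e.dual s).cut = s.D - e.slope s := by simp [dual, hl]
    have hyy : (f.dual s).y - (e.dual s).y =
        (frX s e f - frX s e e) - (frY s e f - frY s e e) := by
      have h1 := hy f
      have h2 := hy e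
      linarith
    rw [hx, hyy, hs, hc]
    ring_nf
  · have hy : ∀ g : Spec, (g.dual s).y = frY s e g - (((e.lev : ℤ)) / 2) * s.D := by
      intro g
      obtain ⟨t, ht⟩ : ∃ t, e.lev = 2 * t + 1 := ⟨e.lev / 2, by omega⟩
      simp only [dual, frY, ht]
      have h1 : ((g.loc : ℤ) + 1 - ((2 * t + 1 : ℕ) : ℤ)) / 2 =
          ((g.loc / 2 : ℕ) : ℤ) - t := by omega
      have h4 : (((2 * t + 1 : ℕ) : ℤ)) / 2 = t := by omega
      have h2 : ((g.loc : ℤ) + 1 - ((2 * t + 1 : ℕ) : ℤ)) % 2 = 0 ↔ g.loc % 2 = 0 := by omega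
      simp only [h1, h4, h2]
      ring
    have hs : (e.dual s).sgn = 1 := by simp [DualRay.sgn, dual, hl]
    have hc : (e.dual s).cut = e.slope s := by simp [dual, hl]
    have hyy : (f.dual s).y - (e.dual s).y = frY s e f - frY s e e := by
      rw [hy f, hy e]; ring
    rw [hx, hyy, hs, hc, one_mul]

end Spec

end RayGraph

namespace RayGraph

/-! ### Comparison of slopes -/

/-- Seen from a point, a point at the same location is on the good side of a cutoff that is small
in the frame of the location before. -/
lemma good_of_same_loc {D R S dX dY : ℤ} (hR : 0 < R) (hD : 0 < D) (hS : 10 * S ≤ D)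
    (hX : R ≤ 2 * |dX|) (hY : 8 * |dY| ≤ R) :
    0 < (D * (dX - dY) - S * dX) * dX := by
  have h1 : 4 * |dY| ≤ |dX| := by linarith
  have h2 : 0 < |dX| := by linarith
  have h3 : 4 * |dY * dX| ≤ dX ^ 2 := by
    rw [abs_mul, ← sq_abs dX]; nlinarith
  have h4 : 0 < dX ^ 2 := by rw [← sq_abs]; positivity
  have h5 := le_abs_self (dY * dX)
  have h6 : D * (dY * dX) * 4 ≤ D * dX ^ 2 := by nlinarith
  have h7 : 10 * S * dX ^ 2 ≤ D * dX ^ 2 := mul_le_mul_of_nonneg_right hS h4.le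
  have h8 : 0 < D * dX ^ 2 := mul_pos hD h4
  nlinarith

/-- From a point one location further on, the points at all other locations are seen on the good
side of a cutoff that is small in the frame. -/
lemma good_of_far_one {D S w r x y : ℤ} (hD : 0 < D) (hwD : 10 * w ≤ D)
    (hS : 10 * S ≤ D) (hr : 2 ≤ r ∨ r ≤ -1) (hx : |x| ≤ w) (hy : |y| ≤ w) :
    0 < (D * (-((r / 2) * D) + y) - S * (-((r - 1) * D) + x)) * (-((r - 1) * D) + x) := by
  obtain ⟨hx1, hx2⟩ := abs_le.1 hx
  obtain ⟨hy1, hy2⟩ := abs_le.1 hy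
  obtain ⟨q, hq⟩ : ∃ q, r / 2 = q := ⟨_, rfl⟩
  rw [hq]
  rcases hr with hr | hr
  · have hq1 : 1 ≤ q := by omega
    have hq2 : r - 1 ≤ 2 * q := by omega
    have hqD : D ≤ q * D := by nlinarith
    have h1 : -((r - 1) * D) + x < 0 := by nlinarith
    have h2 : -(2 * (q * D)) - w ≤ -((r - 1) * D) + x := by nlinarith
    apply mul_pos_of_neg_of_neg _ h1
    set X := -((r - 1) * D) + x with hX
    have h3 : 10 * (-(S * X)) ≤ D * (2 * (q * D) + w) := by
      have : 10 * (-(S * X)) ≤ D * (-X) := by nlinarith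
      nlinarith
    nlinarith
  · have hq1 : q ≤ -1 := by omega
    have hq2 : 1 - r ≤ -(3 * q) := by omega
    have hqD : D ≤ -(q * D) := by nlinarith
    have h1 : 0 < -((r - 1) * D) + x := by nlinarith
    have h2 : -((r - 1) * D) + x ≤ -(3 * (q * D)) + w := by nlinarith
    apply mul_pos _ h1
    set X := -((r - 1) * D) + x with hX
    have h3 : 10 * (S * X) ≤ D * (-(3 * (q * D)) + w) := by
      have : 10 * (S * X) ≤ D * X := by nlinarith
      nlinarith
    nlinarith

/-- From a point at the base location, the points at all other locations are seen on the good
side of a negative cutoff. -/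
lemma good_of_far_zero {D S w r x y : ℤ} (hw : 0 ≤ w) (hD : 0 < D) (hwD : 10 * w ≤ D)
    (hS : 2 * w < -S) (hr : r ≠ 0) (hx : |x| ≤ w) (hy : |y| ≤ w) :
    0 < (D * (-((r / 2) * D) + y) - S * (-(r * D) + x)) * (-(r * D) + x) := by
  obtain ⟨hx1, hx2⟩ := abs_le.1 hx
  obtain ⟨hy1, hy2⟩ := abs_le.1 hy
  obtain ⟨q, hq⟩ : ∃ q, r / 2 = q := ⟨_, rfl⟩
  rw [hq]
  rcases lt_or_gt_of_ne hr with hr | hr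
  · have hq1 : q ≤ -1 := by omega
    have hqD : D ≤ -(q * D) := by nlinarith
    have h1 : 0 < -(r * D) + x := by nlinarith
    refine mul_pos ?_ h1
    nlinarith [mul_pos (show 0 < -S by linarith) h1]
  · have hq1 : 0 ≤ q := by omega
    have h1 : -(r * D) + x ≤ -D + w := by nlinarith
    refine mul_pos_of_neg_of_neg ?_ (by linarith)
    have h3 : 0 ≤ q * D := by positivity
    have h4 : (-S) * (-(r * D) + x) ≤ (-S) * (-D + w) :=
      mul_le_mul_of_nonneg_left h1 (by linarith)
    have h5 : (-S) * (D - w) > 2 * w * (D - w) := by nlinarith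
    nlinarith

/-- The cutoff line of a ray that is hung on the positions `p` and `q`, evaluated at a point near
the chain. -/
lemma hang_identity {D M R S A σ p q b a Y dv dv' c : ℤ} (hD : D = M * R * R) (hA : A = -(M * σ))
    (hσ : σ = p + q + b) (hc : c = A ^ 2 - M * σ ^ 2 - p * q - b * p + 1) (hS : S = c - R * A) :
    D * (Y - (R * A - A ^ 2)) - S * (R * a + dv - (-D + (R * A + dv'))) =
      D * ((Y - a ^ 2) + (a - p) * (a - q) - b * (a - p) - 1)
        - (c * R * (a - A) + S * (dv - dv')) := by
  subst hS hc hσ hA hD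
  ring

/-- A comparison of slopes, when the abscissas are multiples of a large unit up to a small
deviation. -/
lemma good_of_unit {R c U a dv L : ℤ} (hc : 0 ≤ c) (hdv : 0 ≤ dv) (hL : dv ≤ L) (hLR : L < R)
    (hcL : c * L < R) (h : (0 < a ∧ 0 < U) ∨ (a < 0 ∧ U < 0)) :
    0 < (R * U + c * dv) * (R * a + dv) := by
  have h1 : 0 ≤ c * dv := mul_nonneg hc hdv
  have h2 : c * dv ≤ c * L := mul_le_mul_of_nonneg_left hL hc
  rcases h with ⟨ha, hU⟩ | ⟨ha, hU⟩
  · apply mul_pos <;> nlinarith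
  · apply mul_pos_of_neg_of_neg <;> nlinarith

/-- The opposite of `good_of_unit`, for points without deviation. -/
lemma not_good_of_unit {R c U a : ℤ} (h : 0 ≤ a ∧ U ≤ 0 ∨ a ≤ 0 ∧ 0 ≤ U) :
    ¬ 0 < (R * U + c * 0) * (R * a + 0) := by
  have : (R * U + c * 0) * (R * a + 0) = R ^ 2 * (U * a) := by ring
  rw [this, not_lt]
  apply mul_nonpos_of_nonneg_of_nonpos (sq_nonneg R)
  rcases h with h | h
  · exact mul_nonpos_of_nonpos_of_nonneg h.2 h.1
  · exact mul_nonpos_of_nonneg_of_nonpos h.2 h.1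

namespace Scale
variable (s : Scale)

lemma B_ge : 4096 ≤ s.B := by nlinarith [s.one_le_k, s.k_le_B]
lemma k_le : 4096 * s.k ≤ s.B := by nlinarith [s.one_le_k, s.k_le_B]
lemma M_pos : 0 < s.M := by unfold M; linarith [s.one_le_k]
lemma sq_ge : 4096 * s.B ≤ s.B ^ 2 := by nlinarith [s.B_ge]
lemma lift_ge : 4096 * s.B ^ 2 ≤ s.lift := by
  have := s.B_ge
  unfold lift
  calc 4096 * s.B ^ 2 ≤ s.B * s.B ^ 2 := by gcongr
    _ = s.B ^ 3 := by ring
lemma Z_eq : s.Z = s.B ^ 2 * s.lift := by unfold Z lift; ring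
lemma Z_ge : 4096 * s.lift ≤ s.Z := by
  have h1 := s.sq_ge
  have h2 := s.B_ge
  have h3 := s.lift_ge
  rw [Z_eq]
  nlinarith
lemma R_ge : s.B ^ 11 * 4096 ≤ s.R := by
  have := s.B_ge
  unfold R
  calc s.B ^ 11 * 4096 ≤ s.B ^ 11 * s.B := by gcongr
    _ = s.B ^ 12 := by ring
lemma R_ge_Z : 4096 * (s.Z * s.B) ≤ s.R := by
  have := s.B_ge
  refine le_trans ?_ s.R_ge
  unfold Z
  calc 4096 * (s.B ^ 5 * s.B) = s.B ^ 6 * 4096 := by ring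
    _ ≤ s.B ^ 11 * 4096 := by gcongr <;> linarith
lemma R_ge_lift : 4096 * (s.Z * s.B * s.lift) ≤ s.R := by
  have := s.B_ge
  refine le_trans ?_ s.R_ge
  unfold Z lift
  calc 4096 * (s.B ^ 5 * s.B * s.B ^ 3) = s.B ^ 9 * 4096 := by ring
    _ ≤ s.B ^ 11 * 4096 := by gcongr <;> linarith
lemma R_pos : 0 < s.R := by
  have := s.B_ge
  unfold R; positivity
lemma D_pos : 0 < s.D := by
  unfold D; exact mul_pos (mul_pos s.M_pos s.R_pos) s.R_pos
lemma D_ge_R : s.R * s.R ≤ s.D := by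
  have h := s.R_pos
  have h' := s.M_pos
  unfold D; nlinarith [mul_pos h h]
lemma D_ge : 4096 * (s.B ^ 11 * s.R) ≤ s.D := by
  have h := s.R_pos
  refine le_trans ?_ s.D_ge_R
  nlinarith [s.R_ge]

end Scale
end RayGraph

namespace RayGraph
namespace Spec

variable (s : Scale)

/-! ### Which rays cut off which points -/

/-- The ray belongs to a vertex of the tree. -/
def IsTree : Spec → Prop
  | root => True
  | tree _ _ _ => True
  | _ => False

/-- The number of the path to which the ray belongs (`0` for vertices of the tree). -/
def idx : Spec → ℤ
  | mid _ _ _ i => i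
  | left _ _ _ i => i
  | right _ _ _ i => i
  | _ => 0

/-- `p` and `q` are positions of consecutive vertices of level `h`, and `i` is large enough to
be distinguished from the child numbers. -/
structure Gap (P : ℕ → ℤ → Prop) (h : ℕ) (p q i : ℤ) : Prop where
  left_mem : P h p
  right_mem : P h q
  lt : p < q
  gap : ∀ b, P h b → b ≤ p ∨ q ≤ b
  lt_idx : s.k < 2 * i
  idx_le : i ≤ s.k

/-- `e` describes a ray over the tree with the positions `P h` at level `h`. -/
def WF (P : ℕ → ℤ → Prop) : Spec → Prop
  | root => P 0 0
  | tree h p b => P h p ∧ P (h + 1) (pos s (tree h p b)) ∧ 2 * |b| ≤ s.k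
  | mid h p q i => Gap s P h p q i
  | left h p q i => Gap s P h p q i
  | right h p q i => Gap s P h p q i

/-- The dual point of `f` is cut off by the ray `e`. -/
def Par (e f : Spec) : Prop :=
  match e with
  | root => False
  | tree h p _ => f.IsTree ∧ f.loc = h ∧ f.pos s = p
  | mid h p q _ => f.IsTree ∧ f.loc = h ∧ (f.pos s = p ∨ f.pos s = q)
  | left h p _ _ => f.IsTree ∧ f.loc = h ∧ f.pos s = p
  | right h p q i => (f.IsTree ∧ f.loc = h ∧ f.pos s = q) ∨ f = left h p q i

/-- Rays of paths have different numbers, unless they belong to the same path with four vertices. -/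
def Compat (e f : Spec) : Prop :=
  ¬ e.IsTree → ¬ f.IsTree → e.idx = f.idx →
    ∃ h p q i, (e = left h p q i ∧ f = right h p q i) ∨ (e = right h p q i ∧ f = left h p q i)

/-- The family of sets of positions of the levels of a tree. -/
structure Positions (P : ℕ → ℤ → Prop) : Prop where
  zero : ∀ b, P 0 b → b = 0
  succ : ∀ h b, P (h + 1) b → ∃ p c, P h p ∧ 2 * |c| ≤ s.k ∧ b = -(s.M * (p + p + c))
  bound : ∀ h b, P h b → 8 * s.M * |b| ≤ s.B

variable {s} {P : ℕ → ℤ → Prop}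

lemma Positions.dvd (hP : Positions s P) {h : ℕ} {b : ℤ} (hb : P h b) : s.M ∣ b := by
  cases h with
  | zero => rw [hP.zero b hb]; exact dvd_zero _
  | succ h =>
    obtain ⟨p, c, -, -, rfl⟩ := hP.succ h b hb
    exact (Dvd.intro _ rfl).neg_right

lemma Positions.abs_bound (hP : Positions s P) {h : ℕ} {b : ℤ} (hb : P h b) :
    512 * |b| ≤ s.B := by
  have h1 := hP.bound h b hb
  have h2 := s.one_le_k
  have h3 : 0 ≤ |b| := abs_nonneg b
  unfold Scale.M at h1
  nlinarith

/-- Residues modulo the gap distinguish small numbers. -/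
lemma eq_of_dvd_of_small {x y : ℤ} (h : s.M ∣ x - y) (hx : |x| ≤ 16 * s.k) (hy : |y| ≤ 16 * s.k) :
    x = y := by
  have : x - y = 0 := by
    apply Int.eq_zero_of_abs_lt_dvd h
    have := abs_sub x y
    have := s.one_le_k
    unfold Scale.M
    linarith
  linarith

/-- The positions of the middle vertices of paths are not positions of vertices of the tree. -/
lemma Positions.mid_notMem (hP : Positions s P) {h : ℕ} {p q i : ℤ} (hg : Gap s P h p q i) :
    ¬ P (h + 1) (-(s.M * (p + q + i))) := by
  intro hb
  obtain ⟨p', c, hp', hc, he⟩ := hP.succ h _ hb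
  have h1 : p + q + i = p' + p' + c := by
    have := s.M_pos
    have h2 : s.M * (p + q + i) = s.M * (p' + p' + c) := by linarith
    exact mul_left_cancel₀ this.ne' h2
  have hk := s.one_le_k
  have hi1 := hg.lt_idx
  have hi2 := hg.idx_le
  obtain ⟨hc1, hc2⟩ := abs_le.1 (show |c| ≤ s.k by linarith [abs_nonneg c])
  have h3 : i = c := by
    apply eq_of_dvd_of_small (s := s)
    · have : i - c = p' + p' - (p + q) := by linarith
      rw [this]
      exact dvd_sub (dvd_add (hP.dvd hp') (hP.dvd hp'))
        (dvd_add (hP.dvd hg.left_mem) (hP.dvd hg.right_mem))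
    · rw [abs_le]; constructor <;> linarith
    · rw [abs_le]; constructor <;> linarith
  have := le_abs_self c
  linarith

lemma add_le_of_dvd {a b : ℤ} (ha : s.M ∣ a) (hb : s.M ∣ b)
    (hab : a < b) : a + 64 * s.k ≤ b := by
  have h1 : s.M ∣ b - a := dvd_sub hb ha
  have := Int.le_of_dvd (by linarith) h1
  unfold Scale.M at this
  linarith

lemma Gap.trichotomy {h : ℕ} {p q i p' q' i' : ℤ} (hg : Gap s P h p q i)
    (hg' : Gap s P h p' q' i') : (p' = p ∧ q' = q) ∨ q ≤ p' ∨ q' ≤ p := by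
  rcases hg.gap p' hg'.left_mem with h1 | h1
  · rcases hg.gap q' hg'.right_mem with h2 | h2
    · exact Or.inr (Or.inr h2)
    · left
      have h3 := hg'.gap p hg.left_mem
      have h4 := hg'.gap q hg.right_mem
      have := hg.lt
      have := hg'.lt
      omega
  · exact Or.inr (Or.inl h1)

lemma WF.pos_bound (hP : Positions s P) {f : Spec} (hf : WF s P f) : 2 * |f.pos s| ≤ s.B := by
  have hk := s.one_le_k
  have hkB := s.k_le_B
  have hlink : ∀ h p q i, Gap s P h p q i → 2 * |s.M * (p + q + i)| ≤ s.B ∧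
      512 * |p| ≤ s.B ∧ 512 * |q| ≤ s.B ∧ |i| ≤ s.k := by
    intro h p q i hg
    have h1 := hP.bound _ _ hg.left_mem
    have h2 := hP.bound _ _ hg.right_mem
    have h3 := hg.lt_idx
    have h4 := hg.idx_le
    have h5 : |i| ≤ s.k := by rw [abs_le]; constructor <;> linarith
    refine ⟨?_, hP.abs_bound hg.left_mem, hP.abs_bound hg.right_mem, h5⟩
    have hM := s.M_pos
    rw [abs_mul, abs_of_pos hM]
    have h6 : |p + q + i| ≤ |p| + |q| + |i| := abs_add_three p q i
    have h7 : s.M * |p + q + i| ≤ s.M * (|p| + |q| + s.k) :=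
      mul_le_mul_of_nonneg_left (by linarith) hM.le
    have h8 : s.M * s.k = 64 * s.k * s.k := by unfold Scale.M; ring
    nlinarith
  have hBp : 0 ≤ s.B := by linarith [s.B_ge]
  have hkk := s.k_le
  cases f with
  | root => simpa [pos] using hBp
  | tree h p b =>
    have := hP.abs_bound hf.2.1
    have := abs_nonneg (pos s (tree h p b))
    linarith
  | mid h p q i => simp only [pos, abs_neg]; exact (hlink h p q i hf).1
  | left h p q i =>
    obtain ⟨-, h1, h2, h3⟩ := hlink h p q i hf
    have := abs_sub p i
    simp only [pos]; linarith
  | right h p q i =>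
    obtain ⟨-, h1, h2, h3⟩ := hlink h p q i hf
    have h4 := abs_add_three q (-(4 * s.k)) i
    rw [abs_neg, abs_of_pos (show 0 < 4 * s.k by linarith)] at h4
    simp only [pos, sub_eq_add_neg]; linarith

lemma dev_nonneg (f : Spec) : 0 ≤ f.dev s := by
  have := s.B_ge
  cases f <;> simp only [dev, Scale.lift, le_refl]
  positivity

lemma dev_le (f : Spec) : f.dev s ≤ s.lift := by
  have : 0 ≤ s.lift := dev_nonneg (s := s) (mid 0 0 0 0)
  cases f <;> simp [dev, this]

lemma Gap.bounds (hP : Positions s P) {h : ℕ} {p q i : ℤ} (hg : Gap s P h p q i) :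
    512 * |p| ≤ s.B ∧ 512 * |q| ≤ s.B ∧ 1 ≤ i ∧ i ≤ s.k ∧ p + 64 * s.k ≤ q ∧
      256 * (q - p) ≤ s.B := by
  have hk := s.one_le_k
  have h1 := hP.abs_bound hg.left_mem
  have h2 := hP.abs_bound hg.right_mem
  refine ⟨h1, h2, by linarith [hg.lt_idx], hg.idx_le,
    add_le_of_dvd (hP.dvd hg.left_mem) (hP.dvd hg.right_mem) hg.lt, ?_⟩
  have := neg_abs_le p
  have := le_abs_self q
  linarith

lemma IsTree.locY_eq {f : Spec} (h : f.IsTree) : f.locY s = f.pos s ^ 2 ∧ f.dev s = 0 := by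
  cases f <;> simp [IsTree, locY, pos, dev] at h ⊢

lemma WF.mem_of_isTree {f : Spec} (hf : WF s P f) (h : f.IsTree) : P f.loc (f.pos s) := by
  cases f with
  | root => exact hf
  | tree h p b => exact hf.2.1
  | _ => simp [IsTree] at h

lemma WF.locY_bounds (hP : Positions s P) {f : Spec} (hf : WF s P f) :
    0 ≤ f.locY s ∧ f.locY s ≤ s.Z * s.B ∧
      (¬ f.IsTree → f.pos s ^ 2 + 10 * s.B ^ 2 ≤ f.locY s) := by
  have hk := s.one_le_k
  have hkB := s.k_le
  have hB := s.B_ge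
  have hl := s.lift_ge
  have hZ := s.Z_ge
  have hpb := hf.pos_bound hP
  have hB2 : 0 ≤ s.B ^ 2 := sq_nonneg _
  have hp2 : f.pos s ^ 2 ≤ s.B ^ 2 := by
    apply sq_le_sq'
    · have := neg_abs_le (f.pos s); have := abs_nonneg (f.pos s); linarith
    · have := le_abs_self (f.pos s); have := abs_nonneg (f.pos s); linarith
  have hZB : s.Z ≤ s.Z * s.B := by nlinarith
  have hlink : ∀ h p q i, Gap s P h p q i →
      q ^ 2 ≤ s.B ^ 2 ∧ 0 ≤ i * (q - p) ∧ i * (q - p) ≤ s.B ^ 2 ∧ i ^ 2 ≤ s.B ^ 2 ∧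
      64 * s.Z ≤ s.Z * (q - p) ∧ 256 * (s.Z * (q - p)) ≤ s.Z * s.B ∧
      4096 * (s.Z * i) ≤ s.Z * s.B ∧ 0 ≤ s.Z * i := by
    intro h p q i hg
    obtain ⟨h1, h2, h3, h4, h5, h6⟩ := hg.bounds hP
    have := neg_abs_le q
    have := le_abs_self q
    have := abs_nonneg q
    have hZ0 : 0 ≤ s.Z := by linarith
    refine ⟨by apply sq_le_sq' <;> linarith, mul_nonneg (by linarith) (by linarith), ?_,
      by apply sq_le_sq' <;> linarith, ?_, ?_, ?_, mul_nonneg hZ0 (by linarith)⟩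
    · nlinarith
    · nlinarith
    · nlinarith
    · nlinarith
  cases f with
  | root => simp [locY, IsTree]; nlinarith
  | tree h p b => simp only [locY, IsTree, not_true, false_imp_iff, and_true]
                  exact ⟨sq_nonneg _, by linarith⟩
  | mid h p q i =>
    simp only [locY]
    have := sq_nonneg (pos s (mid h p q i))
    refine ⟨by linarith, by linarith, fun _ => by linarith⟩
  | left h p q i =>
    obtain ⟨h1, h2, h3, h4, h5, h6, h7, h8⟩ := hlink h p q i hf
    simp only [locY]
    have := sq_nonneg q
    have := sq_nonneg i
    refine ⟨by linarith, by linarith, fun _ => by linarith⟩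
  | right h p q i =>
    obtain ⟨h1, h2, h3, h4, h5, h6, h7, h8⟩ := hlink h p q i hf
    obtain ⟨-, -, h9, h10, -, -⟩ := hf.bounds hP
    simp only [locY]
    have := sq_nonneg q
    have := sq_nonneg i
    have h11 : s.Z - 2 * i ≤ (s.Z - 2 * i) * (4 * s.k - i) := by
      have : 0 ≤ s.Z - 2 * i := by linarith [s.sq_ge]
      nlinarith
    have h12 : (s.Z - 2 * i) * (4 * s.k - i) ≤ s.Z * (4 * s.k) := by
      apply mul_le_mul <;> linarith
    have h13 : 4096 * (s.Z * s.k) ≤ s.Z * s.B := by nlinarith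
    have := s.sq_ge
    refine ⟨by linarith, by linarith, fun _ => by linarith⟩

end Spec
end RayGraph

namespace RayGraph
namespace Spec

variable {s : Scale} {P : ℕ → ℤ → Prop}

lemma pos_ne_aux {p q b p' q' b' : ℤ} (hp : s.M ∣ p) (hq : s.M ∣ q) (hp' : s.M ∣ p')
    (hq' : s.M ∣ q') (hb : |b| ≤ s.k) (hb' : |b'| ≤ s.k)
    (h : -(s.M * (p + q + b)) = -(s.M * (p' + q' + b'))) : b = b' := by
  have hk := s.one_le_k
  have h1 : p + q + b = p' + q' + b' := mul_left_cancel₀ s.M_pos.ne' (by linarith)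
  apply eq_of_dvd_of_small (s := s)
  · have : b - b' = p' + q' - (p + q) := by linarith
    rw [this]
    exact dvd_sub (dvd_add hp' hq') (dvd_add hp hq)
  · linarith
  · linarith

/-- Different rays at the same location have different positions: modulo the gap, the position
at a link reveals the number of the link, and that of a vertex reveals its child number. -/
lemma pos_ne (hP : Positions s P) {e f : Spec} (he : WF s P e) (hf : WF s P f) (hef : e ≠ f)
    (hc : Compat e f) (hl : e.loc = f.loc) : e.pos s ≠ f.pos s := by
  have hk := s.one_le_k
  have hlow : ∀ {h p q i}, Gap s P h p q i → 0 < i ∧ |i| ≤ s.k := by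
    intro h p q i hg
    have := hg.lt_idx
    have := hg.idx_le
    exact ⟨by linarith, by rw [abs_le]; constructor <;> linarith⟩
  -- a coincidence of the numbers of paths leaves the two internal vertices of one path
  have hlink : ¬ e.IsTree → ¬ f.IsTree → e.idx = f.idx → e.pos s ≠ f.pos s := by
    intro h1 h2 h3 h4
    obtain ⟨h, p, q, i, ⟨rfl, rfl⟩ | ⟨rfl, rfl⟩⟩ := hc h1 h2 h3
    all_goals
      simp only [pos] at h4
      obtain ⟨-, -, h5, h6, h7, -⟩ := Gap.bounds hP he
      linarith
  -- a position that is not a multiple of the gap differs from all that are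
  have hnear : ∀ {a b i : ℤ}, s.M ∣ a → s.M ∣ b → |i| ≤ 16 * s.k → i ≠ 0 → a ≠ b + i := by
    intro a b i ha hb hi hi0 hab
    apply hi0
    apply eq_of_dvd_of_small (s := s) (y := 0) _ hi (by rw [abs_zero]; linarith)
    have : i - 0 = a - b := by linarith
    rw [this]; exact dvd_sub ha hb
  have hnear2 : ∀ {a b i j : ℤ}, s.M ∣ a → s.M ∣ b → |i| ≤ 16 * s.k → |j| ≤ 16 * s.k →
      a + i = b + j → i = j := by
    intro a b i j ha hb hi hj hab
    apply eq_of_dvd_of_small (s := s) _ hi hj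
    have : i - j = b - a := by linarith
    rw [this]; exact dvd_sub hb ha
  -- positions on the chain are multiples of the gap, those near it are not
  have hM : ∀ x, s.M ∣ -(s.M * x) := fun x => (Dvd.intro _ rfl).neg_right
  have hsm : ∀ {h p q i}, Gap s P h p q i → |-i| ≤ 16 * s.k ∧ |-(4 * s.k) + i| ≤ 16 * s.k ∧
      -i ≠ 0 ∧ -(4 * s.k) + i ≠ 0 := by
    intro h p q i hg
    have := hg.lt_idx
    have := hg.idx_le
    refine ⟨by rw [abs_le]; constructor <;> linarith, by rw [abs_le]; constructor <;> linarith,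
      by linarith, by linarith⟩
  cases e with
  | root =>
    cases f with
    | root => exact absurd rfl hef
    | tree h p b => simp [loc] at hl
    | mid h p q i => simp [loc] at hl
    | left h p q i =>
      have := hnear (dvd_zero s.M) (hP.dvd hf.left_mem) (hsm hf).1 (hsm hf).2.2.1
      simpa [pos, sub_eq_add_neg] using this
    | right h p q i =>
      have := hnear (dvd_zero s.M) (hP.dvd hf.right_mem) (hsm hf).2.1 (hsm hf).2.2.2
      simpa [pos, sub_eq_add_neg, add_assoc] using this
  | tree h p b =>
    have hb : |b| ≤ s.k := by linarith [he.2.2, abs_nonneg b]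
    cases f with
    | root => simp [loc] at hl
    | tree h' p' b' =>
      have hb' : |b'| ≤ s.k := by linarith [hf.2.2, abs_nonneg b']
      intro h1
      simp only [pos] at h1
      have h2 := pos_ne_aux (hP.dvd he.1) (hP.dvd he.1) (hP.dvd hf.1) (hP.dvd hf.1) hb hb' h1
      simp only [loc, Nat.add_right_cancel_iff] at hl
      subst hl h2
      have h3 : p + p + b = p' + p' + b := mul_left_cancel₀ s.M_pos.ne' (by linarith)
      have h4 : p = p' := by linarith
      exact hef (by rw [h4])
    | mid h' p' q' i' =>
      simp only [loc, Nat.add_right_cancel_iff] at hl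
      subst hl
      intro h1
      apply hP.mid_notMem hf
      have := he.2.1
      rw [h1] at this
      exact this
    | left h' p' q' i' =>
      have := hnear (hM (p + p + b)) (hP.dvd hf.left_mem) (hsm hf).1 (hsm hf).2.2.1
      simpa [pos, sub_eq_add_neg] using this
    | right h' p' q' i' =>
      have := hnear (hM (p + p + b)) (hP.dvd hf.right_mem) (hsm hf).2.1 (hsm hf).2.2.2
      simpa [pos, sub_eq_add_neg, add_assoc] using this
  | mid h p q i =>
    cases f with
    | root => simp [loc] at hl
    | tree h' p' b' =>
      simp only [loc, Nat.add_right_cancel_iff] at hl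
      subst hl
      intro h1
      apply hP.mid_notMem he
      have := hf.2.1
      rw [← h1] at this
      exact this
    | mid h' p' q' i' =>
      intro h1
      refine hlink (by simp [IsTree]) (by simp [IsTree]) ?_ h1
      exact pos_ne_aux (hP.dvd he.left_mem) (hP.dvd he.right_mem) (hP.dvd hf.left_mem)
        (hP.dvd hf.right_mem) (hlow he).2 (hlow hf).2 h1
    | left h' p' q' i' =>
      have := hnear (hM (p + q + i)) (hP.dvd hf.left_mem) (hsm hf).1 (hsm hf).2.2.1
      simpa [pos, sub_eq_add_neg] using this
    | right h' p' q' i' =>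
      have := hnear (hM (p + q + i)) (hP.dvd hf.right_mem) (hsm hf).2.1 (hsm hf).2.2.2
      simpa [pos, sub_eq_add_neg, add_assoc] using this
  | left h p q i =>
    cases f with
    | root =>
      have := hnear (dvd_zero s.M) (hP.dvd he.left_mem) (hsm he).1 (hsm he).2.2.1
      simpa [pos, sub_eq_add_neg] using this.symm
    | tree h' p' b' =>
      have := hnear (hM (p' + p' + b')) (hP.dvd he.left_mem) (hsm he).1 (hsm he).2.2.1
      simpa [pos, sub_eq_add_neg] using this.symm
    | mid h' p' q' i' =>
      have := hnear (hM (p' + q' + i')) (hP.dvd he.left_mem) (hsm he).1 (hsm he).2.2.1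
      simpa [pos, sub_eq_add_neg] using this.symm
    | left h' p' q' i' =>
      intro h1
      refine hlink (by simp [IsTree]) (by simp [IsTree]) ?_ h1
      have := hnear2 (hP.dvd he.left_mem) (hP.dvd hf.left_mem) (hsm he).1 (hsm hf).1
        (by simpa [pos, sub_eq_add_neg] using h1)
      simp only [idx]; linarith
    | right h' p' q' i' =>
      intro h1
      have := hnear2 (hP.dvd he.left_mem) (hP.dvd hf.right_mem) (hsm he).1 (hsm hf).2.1
        (by simpa [pos, sub_eq_add_neg, add_assoc] using h1)
      have h2 := Gap.idx_le he
      have h3 := Gap.idx_le hf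
      linarith
  | right h p q i =>
    cases f with
    | root =>
      have := hnear (dvd_zero s.M) (hP.dvd he.right_mem) (hsm he).2.1 (hsm he).2.2.2
      simpa [pos, sub_eq_add_neg, add_assoc] using this.symm
    | tree h' p' b' =>
      have := hnear (hM (p' + p' + b')) (hP.dvd he.right_mem) (hsm he).2.1 (hsm he).2.2.2
      simpa [pos, sub_eq_add_neg, add_assoc] using this.symm
    | mid h' p' q' i' =>
      have := hnear (hM (p' + q' + i')) (hP.dvd he.right_mem) (hsm he).2.1 (hsm he).2.2.2
      simpa [pos, sub_eq_add_neg, add_assoc] using this.symm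
    | left h' p' q' i' =>
      intro h1
      have := hnear2 (hP.dvd he.right_mem) (hP.dvd hf.left_mem) (hsm he).2.1 (hsm hf).1
        (by simpa [pos, sub_eq_add_neg, add_assoc] using h1)
      have h2 := Gap.idx_le he
      have h3 := Gap.idx_le hf
      linarith
    | right h' p' q' i' =>
      intro h1
      refine hlink (by simp [IsTree]) (by simp [IsTree]) ?_ h1
      have := hnear2 (hP.dvd he.right_mem) (hP.dvd hf.right_mem) (hsm he).2.1 (hsm hf).2.1
        (by simpa [pos, sub_eq_add_neg, add_assoc] using h1)
      simp only [idx]; linarith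

/-! ### Rays hung on the chain -/

lemma WF.locX_bound (hP : Positions s P) {f : Spec} (hf : WF s P f) :
    |f.locX s| ≤ s.R * s.B ∧ |f.locY s| ≤ s.R * s.B ∧ |f.locX s - f.locY s| ≤ s.R * s.B ∧
      8 * f.locY s ≤ s.R := by
  have hB := s.B_ge
  have hR := s.R_pos
  have h1 := hf.pos_bound hP
  obtain ⟨h2, h3, -⟩ := hf.locY_bounds hP
  have h4 := s.R_ge_Z
  have h5 := s.Z_ge
  have h6 := dev_nonneg (s := s) f
  have h7 := dev_le (s := s) f
  have h8 : s.Z ≤ s.Z * s.B := by nlinarith [s.lift_ge, sq_nonneg s.B]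
  have h9 : 2 * (s.R * |f.pos s|) ≤ s.R * s.B := by nlinarith
  have h10 : 4 * s.R ≤ s.R * s.B := by nlinarith
  have h11 := abs_mul s.R (f.pos s)
  rw [abs_of_pos hR] at h11
  have h12 := abs_add_le (s.R * f.pos s) (f.dev s)
  have h13 := abs_sub (f.locX s) (f.locY s)
  rw [abs_of_nonneg h6] at h12
  rw [abs_of_nonneg h2] at h13 ⊢
  unfold locX at *
  refine ⟨?_, ?_, ?_, ?_⟩ <;> linarith

/-- The cutoff of a ray that is hung on the positions `p` and `q` is small, and so is its part
that does not depend on the position. -/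
lemma hang_bounds {p q b : ℤ} (hp : 512 * |p| ≤ s.B) (hq : 512 * |q| ≤ s.B) (hb : |b| ≤ s.k)
    (h : 2 * |s.M * (p + q + b)| ≤ s.B) :
    |(s.M * (p + q + b)) ^ 2 - s.M * (p + q + b) ^ 2 - p * q - b * p + 1| ≤ 5 * s.B ^ 2 ∧
      |hang s p q b| ≤ s.R * s.B := by
  have hB := s.B_ge
  have hkB := s.k_le
  have hR := s.R_ge_Z
  have hZ := s.Z_ge
  have hl := s.lift_ge
  have hR0 := s.R_pos
  have hM : 1 ≤ s.M := s.M_pos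
  unfold hang
  set σ := p + q + b
  set A := s.M * σ with hA
  have hA2 : A ^ 2 ≤ s.B ^ 2 := by
    apply sq_le_sq' <;> linarith [abs_le.1 (le_refl |A|), neg_abs_le A, le_abs_self A, abs_nonneg A]
  have hσ2 : s.M * σ ^ 2 ≤ A ^ 2 := by
    have : A ^ 2 = s.M * (s.M * σ ^ 2) := by rw [hA]; ring
    have h0 : 0 ≤ s.M * σ ^ 2 := by positivity
    rw [this]; nlinarith
  have h0 : 0 ≤ s.M * σ ^ 2 := by positivity
  have hpq : |p * q| ≤ s.B ^ 2 := by
    rw [abs_mul, sq]; apply mul_le_mul <;> linarith [abs_nonneg p, abs_nonneg q]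
  have hbp : |b * p| ≤ s.B ^ 2 := by
    rw [abs_mul, sq]; apply mul_le_mul <;> linarith [abs_nonneg p, abs_nonneg b, s.one_le_k]
  have h1 : 1 ≤ s.B ^ 2 := by nlinarith
  obtain ⟨a1, a2⟩ := abs_le.1 hpq
  obtain ⟨a3, a4⟩ := abs_le.1 hbp
  have a5 := sq_nonneg A
  have h2 : |A ^ 2 - s.M * σ ^ 2 - p * q - b * p + 1| ≤ 5 * s.B ^ 2 := by
    rw [abs_le]; constructor <;> linarith
  refine ⟨h2, ?_⟩
  refine (abs_add_le _ _).trans ?_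
  have h3 : |s.R * A| = s.R * |A| := by rw [abs_mul, abs_of_pos hR0]
  rw [h3]
  have h4 : 2 * (s.R * |A|) ≤ s.R * s.B := by nlinarith
  have h5 : s.R ≤ s.R * s.B := by nlinarith
  have h6 : s.Z ≤ s.Z * s.B := by nlinarith
  have h7 : 2 * s.R ≤ s.R * s.B := by nlinarith
  linarith

/-- A ray that is hung on the chain of the level below: it sees a point of that location on the
good side exactly when the point lies above the secant of the parabola. -/
lemma hang_good (hP : Positions s P) {e f : Spec} (he : WF s P e) (hf : WF s P f) {p q b : ℤ}
    (hp : 512 * |p| ≤ s.B) (hq : 512 * |q| ≤ s.B) (hb : |b| ≤ s.k)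
    (hpos : e.pos s = -(s.M * (p + q + b))) (hslope : e.slope s = hang s p q b)
    (hY : e.locY s = e.pos s ^ 2 + e.dev s) (hlev : e.lev = e.loc) (hl : f.loc + 1 = e.lev) :
    (2 ≤ (f.locY s - f.pos s ^ 2) + (f.pos s - p) * (f.pos s - q) - b * (f.pos s - p) →
      DualRay.Good s.D (e.dual s) (f.dual s)) ∧
    ((f.locY s - f.pos s ^ 2) + (f.pos s - p) * (f.pos s - q) - b * (f.pos s - p) ≤ 0 →
      ¬ DualRay.Good s.D (e.dual s) (f.dual s)) := by
  have hB := s.B_ge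
  have hR0 := s.R_pos
  have hD := s.D_ge
  have hD0 := s.D_pos
  rw [good_iff]
  obtain ⟨x1, x2, x3, -⟩ := he.locX_bound hP
  obtain ⟨y1, y2, y3, -⟩ := hf.locX_bound hP
  have hpe := he.pos_bound hP
  have hpf := hf.pos_bound hP
  have de0 := dev_nonneg (s := s) e
  have de1 := dev_le (s := s) e
  have df0 := dev_nonneg (s := s) f
  have df1 := dev_le (s := s) f
  have hfe : frX s e e = -s.D + e.locX s := by
    simp only [frX, hlev]; ring
  have hff : frX s e f = f.locX s := by
    have : ((f.loc : ℤ) + 1 - e.lev) = 0 := by omega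
    simp [frX, this]
  have hye : frY s e e = e.locX s - e.locY s := by
    have : ((e.loc : ℤ) + 1 - e.lev) = 1 := by omega
    simp [frY, this]
  have hyf : frY s e f = f.locY s := by
    have : ((f.loc : ℤ) + 1 - e.lev) = 0 := by omega
    simp [frY, this]
  rw [hfe, hff, hye, hyf]
  have hA : 2 * |s.M * (p + q + b)| ≤ s.B := by rw [hpos, abs_neg] at hpe; exact hpe
  obtain ⟨c1, c2⟩ := hang_bounds hp hq hb hA
  set c := (s.M * (p + q + b)) ^ 2 - s.M * (p + q + b) ^ 2 - p * q - b * p + 1 with hc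
  have hid := hang_identity (D := s.D) (M := s.M) (R := s.R) (S := hang s p q b) (A := e.pos s)
    (σ := p + q + b) (p := p) (q := q) (b := b) (a := f.pos s) (Y := f.locY s) (dv := f.dev s)
    (dv' := e.dev s) (c := c) rfl hpos rfl (by rw [hc, hpos]; ring)
    (by rw [hc, hpos]; unfold hang; ring)
  have hQ : s.D * (f.locY s - (e.locX s - e.locY s)) - e.slope s * (f.locX s - (-s.D + e.locX s)) =
      s.D * ((f.locY s - f.pos s ^ 2) + (f.pos s - p) * (f.pos s - q) - b * (f.pos s - p) - 1)
        - (c * s.R * (f.pos s - e.pos s) + hang s p q b * (f.dev s - e.dev s)) := by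
    rw [← hid, hslope]
    have h1 : e.locX s - e.locY s = s.R * e.pos s - e.pos s ^ 2 := by
      rw [hY]; unfold locX; ring
    rw [h1]; rfl
  -- the error term is smaller than the denominator
  have hE : |c * s.R * (f.pos s - e.pos s) + hang s p q b * (f.dev s - e.dev s)| < s.D := by
    refine lt_of_le_of_lt (abs_add_le _ _) ?_
    rw [abs_mul, abs_mul, abs_mul, abs_of_pos hR0]
    have h1 : |f.pos s - e.pos s| ≤ s.B := by
      have := abs_sub (f.pos s) (e.pos s); linarith
    have h2 : |f.dev s - e.dev s| ≤ s.B ^ 3 := by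
      rw [abs_le]; unfold Scale.lift at *; constructor <;> linarith
    have h3 : |c| * s.R * |f.pos s - e.pos s| ≤ 5 * s.B ^ 2 * s.R * s.B := by gcongr
    have h4 : |hang s p q b| * |f.dev s - e.dev s| ≤ s.R * s.B * s.B ^ 3 := by gcongr
    have h5 : s.B ^ 3 * s.R ≤ s.B ^ 11 * s.R := by gcongr <;> linarith
    have h6 : s.B ^ 4 * s.R ≤ s.B ^ 11 * s.R := by gcongr <;> linarith
    have h7 : 0 < s.B ^ 11 * s.R := by positivity
    have h8 : 5 * s.B ^ 2 * s.R * s.B = 5 * (s.B ^ 3 * s.R) := by ring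
    have h9 : s.R * s.B * s.B ^ 3 = s.B ^ 4 * s.R := by ring
    linarith
  have hRB : s.R * s.B * 4096 ≤ s.D := by
    have : s.B ^ 1 * s.R ≤ s.B ^ 11 * s.R := by gcongr <;> linarith
    rw [pow_one] at this
    linarith
  have hX : 0 < f.locX s - (-s.D + e.locX s) := by
    have := neg_abs_le (f.locX s)
    have := le_abs_self (e.locX s)
    have : 0 ≤ s.R * s.B := by positivity
    linarith
  rw [hQ]
  obtain ⟨e1, e2⟩ := abs_lt.1 hE
  generalize (f.locY s - f.pos s ^ 2) + (f.pos s - p) * (f.pos s - q) - b * (f.pos s - p) = G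
  constructor
  · intro h
    refine mul_pos ?_ hX
    have := mul_le_mul_of_nonneg_left (show 1 ≤ G - 1 by linarith) hD0.le
    linarith
  · intro h
    refine not_lt.2 (mul_nonpos_of_nonpos_of_nonneg ?_ hX.le)
    have := mul_le_mul_of_nonneg_left (show G - 1 ≤ -1 by linarith) hD0.le
    linarith

end Spec
end RayGraph

namespace RayGraph
namespace Spec

variable {s : Scale} {P : ℕ → ℤ → Prop}

lemma slope_le (hP : Positions s P) {e : Spec} (he : WF s P e) (hl : e.lev = e.loc) :
    10 * e.slope s ≤ s.D := by
  have hB := s.B_ge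
  have hD0 := s.D_pos
  have hR0 := s.R_pos
  have hD := s.D_ge
  have hRB : s.R * s.B * 4096 ≤ s.D := by
    have : s.B ^ 1 * s.R ≤ s.B ^ 11 * s.R := by gcongr <;> linarith
    rw [pow_one] at this
    linarith
  have hRB0 : 0 ≤ s.R * s.B := by positivity
  have hpb := he.pos_bound hP
  cases e with
  | root => simp only [slope]; linarith
  | tree h p b =>
    have hp := hP.abs_bound he.1
    have hb : |b| ≤ s.k := by linarith [he.2.2, abs_nonneg b]
    simp only [pos, abs_neg] at hpb
    have := le_of_abs_le (hang_bounds hp hp hb hpb).2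
    simp only [slope]; linarith
  | mid h p q i =>
    obtain ⟨hp, hq, hi0, hi, -⟩ := Gap.bounds hP he
    simp only [pos, abs_neg] at hpb
    have hb : |i| ≤ s.k := by rw [abs_le]; constructor <;> linarith
    have := le_of_abs_le (hang_bounds hp hq hb hpb).2
    simp only [slope]; linarith
  | left h p q i => simp [lev, loc] at hl
  | right h p q i => simp [lev, loc] at hl

/-- A ray that is not hung on the location of `f` sees `f` on the good side. -/
lemma good_of_loc_ne (hP : Positions s P) {e f : Spec} (he : WF s P e) (hf : WF s P f)
    (hef : e ≠ f) (hc : Compat e f) (hl : f.loc + 1 ≠ e.lev) :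
    DualRay.Good s.D (e.dual s) (f.dual s) := by
  have hB := s.B_ge
  have hR0 := s.R_pos
  have hD := s.D_ge
  have hD0 := s.D_pos
  have hRB : s.R * s.B * 4096 ≤ s.D := by
    have : s.B ^ 1 * s.R ≤ s.B ^ 11 * s.R := by gcongr <;> linarith
    rw [pow_one] at this
    linarith
  have hRB0 : 0 ≤ s.R * s.B := by positivity
  obtain ⟨x1, x2, x3, x4⟩ := he.locX_bound hP
  obtain ⟨y1, y2, y3, y4⟩ := hf.locX_bound hP
  rw [good_iff]
  by_cases hel : e.lev = e.loc
  · have hS := slope_le hP he hel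
    have hfe : frX s e e = -s.D + e.locX s := by
      simp only [frX, hel]; ring
    have hye : frY s e e = e.locX s - e.locY s := by
      have : ((e.loc : ℤ) + 1 - e.lev) = 1 := by omega
      simp [frY, this]
    rw [hfe, hye]
    by_cases hloc : e.loc = f.loc
    · have hne := pos_ne hP he hf hef hc hloc
      have hff : frX s e f = -s.D + f.locX s := by
        simp only [frX, hel, hloc]; ring
      have hyf : frY s e f = f.locX s - f.locY s := by
        have : ((f.loc : ℤ) + 1 - e.lev) = 1 := by omega
        simp [frY, this]
      rw [hff, hyf]
      obtain ⟨z1, -, -⟩ := he.locY_bounds hP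
      obtain ⟨z2, -, -⟩ := hf.locY_bounds hP
      have := good_of_same_loc (D := s.D) (R := s.R) (S := e.slope s)
        (dX := f.locX s - e.locX s) (dY := f.locY s - e.locY s) hR0 hD0 hS ?_ ?_
      · convert this using 1; ring
      · have h1 := s.R_ge_lift
        have h2 := s.lift_ge
        have h3 : s.lift ≤ s.Z * s.B * s.lift := by
          have : 1 ≤ s.Z * s.B := by nlinarith [s.Z_ge, sq_nonneg s.B]
          have : 0 ≤ s.lift := by nlinarith [sq_nonneg s.B]
          nlinarith
        have h4 := dev_nonneg (s := s) e
        have h5 := dev_le (s := s) e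
        have h6 := dev_nonneg (s := s) f
        have h7 := dev_le (s := s) f
        have h8 : f.locX s - e.locX s = s.R * (f.pos s - e.pos s) + (f.dev s - e.dev s) := by
          unfold locX; ring
        rw [h8]
        rcases lt_or_gt_of_ne hne with h | h
        · have : s.R * 1 ≤ s.R * (f.pos s - e.pos s) := by gcongr; omega
          have := le_abs_self (s.R * (f.pos s - e.pos s) + (f.dev s - e.dev s))
          linarith
        · have : s.R * (f.pos s - e.pos s) ≤ s.R * (-1) := by gcongr; omega
          have := neg_le_abs (s.R * (f.pos s - e.pos s) + (f.dev s - e.dev s))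
          linarith
      · have : |f.locY s - e.locY s| ≤ max (f.locY s) (e.locY s) := by
          rw [abs_le]; constructor <;>
            rcases max_cases (f.locY s) (e.locY s) with h | h <;> linarith
        rcases max_cases (f.locY s) (e.locY s) with h | h <;> linarith
    · obtain ⟨r, hr⟩ : ∃ r : ℤ, r = (f.loc : ℤ) + 1 - e.lev := ⟨_, rfl⟩
      have hff : frX s e f = -(r * s.D) + f.locX s := by simp only [frX, hr]
      have hyf : ∃ y, |y| ≤ s.R * s.B ∧ frY s e f = -((r / 2) * s.D) + y := by
        refine ⟨_, ?_, by simp only [frY, hr]; rfl⟩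
        split <;> assumption
      obtain ⟨y, hy, hyf⟩ := hyf
      have := good_of_far_one (D := s.D) (S := e.slope s) (w := 2 * (s.R * s.B)) (r := r)
        (x := f.locX s - e.locX s) (y := y - (e.locX s - e.locY s)) hD0 (by linarith) hS
        (by omega) ((abs_sub _ _).trans (by linarith)) ((abs_sub _ _).trans (by linarith))
      rw [hff, hyf]
      convert this using 1; ring
  · -- the rays for paths with four vertices
    have hel : e.lev = e.loc + 1 := by cases e <;> simp [lev, loc] at hel ⊢
    have hfe : frX s e e = e.locX s := by
      simp only [frX, hel]; push_cast; ring
    have hye : frY s e e = e.locY s := by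
      have : ((e.loc : ℤ) + 1 - e.lev) = 0 := by omega
      simp [frY, this]
    obtain ⟨r, hr⟩ : ∃ r : ℤ, r = (f.loc : ℤ) + 1 - e.lev := ⟨_, rfl⟩
    have hff : frX s e f = -(r * s.D) + f.locX s := by simp only [frX, hr]
    have hyf : ∃ y, |y| ≤ s.R * s.B ∧ frY s e f = -((r / 2) * s.D) + y := by
      refine ⟨_, ?_, by simp only [frY, hr]; rfl⟩
      split <;> assumption
    obtain ⟨y, hy, hyf⟩ := hyf
    have hS : 2 * (2 * (s.R * s.B)) < -e.slope s := by
      have hZ : 4096 * (4096 * (4096 * s.B)) ≤ s.Z := by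
        linarith [s.Z_ge, s.lift_ge, s.sq_ge]
      have hRZ : s.R * (4096 * (4096 * (4096 * s.B))) ≤ s.R * s.Z := by gcongr
      have hk := s.one_le_k
      have hM : 1 ≤ s.M := s.M_pos
      have hRB1 : 0 < s.R * s.B := mul_pos hR0 (by linarith)
      cases e with
      | left h p q i =>
        obtain ⟨-, -, -, -, h5, -⟩ := Gap.bounds hP he
        have : s.R * s.Z ≤ s.R * s.Z * (q - p) := by
          have : 0 ≤ s.R * s.Z := by linarith
          nlinarith
        simp only [slope]; linarith
      | right h p q i =>
        obtain ⟨-, -, h3, h4, -, -⟩ := Gap.bounds hP he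
        have h5 : s.B ≤ s.Z - 2 * i := by linarith [s.k_le]
        have h6 : 5 * s.B ≤ s.Z - 2 * i := by linarith [s.k_le]
        have h7 : s.R * (5 * s.B) ≤ s.R * (s.Z - 2 * i) := by gcongr
        have h8 : s.R * (s.Z - 2 * i) ≤ (s.Z - 2 * i) * (s.M * s.R) := by
          have : 0 ≤ s.R * (s.Z - 2 * i) := mul_nonneg hR0.le (by linarith)
          nlinarith
        simp only [slope]; linarith
      | root => simp [lev, loc] at hel
      | tree h p b => simp [lev, loc] at hel
      | mid h p q i => simp [lev, loc] at hel
    have := good_of_far_zero (D := s.D) (S := e.slope s) (w := 2 * (s.R * s.B)) (r := r)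
        (x := f.locX s - e.locX s) (y := y - e.locY s) (by linarith) hD0 (by linarith) hS
        (by omega) ((abs_sub _ _).trans (by linarith)) ((abs_sub _ _).trans (by linarith))
    rw [hfe, hye, hff, hyf]
    convert this using 1; ring

/-- The factored secant of the parabola is far above the chain except at its endpoints. -/
lemma two_le_secant {M k p q b a : ℤ} (hk : 1 ≤ k) (hM : M = 64 * k) (hpq : p ≤ q) (hb : |b| ≤ k)
    (h : a + M ≤ p ∨ q + M ≤ a) :
    2 ≤ (a - p) * (a - q) - b * (a - p) := by
  obtain ⟨b1, b2⟩ := abs_le.1 hb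
  have he : (a - p) * (a - q) - b * (a - p) = (a - p) * (a - q - b) := by ring
  rw [he]
  rcases h with h | h
  · have h1 : (a - p) * (a - q - b) = (p - a) * (q - a + b) := by ring
    rw [h1]
    have h2 : 2 ≤ p - a := by linarith
    have h3 : 1 ≤ q - a + b := by linarith
    nlinarith
  · have h2 : 2 ≤ a - p := by linarith
    have h3 : 1 ≤ a - q - b := by linarith
    nlinarith

/-- The points that do not belong to the tree lie far above all secants on which rays are hung. -/
lemma hang_good_of_not_isTree (hP : Positions s P) {f : Spec} (hf : WF s P f) (hft : ¬ f.IsTree)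
    {p q b : ℤ} (hp : 512 * |p| ≤ s.B) (hq : 512 * |q| ≤ s.B) (hb : |b| ≤ s.k) :
    2 ≤ (f.locY s - f.pos s ^ 2) + (f.pos s - p) * (f.pos s - q) - b * (f.pos s - p) := by
  obtain ⟨-, -, h1⟩ := hf.locY_bounds hP
  have h1 := h1 hft
  have hB := s.B_ge
  have hk := s.k_le
  have hpb := hf.pos_bound hP
  have hap := abs_sub (f.pos s) p
  have haq := abs_sub (f.pos s) q
  have h2 : |(f.pos s - p) * (f.pos s - q)| ≤ s.B ^ 2 := by
    rw [abs_mul, sq]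
    apply mul_le_mul <;>
      linarith [abs_nonneg (f.pos s - q), abs_nonneg (f.pos s), abs_nonneg p, abs_nonneg q]
  have h3 : |b * (f.pos s - p)| ≤ s.B ^ 2 := by
    rw [abs_mul, sq]
    apply mul_le_mul <;>
      linarith [abs_nonneg (f.pos s - p), abs_nonneg (f.pos s), abs_nonneg p,
        abs_nonneg b, s.one_le_k]
  have h4 := neg_abs_le ((f.pos s - p) * (f.pos s - q))
  have h5 := le_abs_self (b * (f.pos s - p))
  nlinarith

/-- A vertex of the tree cuts off the point at the position of its parent. -/
lemma good_tree (hP : Positions s P) {h : ℕ} {p b : ℤ} {f : Spec} (he : WF s P (tree h p b))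
    (hf : WF s P f) (hl : f.loc = h) :
    DualRay.Good s.D ((tree h p b).dual s) (f.dual s) ↔ ¬ Par s (tree h p b) f := by
  have hp := hP.abs_bound he.1
  have hb : |b| ≤ s.k := by linarith [he.2.2, abs_nonneg b]
  obtain ⟨h1, h2⟩ := hang_good hP he hf hp hp hb rfl rfl (by simp [locY, dev]) rfl
    (by simp [lev, hl])
  by_cases hft : f.IsTree
  · have hY := hft.locY_eq (s := s)
    have hmem := hf.mem_of_isTree hft
    rw [hY.1] at h1 h2
    simp only [Par, hft, hl, true_and]
    by_cases hfp : f.pos s = p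
    · simp only [hfp, not_true, iff_false]
      exact h2 (by rw [hfp]; simp)
    · simp only [hfp, not_false_eq_true, iff_true]
      apply h1
      have := two_le_secant (a := f.pos s) s.one_le_k rfl (le_refl p) hb ?_
      · linarith
      · rcases lt_or_gt_of_ne hfp with h | h
        · exact Or.inl (add_le_of_dvd (hP.dvd hmem) (hP.dvd he.1) h)
        · exact Or.inr (add_le_of_dvd (hP.dvd he.1) (hP.dvd hmem) h)
  · simp only [Par, hft, false_and, not_false_eq_true, iff_true]
    exact h1 (hang_good_of_not_isTree hP hf hft hp hp hb)

/-- The middle vertex of a path with three vertices cuts off the points at both ends. -/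
lemma good_mid (hP : Positions s P) {h : ℕ} {p q i : ℤ} {f : Spec} (he : WF s P (mid h p q i))
    (hf : WF s P f) (hl : f.loc = h) :
    DualRay.Good s.D ((mid h p q i).dual s) (f.dual s) ↔ ¬ Par s (mid h p q i) f := by
  have hg : Gap s P h p q i := he
  obtain ⟨hp, hq, hi0, hi, hpq, -⟩ := hg.bounds hP
  have hb : |i| ≤ s.k := by rw [abs_le]; constructor <;> linarith
  obtain ⟨h1, h2⟩ := hang_good hP he hf hp hq hb rfl rfl (by simp [locY, dev]) rfl
    (by simp [lev, hl])
  by_cases hft : f.IsTree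
  · have hY := hft.locY_eq (s := s)
    have hmem := hf.mem_of_isTree hft
    rw [hl] at hmem
    rw [hY.1] at h1 h2
    simp only [Par, hft, hl, true_and]
    by_cases hfp : f.pos s = p
    · simp only [hfp, true_or, not_true, iff_false]
      exact h2 (by rw [hfp]; simp)
    by_cases hfq : f.pos s = q
    · simp only [hfq, or_true, not_true, iff_false]
      apply h2
      rw [hfq]
      have : 0 ≤ i * (q - p) := mul_nonneg (by linarith) (by linarith [s.one_le_k])
      simpa using this
    · simp only [hfp, hfq, or_self, not_false_eq_true, iff_true]
      apply h1
      have := two_le_secant (a := f.pos s) (q := q) s.one_le_k rfl hg.lt.le hb ?_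
      · linarith
      · rcases hg.gap _ hmem with h | h
        · exact Or.inl (add_le_of_dvd (hP.dvd hmem) (hP.dvd hg.left_mem) (lt_of_le_of_ne h hfp))
        · exact Or.inr (add_le_of_dvd (hP.dvd hg.right_mem) (hP.dvd hmem)
            (lt_of_le_of_ne h (Ne.symm hfq)))
  · simp only [Par, hft, false_and, not_false_eq_true, iff_true]
    exact h1 (hang_good_of_not_isTree hP hf hft hp hq hb)

end Spec
end RayGraph

namespace RayGraph
namespace Spec

variable {s : Scale} {P : ℕ → ℤ → Prop}

/-! ### Rays for paths with four vertices -/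

/-- The products that occur in the comparisons of heights, bounded by the size parameters. -/
lemma Gap.products (hP : Positions s P) {h : ℕ} {p q i : ℤ} (hg : Gap s P h p q i) :
    0 ≤ p ^ 2 ∧ p ^ 2 ≤ s.B ^ 2 ∧ 0 ≤ q ^ 2 ∧ q ^ 2 ≤ s.B ^ 2 ∧ 0 ≤ i ^ 2 ∧ i ^ 2 ≤ s.B ^ 2 ∧
      0 ≤ i * (q - p) ∧ i * (q - p) ≤ s.B ^ 2 := by
  obtain ⟨h1, h2, h3, h4, h5, h6⟩ := hg.bounds hP
  have hB := s.B_ge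
  have hk := s.k_le
  have := neg_abs_le q
  have := le_abs_self q
  have := neg_abs_le p
  have := le_abs_self p
  have := abs_nonneg q
  have := abs_nonneg p
  have := s.one_le_k
  refine ⟨sq_nonneg _, by apply sq_le_sq' <;> linarith, sq_nonneg _,
    by apply sq_le_sq' <;> linarith, sq_nonneg _, by apply sq_le_sq' <;> linarith,
    mul_nonneg (by linarith) (by linarith), by rw [sq]; apply mul_le_mul <;> linarith⟩

/-- The frame of a ray whose point lies at the location that it is hung on. -/
lemma frame_at_base {e f : Spec} (hel : e.lev = e.loc + 1) (hl : f.loc = e.loc) :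
    DualRay.Good s.D (e.dual s) (f.dual s) ↔
      0 < (s.D * (f.locY s - e.locY s) - e.slope s * (f.locX s - e.locX s)) *
        (f.locX s - e.locX s) := by
  rw [good_iff]
  have h1 : ((e.loc : ℤ) + 1 - e.lev) = 0 := by omega
  have h2 : ((f.loc : ℤ) + 1 - e.lev) = 0 := by omega
  simp [frX, frY, h1, h2]

/-- The comparison of slopes from the left ray of a path, divided by the horizontal unit. -/
lemma good_left_iff {h : ℕ} {p q i : ℤ} {f : Spec} (hl : f.loc = h) :
    DualRay.Good s.D ((left h p q i).dual s) (f.dual s) ↔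
      0 < (s.R * (s.M * (f.locY s - (q ^ 2 + s.Z * (q - p + i) - i ^ 2)) +
        2 * s.Z * (q - p) * (f.pos s - p + i)) + 2 * s.Z * (q - p) * f.dev s) *
          (s.R * (f.pos s - p + i) + f.dev s) := by
  rw [frame_at_base rfl hl]
  refine Iff.trans ?_ (mul_pos_iff_of_pos_left s.R_pos)
  simp only [locX]
  generalize f.pos s = a
  generalize f.dev s = dv
  generalize f.locY s = Y
  simp only [slope, locY, pos, dev, Scale.D]
  refine iff_of_eq (congrArg _ ?_)
  ring

/-- The comparison of slopes from the right ray of a path, divided by the gap and the horizontal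
unit. -/
lemma good_right_iff {h : ℕ} {p q i : ℤ} {f : Spec} (hl : f.loc = h) :
    DualRay.Good s.D ((right h p q i).dual s) (f.dual s) ↔
      0 < (s.R * (f.locY s - (q ^ 2 + i ^ 2 + 2 * i * (q - p)) +
        (s.Z - 2 * i) * (f.pos s - q)) + (s.Z - 2 * i) * f.dev s) *
          (s.R * (f.pos s - q + 4 * s.k - i) + f.dev s) := by
  rw [frame_at_base rfl hl]
  refine Iff.trans ?_ (mul_pos_iff_of_pos_left (mul_pos s.M_pos s.R_pos))
  simp only [locX]
  generalize f.pos s = a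
  generalize f.dev s = dv
  generalize f.locY s = Y
  simp only [slope, locY, pos, dev, Scale.D]
  refine iff_of_eq (congrArg _ ?_)
  ring

/-- Seen from the left ray of a path, all points sufficiently far to the right are good. -/
lemma left_right_aux {k B Z M p q i a Y : ℤ} (hk : 1 ≤ k) (hM : M = 64 * k) (hZ : 4096 * B ^ 2 ≤ Z)
    (hB : 1 ≤ B) (hq : q ^ 2 ≤ B ^ 2) (hi : i ≤ k) (hpq : p + 64 * k ≤ q)
    (ha : 48 * k ≤ a) (hY : 0 ≤ Y) :
    0 < M * (Y - (q ^ 2 + Z * (q - p + i) - i ^ 2)) + 2 * Z * (q - p) * a := by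
  have hB2 : 1 ≤ B ^ 2 := by nlinarith
  have hZ0 : 0 ≤ Z := by linarith
  have h1 : Z * i ≤ Z * k := by gcongr
  have h2 : Z * (64 * k) ≤ Z * (q - p) := by gcongr; linarith
  have h3 : 2 * (Z * (q - p)) * (48 * k) ≤ 2 * (Z * (q - p)) * a := by
    have : 0 ≤ Z * k := by positivity
    gcongr
    linarith
  have h4 : Z ≤ Z * k := by nlinarith
  have h6 : 0 < 2 * (Y - (q ^ 2 + Z * (q - p + i) - i ^ 2)) + 3 * (Z * (q - p)) := by
    have := sq_nonneg i
    linarith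
  have h7 : 0 < k * (2 * (Y - (q ^ 2 + Z * (q - p + i) - i ^ 2)) + 3 * (Z * (q - p))) :=
    mul_pos (by linarith) h6
  subst hM
  linarith

/-- Seen from the left ray of a path, all points to the left that are lower are good. -/
lemma left_left_aux {M Z A Y y g a : ℤ} (hM : 0 < M) (hA : 0 ≤ A) (hZ : Z * g = A) (ha : a < 0)
    (h : Y < y) : M * (Y - y) + 2 * Z * g * a < 0 := by
  have h1 : M * (Y - y) < 0 := mul_neg_of_pos_of_neg hM (by linarith)
  have h2 : 2 * Z * g * a = 2 * (A * a) := by rw [← hZ]; ring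
  have h3 : A * a ≤ 0 := mul_nonpos_of_nonneg_of_nonpos hA ha.le
  linarith

/-- The left ray of a path cuts off the point at `p` only, among the points at its location. -/
lemma good_left (hP : Positions s P) {h : ℕ} {p q i : ℤ} {f : Spec} (he : WF s P (left h p q i))
    (hf : WF s P f) (hef : left h p q i ≠ f) (hl : f.loc = h) :
    DualRay.Good s.D ((left h p q i).dual s) (f.dual s) ↔ ¬ Par s (left h p q i) f := by
  have hg : Gap s P h p q i := he
  obtain ⟨hp, hq, hi0, hi, hpq, hg6⟩ := hg.bounds hP
  obtain ⟨p0, p1, q0, q1, i0, i1, ig0, ig1⟩ := hg.products hP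
  have hk := s.one_le_k
  have hB := s.B_ge
  have hM : s.M = 64 * s.k := rfl
  have hM0 := s.M_pos
  have hlift := s.lift_ge
  have hZ := s.Z_ge
  have hB2 : 1 ≤ s.B ^ 2 := by nlinarith
  have hZ2 : 4096 * s.B ^ 2 ≤ s.Z := by linarith
  have hZ0 : 0 ≤ s.Z := by linarith
  have hZg0 : 0 ≤ s.Z * (q - p) := mul_nonneg hZ0 (by linarith)
  have hZg : s.Z * (64 * s.k) ≤ s.Z * (q - p) := by gcongr; linarith
  have hZk : s.Z ≤ s.Z * s.k := by nlinarith
  have hZi : 0 ≤ s.Z * i := by positivity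
  have hR := s.R_ge_lift
  have hR0 := s.R_pos
  have hc0 : 0 ≤ 2 * s.Z * (q - p) := by linarith
  have hZgB : 256 * (s.Z * (q - p)) ≤ s.Z * s.B := by nlinarith
  have hlift0 : 0 < s.lift := by linarith
  have hcL : 2 * s.Z * (q - p) * s.lift < s.R := by
    have : 256 * (s.Z * (q - p)) * s.lift ≤ s.Z * s.B * s.lift := by gcongr
    have : 0 < s.Z * s.B * s.lift := by
      have : 0 < s.Z := by linarith
      positivity
    linarith
  have hLR : s.lift < s.R := by
    have h1 : 1 ≤ 2 * s.Z * (q - p) := by linarith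
    have h2 : 1 * s.lift ≤ 2 * s.Z * (q - p) * s.lift := by gcongr
    linarith
  rw [good_left_iff hl]
  have good := fun H => good_of_unit (R := s.R) (c := 2 * s.Z * (q - p))
    (U := s.M * (f.locY s - (q ^ 2 + s.Z * (q - p + i) - i ^ 2)) +
        2 * s.Z * (q - p) * (f.pos s - p + i)) (a := f.pos s - p + i) (dv := f.dev s)
    (L := s.lift) hc0 (dev_nonneg f) (dev_le f) hLR hcL H
  obtain ⟨hY0, -, -⟩ := hf.locY_bounds hP
  -- the two ways of being good: far to the right, or to the left and lower
  have right_good : 48 * s.k ≤ f.pos s - p + i →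
      0 < (s.R * (s.M * (f.locY s - (q ^ 2 + s.Z * (q - p + i) - i ^ 2)) +
        2 * s.Z * (q - p) * (f.pos s - p + i)) + 2 * s.Z * (q - p) * f.dev s) *
          (s.R * (f.pos s - p + i) + f.dev s) := by
    intro h1
    exact good (Or.inl ⟨by linarith, left_right_aux hk hM hZ2 (by linarith) q1 hi hpq h1 hY0⟩)
  have left_good : f.pos s - p + i < 0 → f.locY s < s.Z * (60 * s.k) →
      0 < (s.R * (s.M * (f.locY s - (q ^ 2 + s.Z * (q - p + i) - i ^ 2)) +
        2 * s.Z * (q - p) * (f.pos s - p + i)) + 2 * s.Z * (q - p) * f.dev s) *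
          (s.R * (f.pos s - p + i) + f.dev s) := by
    intro h1 h2
    refine good (Or.inr ⟨h1, left_left_aux hM0 hZg0 rfl h1 ?_⟩)
    linarith
  -- points of the chain and lifted points
  have chain : s.M ∣ f.pos s → f.pos s ≠ p → f.locY s ≤ f.pos s ^ 2 + s.lift →
      0 < (s.R * (s.M * (f.locY s - (q ^ 2 + s.Z * (q - p + i) - i ^ 2)) +
        2 * s.Z * (q - p) * (f.pos s - p + i)) + 2 * s.Z * (q - p) * f.dev s) *
          (s.R * (f.pos s - p + i) + f.dev s) := by
    intro hd hne hY
    have hpb := hf.pos_bound hP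
    rcases lt_or_gt_of_ne hne with h | h
    · have h1 := add_le_of_dvd hd (hP.dvd hg.left_mem) h
      apply left_good (by linarith)
      have : f.pos s ^ 2 ≤ s.B ^ 2 := by
        apply sq_le_sq' <;>
          linarith [neg_abs_le (f.pos s), le_abs_self (f.pos s), abs_nonneg (f.pos s)]
      linarith
    · have h1 := add_le_of_dvd (hP.dvd hg.left_mem) hd h
      exact right_good (by linarith)
  by_cases hft : f.IsTree
  · have hmem := hf.mem_of_isTree hft
    have hY := hft.locY_eq (s := s)
    by_cases h1 : pos s f = p
    · have hpar : Par s (left h p q i) f := ⟨hft, hl, h1⟩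
      simp only [hpar, not_true, iff_false]
      rw [hY.1, hY.2, h1]
      refine not_good_of_unit (Or.inl ⟨by linarith, ?_⟩)
      have : 2 * s.Z * (q - p) * (p - p + i) ≤ 2 * s.Z * (q - p) * s.k := by gcongr; linarith
      have : 0 ≤ s.k * (s.Z * (q - p) + 2 * (q ^ 2 + s.Z * i - i ^ 2 - p ^ 2)) := by
        apply mul_nonneg <;> linarith
      have : 0 ≤ s.k * (s.Z * (q - p)) := by positivity
      rw [hM]; linarith
    · have hpar : ¬ Par s (left h p q i) f := fun h2 => h1 h2.2.2
      simp only [hpar, not_false_eq_true, iff_true]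
      exact chain (hP.dvd hmem) h1 (by rw [hY.1]; linarith)
  cases f with
  | root => simp [IsTree] at hft
  | tree h' p' b => simp [IsTree] at hft
  | mid h' p' q' i' =>
    simp only [loc] at hl
    subst hl
    simp only [Par, IsTree, false_and, not_false_eq_true, iff_true]
    refine chain (Dvd.intro _ rfl).neg_right ?_ le_rfl
    intro h1
    apply hP.mid_notMem hf
    have := hg.left_mem
    rw [← h1] at this
    exact this
  | left h' p' q' i' =>
    simp only [loc] at hl
    subst hl
    have hg' : Gap s P h' p' q' i' := hf
    obtain ⟨hp', hq', hi0', hi', hpq', hg6'⟩ := hg'.bounds hP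
    obtain ⟨p0', p1', q0', q1', i0', i1', ig0', ig1'⟩ := hg'.products hP
    simp only [Par, IsTree, false_and, not_false_eq_true, iff_true]
    rcases hg.trichotomy hg' with ⟨rfl, rfl⟩ | h1 | h1
    · have hne : i ≠ i' := by
        rintro rfl; exact hef rfl
      apply good
      simp only [pos, locY]
      have h2 : s.M * (q' ^ 2 + s.Z * (q' - p' + i') - i' ^ 2 -
          (q' ^ 2 + s.Z * (q' - p' + i) - i ^ 2)) + 2 * s.Z * (q' - p') * (p' - i' - p' + i) =
          (i - i') * (s.M * (i + i') + s.Z * (2 * (q' - p') - s.M)) := by ring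
      rw [h2]
      have h3 : 0 < s.M * (i + i') + s.Z * (2 * (q' - p') - s.M) := by
        apply add_pos_of_pos_of_nonneg
        · apply mul_pos hM0; linarith
        · apply mul_nonneg hZ0; linarith
      rcases lt_or_gt_of_ne hne with h4 | h4
      · exact Or.inr ⟨by linarith, mul_neg_of_neg_of_pos (by linarith) h3⟩
      · exact Or.inl ⟨by linarith, mul_pos (by linarith) h3⟩
    · apply right_good
      simp only [pos]; linarith
    · apply good
      right
      simp only [pos, locY]
      have h2 : p' - i' - p + i < 0 := by linarith
      refine ⟨h2, ?_⟩
      have h3 : q' - p' + i' - i ≤ -(p' - i' - p + i) := by linarith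
      have h4 : 0 ≤ q' - p' + i' - i := by linarith
      have h5 : s.Z * (q' - p' + i' - i) * s.M ≤ s.Z * (q' - p' + i' - i) * (q - p) := by
        apply mul_le_mul_of_nonneg_left
        · rw [hM]; linarith
        · positivity
      have h6 : s.Z * (q - p) * (q' - p' + i' - i) ≤ s.Z * (q - p) * -(p' - i' - p + i) := by
        gcongr
      have h7 : 0 < s.M * (s.Z * (q' - p') + s.Z * i' - s.Z * i + s.Z * (q - p) -
          q' ^ 2 + q ^ 2 - i ^ 2 + i' ^ 2) := by
        apply mul_pos hM0
        have : s.Z * i ≤ s.Z * s.k := by gcongr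
        have : 0 ≤ s.Z * (q' - p') := mul_nonneg hZ0 (by linarith)
        have : 0 ≤ s.Z * i' := by positivity
        linarith
      linarith
  | right h' p' q' i' =>
    simp only [loc] at hl
    subst hl
    have hg' : Gap s P h' p' q' i' := hf
    obtain ⟨hp', hq', hi0', hi', hpq', hg6'⟩ := hg'.bounds hP
    obtain ⟨p0', p1', q0', q1', i0', i1', ig0', ig1'⟩ := hg'.products hP
    simp only [Par, IsTree, false_and, not_false_eq_true, iff_true]
    rcases hg.trichotomy hg' with ⟨rfl, rfl⟩ | h1 | h1
    · apply right_good
      simp only [pos]; linarith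
    · apply right_good
      simp only [pos]; linarith
    · apply left_good
      · simp only [pos]; linarith
      · simp only [locY]
        have : (s.Z - 2 * i') * (4 * s.k - i') ≤ s.Z * (4 * s.k) := by
          apply mul_le_mul <;> linarith
        linarith

/-- The right ray of a path cuts off the point at `q` and that of the left ray of the same path. The
latter lies exactly on the line of the cutoff, which suffices since rays are open. -/
lemma good_right (hP : Positions s P) {h : ℕ} {p q i : ℤ} {f : Spec} (he : WF s P (right h p q i))
    (hf : WF s P f) (hef : right h p q i ≠ f) (hl : f.loc = h) :
    DualRay.Good s.D ((right h p q i).dual s) (f.dual s) ↔ ¬ Par s (right h p q i) f := by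
  have hg : Gap s P h p q i := he
  obtain ⟨hp, hq, hi0, hi, hpq, hg6⟩ := hg.bounds hP
  obtain ⟨p0, p1, q0, q1, i0, i1, ig0, ig1⟩ := hg.products hP
  have hk := s.one_le_k
  have hkB := s.k_le
  have hB := s.B_ge
  have hM : s.M = 64 * s.k := rfl
  have hlift := s.lift_ge
  have hZ := s.Z_ge
  have hB2 : 1 ≤ s.B ^ 2 := by nlinarith
  have hBB := s.sq_ge
  have hZ2 : 4096 * s.B ^ 2 ≤ s.Z := by linarith
  have hZ0 : 0 ≤ s.Z := by linarith
  obtain ⟨c, hc⟩ : ∃ c, c = s.Z - 2 * i := ⟨_, rfl⟩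
  have hc0 : 0 ≤ c := by linarith
  have hcZ : 2000 * s.B ^ 2 + s.lift * 2 ≤ c := by linarith
  have hcM : c ≤ c * s.k := by nlinarith
  have hR := s.R_ge_lift
  have hR0 := s.R_pos
  have hlift0 : 0 < s.lift := by linarith
  have hZB : s.Z ≤ s.Z * s.B := by nlinarith
  have hcL : c * s.lift < s.R := by
    have : c * s.lift ≤ s.Z * s.B * s.lift := by gcongr; linarith
    have : 0 < s.Z * s.B * s.lift := by
      have : 0 < s.Z := by linarith
      positivity
    linarith
  have hLR : s.lift < s.R := by
    have h1 : 1 ≤ c := by linarith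
    have h2 : 1 * s.lift ≤ c * s.lift := by gcongr
    linarith
  rw [good_right_iff hl, ← hc]
  have good := fun H => good_of_unit (R := s.R) (c := c)
    (U := f.locY s - (q ^ 2 + i ^ 2 + 2 * i * (q - p)) + c * (f.pos s - q))
    (a := f.pos s - q + 4 * s.k - i) (dv := f.dev s)
    (L := s.lift) hc0 (dev_nonneg f) (dev_le f) hLR hcL H
  obtain ⟨hY0, -, -⟩ := hf.locY_bounds hP
  have right_good : q + 60 * s.k ≤ f.pos s →
      0 < (s.R * (f.locY s - (q ^ 2 + i ^ 2 + 2 * i * (q - p)) + c * (f.pos s - q)) + c * f.dev s) *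
          (s.R * (f.pos s - q + 4 * s.k - i) + f.dev s) := by
    intro h1
    refine good (Or.inl ⟨by linarith, ?_⟩)
    have : c * (60 * s.k) ≤ c * (f.pos s - q) := by gcongr; linarith
    linarith
  have left_good : f.pos s + 60 * s.k ≤ q → f.locY s ≤ s.B ^ 2 * 100 + s.lift + s.Z * (5 * s.k) →
      0 < (s.R * (f.locY s - (q ^ 2 + i ^ 2 + 2 * i * (q - p)) + c * (f.pos s - q)) + c * f.dev s) *
          (s.R * (f.pos s - q + 4 * s.k - i) + f.dev s) := by
    intro h1 h2
    refine good (Or.inr ⟨by linarith, ?_⟩)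
    have h3 : c * (f.pos s - q) ≤ c * (-(60 * s.k)) := by gcongr; linarith
    have h4 : s.Z * s.k = c * s.k + 2 * i * s.k := by rw [hc]; ring
    have h5 : i * s.k ≤ s.B ^ 2 := by rw [sq]; apply mul_le_mul <;> linarith
    linarith
  have chain : s.M ∣ f.pos s → f.pos s ≠ q → f.locY s ≤ f.pos s ^ 2 + s.lift →
      0 < (s.R * (f.locY s - (q ^ 2 + i ^ 2 + 2 * i * (q - p)) + c * (f.pos s - q)) + c * f.dev s) *
          (s.R * (f.pos s - q + 4 * s.k - i) + f.dev s) := by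
    intro hd hne hY
    have hpb := hf.pos_bound hP
    rcases lt_or_gt_of_ne hne with h | h
    · have h1 := add_le_of_dvd hd (hP.dvd hg.right_mem) h
      apply left_good (by linarith)
      have : f.pos s ^ 2 ≤ s.B ^ 2 := by
        apply sq_le_sq' <;>
          linarith [neg_abs_le (f.pos s), le_abs_self (f.pos s), abs_nonneg (f.pos s)]
      have : 0 ≤ s.Z * s.k := by positivity
      linarith
    · have h1 := add_le_of_dvd (hP.dvd hg.right_mem) hd h
      exact right_good (by linarith)
  by_cases hft : f.IsTree
  · have hmem := hf.mem_of_isTree hft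
    have hY := hft.locY_eq (s := s)
    by_cases h1 : pos s f = q
    · have hpar : Par s (right h p q i) f := Or.inl ⟨hft, hl, h1⟩
      simp only [hpar, not_true, iff_false]
      rw [hY.1, hY.2, h1]
      refine not_good_of_unit (Or.inl ⟨by linarith, ?_⟩)
      linarith
    · have hpar : ¬ Par s (right h p q i) f := by
        rintro (h2 | h2)
        · exact h1 h2.2.2
        · rw [h2] at hft; simp [IsTree] at hft
      simp only [hpar, not_false_eq_true, iff_true]
      exact chain (hP.dvd hmem) h1 (by rw [hY.1]; linarith)
  cases f with
  | root => simp [IsTree] at hft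
  | tree h' p' b => simp [IsTree] at hft
  | mid h' p' q' i' =>
    simp only [loc] at hl
    subst hl
    have hpar : ¬ Par s (right (h' + 1) p q i) (mid h' p' q' i') := by simp [Par, IsTree]
    simp only [hpar, not_false_eq_true, iff_true]
    refine chain (Dvd.intro _ rfl).neg_right ?_ le_rfl
    intro h1
    apply hP.mid_notMem hf
    have := hg.right_mem
    rw [← h1] at this
    exact this
  | left h' p' q' i' =>
    simp only [loc] at hl
    subst hl
    have hg' : Gap s P h' p' q' i' := hf
    obtain ⟨hp', hq', hi0', hi', hpq', hg6'⟩ := hg'.bounds hP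
    obtain ⟨p0', p1', q0', q1', i0', i1', ig0', ig1'⟩ := hg'.products hP
    by_cases hpar : Par s (right h' p q i) (left h' p' q' i')
    · simp only [hpar, not_true, iff_false]
      simp only [Par, IsTree, false_and, false_or, left.injEq, true_and] at hpar
      obtain ⟨rfl, rfl, rfl⟩ := hpar
      simp only [locY, pos, dev]
      refine not_good_of_unit (Or.inr ⟨by linarith, le_of_eq ?_⟩)
      rw [hc]; ring
    · simp only [hpar, not_false_eq_true, iff_true]
      rcases hg.trichotomy hg' with ⟨rfl, rfl⟩ | h1 | h1
      · have hne : i ≠ i' := by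
          rintro rfl; exact hpar (Or.inr rfl)
        apply good
        right
        simp only [pos, locY]
        refine ⟨by linarith, ?_⟩
        have h2 : q' ^ 2 + s.Z * (q' - p' + i') - i' ^ 2 - (q' ^ 2 + i ^ 2 + 2 * i * (q' - p')) +
            c * (p' - i' - q') = -(i - i') ^ 2 := by rw [hc]; ring
        rw [h2]
        have : 0 < (i - i') ^ 2 := by
          have := sub_ne_zero.2 hne
          positivity
        linarith
      · apply good
        left
        simp only [pos, locY]
        refine ⟨by linarith, ?_⟩
        have h2 : c * (-i') ≤ c * (p' - i' - q) := by gcongr; linarith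
        have h3 : s.Z * (64 * s.k) ≤ s.Z * (q' - p') := by gcongr; linarith
        have h4 : s.Z * i' = c * i' + 2 * i * i' := by rw [hc]; ring
        have h5 : 0 ≤ i * i' := by positivity
        have h6 : s.Z ≤ s.Z * s.k := by nlinarith
        linarith
      · apply good
        right
        simp only [pos, locY]
        refine ⟨by linarith, ?_⟩
        have h2 : c * (p' - i' - q) ≤ c * (-(q' - p') - i' - 64 * s.k) :=
          mul_le_mul_of_nonneg_left (by linarith) hc0
        have h3 : c * (-(q' - p') - i' - 64 * s.k) = -(s.Z * (q' - p' + i')) - 64 * (c * s.k) +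
          2 * (i * (q' - p' + i')) := by rw [hc]; ring
        have h4 : i * (q' - p' + i') ≤ s.B ^ 2 := by rw [sq]; apply mul_le_mul <;> linarith
        linarith
  | right h' p' q' i' =>
    simp only [loc] at hl
    subst hl
    have hg' : Gap s P h' p' q' i' := hf
    obtain ⟨hp', hq', hi0', hi', hpq', hg6'⟩ := hg'.bounds hP
    obtain ⟨p0', p1', q0', q1', i0', i1', ig0', ig1'⟩ := hg'.products hP
    have hpar : ¬ Par s (right h' p q i) (right h' p' q' i') := by simp [Par, IsTree]
    simp only [hpar, not_false_eq_true, iff_true]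
    rcases hg.trichotomy hg' with ⟨rfl, rfl⟩ | h1 | h1
    · have hne : i ≠ i' := by
        rintro rfl; exact hef rfl
      apply good
      simp only [pos, locY]
      have h2 : q' ^ 2 + i' ^ 2 + 2 * i' * (q' - p') + (s.Z - 2 * i') * (4 * s.k - i') -
          (q' ^ 2 + i ^ 2 + 2 * i * (q' - p')) + c * (q' - 4 * s.k + i' - q') =
          (i' - i) * (i' + i + 2 * (q' - p') - 8 * s.k + 2 * i') := by rw [hc]; ring
      rw [h2]
      have h3 : 0 < i' + i + 2 * (q' - p') - 8 * s.k + 2 * i' := by linarith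
      rcases lt_or_gt_of_ne hne with h4 | h4
      · exact Or.inl ⟨by linarith, mul_pos (by linarith) h3⟩
      · exact Or.inr ⟨by linarith, mul_neg_of_neg_of_pos (by linarith) h3⟩
    · apply right_good
      simp only [pos]; linarith
    · apply left_good
      · simp only [pos]; linarith
      · simp only [locY]
        have : (s.Z - 2 * i') * (4 * s.k - i') ≤ s.Z * (4 * s.k) := by
          apply mul_le_mul <;> linarith
        have : 0 ≤ s.Z * s.k := by positivity
        linarith

/-- A ray sees exactly the rays that it is hung on at the wrong side. -/
theorem good_iff_not_par (hP : Positions s P) {e f : Spec} (he : WF s P e) (hf : WF s P f)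
    (hef : e ≠ f) (hc : Compat e f) :
    DualRay.Good s.D (e.dual s) (f.dual s) ↔ ¬ Par s e f := by
  by_cases hl : f.loc + 1 = e.lev
  · cases e with
    | root => simp [lev] at hl
    | tree h p b => exact good_tree hP he hf (by simpa [lev] using hl)
    | mid h p q i => exact good_mid hP he hf (by simpa [lev] using hl)
    | left h p q i => exact good_left hP he hf hef (by simpa [lev] using hl)
    | right h p q i => exact good_right hP he hf hef (by simpa [lev] using hl)
  · have : ¬ Par s e f := by
      intro hpar
      apply hl
      cases e with
      | root => exact hpar.elim
      | tree h p b => simp [lev, hpar.2.1]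
      | mid h p q i => simp [lev, hpar.2.1]
      | left h p q i => simp [lev, hpar.2.1]
      | right h p q i =>
        rcases hpar with hpar | rfl
        · simp [lev, hpar.2.1]
        · simp [lev, loc]
    simp only [this, not_false_eq_true, iff_true]
    exact good_of_loc_ne hP he hf hef hc hl

/-- Different rays lie on lines of different slopes. -/
lemma dual_x_ne (hP : Positions s P) {e f : Spec} (he : WF s P e) (hf : WF s P f)
    (hef : e ≠ f) (hc : Compat e f) : (e.dual s).x ≠ (f.dual s).x := by
  have hR0 := s.R_pos
  have hD0 := s.D_pos
  have hD := s.D_ge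
  have hB := s.B_ge
  obtain ⟨x1, -⟩ := he.locX_bound hP
  obtain ⟨y1, -⟩ := hf.locX_bound hP
  obtain ⟨x2, x3⟩ := abs_le.1 x1
  obtain ⟨y2, y3⟩ := abs_le.1 y1
  have hRB : s.R * s.B * 4096 ≤ s.D := by
    have : s.B ^ 1 * s.R ≤ s.B ^ 11 * s.R := by gcongr <;> linarith
    rw [pow_one] at this
    linarith
  have hRB0 : 0 ≤ s.R * s.B := by positivity
  simp only [dual]
  intro h
  rcases lt_trichotomy e.loc f.loc with hl | hl | hl
  · have : (e.loc + 1 : ℤ) * s.D ≤ f.loc * s.D := by gcongr; exact_mod_cast hl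
    linarith
  · have hne := pos_ne hP he hf hef hc hl
    rw [hl] at h
    have h4 := dev_nonneg (s := s) e
    have h5 := dev_le (s := s) e
    have h6 := dev_nonneg (s := s) f
    have h7 := dev_le (s := s) f
    have hlR : s.lift < s.R := by
      unfold Scale.lift Scale.R
      exact pow_lt_pow_right₀ (by linarith) (by norm_num)
    unfold locX at h
    rcases lt_or_gt_of_ne hne with h1 | h1
    · have : s.R * 1 ≤ s.R * (f.pos s - e.pos s) := by gcongr; omega
      linarith
    · have : s.R * 1 ≤ s.R * (e.pos s - f.pos s) := by gcongr; omega
      linarith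
  · have : (f.loc + 1 : ℤ) * s.D ≤ e.loc * s.D := by gcongr; exact_mod_cast hl
    linarith

/-- The ray of a combinatorial description. -/
def ray (s : Scale) (e : Spec) : IntRay := (e.dual s).toRay s.D

theorem ray_inter_iff (hP : Positions s P) {e f : Spec} (he : WF s P e) (hf : WF s P f)
    (hef : e ≠ f) (hc : Compat e f) (hc' : Compat f e) :
    ((e.ray s).toSet ∩ (f.ray s).toSet).Nonempty ↔ ¬ (Par s e f ∨ Par s f e) := by
  rw [ray, ray, DualRay.inter_nonempty_iff _ _ (dual_x_ne hP he hf hef hc),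
    good_iff_not_par hP he hf hef hc, good_iff_not_par hP hf he hef.symm hc', not_or]

end Spec
end RayGraph

namespace RayGraph

/-! ### Positions of the vertices of an embedded tree -/

namespace EmbeddedTree

variable {V : Type*} (T : EmbeddedTree V)

/-- The distance from the root. -/
noncomputable def depth (v : V) : ℕ := T.graph.dist T.root v

lemma depth_root : T.depth T.root = 0 := SimpleGraph.dist_self

lemma depth_eq_zero {v : V} : T.depth v = 0 ↔ v = T.root := by
  rw [depth, T.isTree.connected.dist_eq_zero_iff, eq_comm]

lemma depth_adj {u v : V} (h : T.graph.Adj u v) :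
    T.depth u = T.depth v + 1 ∨ T.depth v = T.depth u + 1 :=
  T.isTree.dist_eq_dist_add_one_of_adj T.root h

/-- The paths from the root to `v` through two parents of `v` coincide. -/
lemma parent_unique {u u' v : V} (h : T.graph.Adj u v) (h' : T.graph.Adj u' v)
    (hd : T.depth v = T.depth u + 1) (hd' : T.depth v = T.depth u' + 1) : u = u' := by
  obtain ⟨p, hp⟩ := T.isTree.connected.exists_walk_length_eq_dist T.root u
  obtain ⟨q, hq⟩ := T.isTree.connected.exists_walk_length_eq_dist T.root u'
  have hp' : (p.concat h).IsPath := by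
    apply SimpleGraph.Walk.isPath_of_length_eq_dist
    rw [SimpleGraph.Walk.length_concat, hp]; exact hd.symm
  have hq' : (q.concat h').IsPath := by
    apply SimpleGraph.Walk.isPath_of_length_eq_dist
    rw [SimpleGraph.Walk.length_concat, hq]; exact hd'.symm
  have := (T.isTree.isAcyclic.subsingleton_path T.root v).elim ⟨_, hp'⟩ ⟨_, hq'⟩
  have h2 := congrArg (fun w => w.1.penultimate) this
  simpa using h2

lemma exists_parent {v : V} (h : v ≠ T.root) :
    ∃ u, T.graph.Adj u v ∧ T.depth v = T.depth u + 1 := by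
  obtain ⟨p, hp⟩ := T.isTree.connected.exists_walk_length_eq_dist T.root v
  have hnil : ¬ p.Nil := by
    intro h1
    exact h h1.eq.symm
  refine ⟨p.penultimate, p.adj_penultimate hnil, ?_⟩
  have h1 : T.depth p.penultimate ≤ p.dropLast.length := SimpleGraph.dist_le _
  have h2 : p.dropLast.length + 1 = p.length := by
    rw [SimpleGraph.Walk.length_dropLast_add_one hnil]
  have h3 := T.depth_adj (p.adj_penultimate hnil)
  have h4 : T.depth v = p.length := hp.symm
  omega

lemma depth_lt_card [Fintype V] (v : V) : T.depth v < Fintype.card V := by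
  obtain ⟨p, hp, hl⟩ := T.isTree.connected.exists_path_of_dist T.root v
  rw [depth, ← hl]
  exact hp.length_lt

variable [DecidableEq V]

/-- The position of the vertex described by `(parent, vertex, position of the parent, signed
child number)`. -/
def entryPos (M : ℤ) (e : V × V × ℤ × ℤ) : ℤ := -(M * (e.2.2.1 + e.2.2.1 + e.2.2.2))

/-- The vertices of level `i + 1` in the order of the breadth-first traversal, as tuples
`(parent, vertex, position of the parent, signed child number)`. The order of the positions is
reversed from each level to the next, and the sign of the child numbers follows it. -/
def entries (M : ℤ) : ℕ → List (V × V × ℤ × ℤ)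
  | 0 => (((T.rot T.root).rotate ((T.rot T.root).idxOf T.second)).zipIdx).map
      fun x => (T.root, x.1, 0, (x.2 : ℤ))
  | i + 1 => (entries M i).flatMap fun e => ((T.children e.1 e.2.1).zipIdx).map
      fun x => (e.2.1, x.1, entryPos M e, (-1) ^ (i + 1) * (x.2 : ℤ))

lemma map_entries (M : ℤ) (i : ℕ) :
    (T.entries M i).map (fun e => (e.1, e.2.1)) = T.levelPairs i := by
  induction i with
  | zero =>
    simp only [entries, levelPairs, List.map_map]
    conv_rhs => rw [← List.zipIdx_map_fst 0 ((T.rot T.root).rotate _), List.map_map]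
    rfl
  | succ i ih =>
    simp only [entries, levelPairs, ← ih, List.map_flatMap, List.flatMap_map, List.map_map]
    congr 1
    funext e
    conv_rhs => rw [← List.zipIdx_map_fst 0 (T.children e.1 e.2.1), List.map_map]
    rfl

lemma map_entries_snd (M : ℤ) (i : ℕ) :
    (T.entries M i).map (fun e => e.2.1) = T.level (i + 1) := by
  rw [level, ← T.map_entries M, List.map_map]; rfl

/-- The list of children of `v` contains all neighbours except the parent. -/
lemma mem_children {p v w : V} (h : T.graph.Adj v p) :
    w ∈ T.children p v ↔ T.graph.Adj v w ∧ w ≠ p := by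
  have hp : p ∈ T.rot v := (T.mem_rot v p).2 h
  obtain ⟨l1, l2, hl⟩ := List.append_of_mem hp
  have hnd := T.rot_nodup v
  rw [hl] at hnd
  have hp1 : p ∉ l1 := by
    intro h1
    have := List.disjoint_of_nodup_append hnd h1
    simp at this
  have hidx : (T.rot v).idxOf p = l1.length := by
    rw [hl, List.idxOf_append_of_notMem hp1]; simp
  have hc : T.children p v = l2 ++ l1 := by
    unfold children
    rw [hidx, hl]
    have : l1 ++ p :: l2 = (l1 ++ [p]) ++ l2 := by simp
    rw [this, show l1.length + 1 = (l1 ++ [p]).length by simp, List.rotate_append_length_eq,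
      ← List.append_assoc, List.dropLast_concat]
  have hp2 : p ∉ l2 := by
    have := (List.nodup_append.1 hnd).2.1
    exact (List.nodup_cons.1 this).1
  rw [hc, ← T.mem_rot, hl]
  simp only [List.mem_append, List.mem_cons]
  constructor
  · rintro (h1 | h1)
    · exact ⟨Or.inr (Or.inr h1), fun h2 => hp2 (h2 ▸ h1)⟩
    · exact ⟨Or.inl h1, fun h2 => hp1 (h2 ▸ h1)⟩
  · rintro ⟨h1 | h1 | h1, h2⟩
    · exact Or.inr h1
    · exact absurd h1 h2
    · exact Or.inl h1

lemma length_children_le (p v : V) : (T.children p v).length ≤ (T.rot v).length := by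
  simp [children]

/-- The breadth-first traversal lists the pairs of a parent and a child. -/
lemma mem_levelPairs {i : ℕ} {u v : V} :
    (u, v) ∈ T.levelPairs i ↔ T.graph.Adj u v ∧ T.depth u = i ∧ T.depth v = i + 1 := by
  induction i generalizing u v with
  | zero =>
    simp only [levelPairs, List.mem_map, List.mem_rotate, T.mem_rot, Prod.mk.injEq]
    constructor
    · rintro ⟨w, hw, rfl, rfl⟩
      refine ⟨hw, T.depth_root, ?_⟩
      have := T.depth_adj hw
      rw [T.depth_root] at this
      omega
    · rintro ⟨h1, h2, -⟩
      rw [T.depth_eq_zero] at h2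
      subst h2
      exact ⟨v, h1, rfl, rfl⟩
  | succ i ih =>
    simp only [levelPairs, List.mem_flatMap, List.mem_map, Prod.mk.injEq, Prod.exists]
    constructor
    · rintro ⟨a, b, hab, w, hw, rfl, rfl⟩
      obtain ⟨h1, h2, h3⟩ := ih.1 hab
      rw [T.mem_children h1.symm] at hw
      refine ⟨hw.1, h3, ?_⟩
      rcases T.depth_adj hw.1 with h4 | h4
      · exact absurd (T.parent_unique hw.1.symm h1 h4 (by omega)) hw.2
      · omega
    · rintro ⟨h1, h2, h3⟩
      have hu : u ≠ T.root := by
        intro h; rw [h, T.depth_root] at h2; omega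
      obtain ⟨a, ha, had⟩ := T.exists_parent hu
      refine ⟨a, u, ih.2 ⟨ha, by omega, h2⟩, v, ?_, rfl, rfl⟩
      rw [T.mem_children ha.symm]
      refine ⟨h1, ?_⟩
      rintro rfl
      omega

variable {T}

lemma adj_of_mem_entries {M : ℤ} {i : ℕ} {e : V × V × ℤ × ℤ} (h : e ∈ T.entries M i) :
    T.graph.Adj e.1 e.2.1 ∧ T.depth e.1 = i ∧ T.depth e.2.1 = i + 1 := by
  rw [← T.mem_levelPairs, ← T.map_entries M]
  exact List.mem_map_of_mem h

lemma exists_entry (M : ℤ) {u v : V} (h : T.graph.Adj u v) (hd : T.depth v = T.depth u + 1) :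
    ∃ e ∈ T.entries M (T.depth u), e.1 = u ∧ e.2.1 = v := by
  have : (u, v) ∈ T.levelPairs (T.depth u) := T.mem_levelPairs.2 ⟨h, rfl, hd⟩
  rw [← T.map_entries M, List.mem_map] at this
  obtain ⟨e, he, heq⟩ := this
  exact ⟨e, he, congrArg Prod.fst heq, congrArg Prod.snd heq⟩

variable (T) in
/-- The positions that occur at a level. -/
def PosAt (M : ℤ) : ℕ → ℤ → Prop
  | 0, a => a = 0
  | i + 1, a => ∃ e ∈ T.entries M i, entryPos M e = a

lemma entry_bounds {M k : ℤ} (hk : ∀ v, 2 * ((T.rot v).length : ℤ) ≤ k) {i : ℕ}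
    {e : V × V × ℤ × ℤ} (h : e ∈ T.entries M i) :
    T.PosAt M i e.2.2.1 ∧ 2 * |e.2.2.2| ≤ k := by
  have aux : ∀ (l : List V) (v : V) (x : V × ℕ), l.length ≤ (T.rot v).length → x ∈ l.zipIdx →
      2 * (x.2 : ℤ) ≤ k := by
    intro l v x hl hx
    have h1 := List.snd_lt_of_mem_zipIdx hx
    have h2 := hk v
    have h3 : (x.2 : ℤ) ≤ ((T.rot v).length : ℤ) := by omega
    linarith
  cases i with
  | zero =>
    simp only [entries, List.mem_map] at h
    obtain ⟨x, hx, rfl⟩ := h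
    refine ⟨rfl, ?_⟩
    simp only [Nat.abs_cast]
    exact aux _ T.root x (by simp) hx
  | succ i =>
    simp only [entries, List.mem_flatMap, List.mem_map] at h
    obtain ⟨f, hf, x, hx, rfl⟩ := h
    refine ⟨⟨f, hf, rfl⟩, ?_⟩
    simp only [abs_mul, abs_pow, abs_neg, abs_one, one_pow, one_mul, Nat.abs_cast]
    exact aux _ f.2.1 x (T.length_children_le _ _) hx

/-- Along each level, the positions are strictly monotone, alternately increasing and
decreasing. -/
lemma entries_sorted {M k : ℤ} (hk : ∀ v, 2 * ((T.rot v).length : ℤ) ≤ k) (hM : k < M)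
    (hM0 : 0 < M) (i : ℕ) :
    (T.entries M i).Pairwise fun e f =>
      (-1) ^ (i + 1) * entryPos M e < (-1) ^ (i + 1) * entryPos M f := by
  have zip : ∀ (l : List V) (n : ℕ), (l.zipIdx n).Pairwise fun x y => x.2 < y.2 := by
    intro l
    induction l with
    | nil => simp
    | cons a l ih =>
      intro n
      rw [List.zipIdx_cons, List.pairwise_cons]
      refine ⟨fun x hx => ?_, ih _⟩
      have := List.le_snd_of_mem_zipIdx hx
      simp only; omega
  have sq : ∀ j : ℕ, ((-1 : ℤ) ^ j) * (-1) ^ j = 1 := by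
    intro j; rw [← mul_pow]; simp
  induction i with
  | zero =>
    simp only [entries, List.pairwise_map]
    refine (zip _ 0).imp ?_
    intro x y hxy
    simp only [entryPos, zero_add, pow_one]
    have : (x.2 : ℤ) < y.2 := by exact_mod_cast hxy
    have := mul_lt_mul_of_pos_left this hM0
    linarith
  | succ i ih =>
    obtain ⟨E, hE⟩ : ∃ E : ℤ, E = (-1) ^ (i + 1) := ⟨_, rfl⟩
    have hEE : E * E = 1 := by rw [hE]; exact sq _
    have hsucc : (-1 : ℤ) ^ (i + 1 + 1) = -E := by rw [hE, pow_succ]; ring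
    rw [hsucc]
    rw [← hE] at ih
    have hpos : ∀ (a b p : ℤ) (u v : V), -E * entryPos M (u, v, p, E * a) =
        M * (2 * (E * p) + a) := by
      intro a b p u v
      simp only [entryPos]
      linear_combination (M * a) * hEE
    simp only [entries, ← hE, List.pairwise_flatMap, List.pairwise_map]
    refine ⟨fun e he => (zip _ 0).imp ?_, ih.imp_of_mem ?_⟩
    · intro x y hxy
      rw [hpos _ 0, hpos _ 0]
      have : (x.2 : ℤ) < y.2 := by exact_mod_cast hxy
      apply mul_lt_mul_of_pos_left _ hM0
      linarith
    · intro e f he hf hef x hx y hy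
      simp only [List.mem_map] at hx hy
      obtain ⟨x, hx, rfl⟩ := hx
      obtain ⟨y, hy, rfl⟩ := hy
      rw [hpos _ 0, hpos _ 0]
      apply mul_lt_mul_of_pos_left _ hM0
      have h1 : M ∣ E * entryPos M f - E * entryPos M e :=
        dvd_sub (Dvd.dvd.mul_left (Dvd.intro _ rfl).neg_right _)
          (Dvd.dvd.mul_left (Dvd.intro _ rfl).neg_right _)
      have h2 := Int.le_of_dvd (by linarith) h1
      have h3 := List.snd_lt_of_mem_zipIdx hx
      have h4 := T.length_children_le e.1 e.2.1
      have h5 := hk e.2.1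
      have h6 : (x.2 : ℤ) ≤ ((T.rot e.2.1).length : ℤ) := by omega
      have h7 : (0 : ℤ) ≤ y.2 := by positivity
      linarith

/-- Different vertices of a level have different positions. -/
lemma entry_eq_of_pos_eq {M k : ℤ} (hk : ∀ v, 2 * ((T.rot v).length : ℤ) ≤ k) (hM : k < M)
    (hM0 : 0 < M) {i : ℕ} {e f : V × V × ℤ × ℤ} (he : e ∈ T.entries M i) (hf : f ∈ T.entries M i)
    (h : entryPos M e = entryPos M f) : e = f := by
  have hs := List.pairwise_iff_getElem.1 (T.entries_sorted hk hM hM0 i)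
  obtain ⟨a, ha, rfl⟩ := List.getElem_of_mem he
  obtain ⟨b, hb, rfl⟩ := List.getElem_of_mem hf
  rcases lt_trichotomy a b with hab | rfl | hab
  · have := hs a b ha hb hab
    rw [h] at this
    exact absurd this (lt_irrefl _)
  · rfl
  · have := hs b a hb ha hab
    rw [h] at this
    exact absurd this (lt_irrefl _)

/-- Consecutive vertices of a level have consecutive positions. -/
lemma gap_of_infix {M k : ℤ} (hk : ∀ v, 2 * ((T.rot v).length : ℤ) ≤ k) (hM : k < M)
    (hM0 : 0 < M) {i : ℕ} {e f : V × V × ℤ × ℤ} (h : [e, f] <:+: T.entries M i) :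
    entryPos M e ≠ entryPos M f ∧ ∀ a, T.PosAt M (i + 1) a →
      a ≤ min (entryPos M e) (entryPos M f) ∨ max (entryPos M e) (entryPos M f) ≤ a := by
  obtain ⟨l1, l2, hl⟩ := h
  have hs := T.entries_sorted hk hM hM0 i
  rw [← hl] at hs
  have hsign : ((-1 : ℤ) ^ (i + 1) = 1) ∨ ((-1 : ℤ) ^ (i + 1) = -1) := neg_one_pow_eq_or ℤ _
  rw [List.append_assoc, List.pairwise_append] at hs
  obtain ⟨-, h2, h3⟩ := hs
  rw [List.cons_append, List.pairwise_cons] at h2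
  obtain ⟨h4, h5⟩ := h2
  rw [List.singleton_append, List.pairwise_cons] at h5
  have hef := h4 f (by simp)
  constructor
  · intro heq; rw [heq] at hef; exact lt_irrefl _ hef
  · rintro a ⟨g, hg, rfl⟩
    rw [← hl] at hg
    simp only [List.mem_append, List.mem_cons, List.not_mem_nil, or_false] at hg
    rcases hg with (hg | rfl | rfl) | hg
    · have h6 := h3 g hg e (by simp)
      rcases hsign with h | h <;> rw [h] at h6 hef <;> grind
    · rcases le_total (entryPos M g) (entryPos M f) with h | h <;> simp [h]
    · rcases le_total (entryPos M e) (entryPos M g) with h | h <;> simp [h]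
    · have h6 := h5.1 g hg
      rcases hsign with h | h <;> rw [h] at h6 hef <;> grind

/-- Positions grow by a factor of at most `M ^ 2` from each level to the next. -/
lemma posAt_abs_le {M k : ℤ} (hk : ∀ v, 2 * ((T.rot v).length : ℤ) ≤ k) (hk1 : 1 ≤ k)
    (hM : 64 * k ≤ M) {i : ℕ} {a : ℤ} (h : T.PosAt M i a) : |a| ≤ M ^ (2 * i) := by
  induction i generalizing a with
  | zero => rw [show a = 0 from h]; simp
  | succ i ih =>
    obtain ⟨e, he, rfl⟩ := h
    obtain ⟨h1, h2⟩ := entry_bounds hk he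
    have h3 := ih h1
    have h4 : (1 : ℤ) ≤ M ^ (2 * i) := one_le_pow₀ (by linarith)
    rw [entryPos, abs_neg, abs_mul, abs_of_nonneg (show 0 ≤ M by linarith)]
    have h5 := abs_add_three e.2.2.1 e.2.2.1 e.2.2.2
    have h6 : |e.2.2.2| ≤ k := by linarith [abs_nonneg e.2.2.2]
    have h7 : |e.2.2.1 + e.2.2.1 + e.2.2.2| ≤ M * M ^ (2 * i) := by nlinarith
    calc M * |e.2.2.1 + e.2.2.1 + e.2.2.2| ≤ M * (M * M ^ (2 * i)) := by gcongr; linarith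
      _ = M ^ (2 * (i + 1)) := by ring

end EmbeddedTree
end RayGraph

namespace RayGraph

/-! ### The ray of each vertex -/

lemma Scale.k_lt_M (s : Scale) : s.k < s.M := by
  have := s.one_le_k
  unfold Scale.M; linarith

namespace EmbeddedTree

variable {V : Type*} [DecidableEq V] (T : EmbeddedTree V)

/-- The scale is large enough for the tree. -/
structure Fits (s : Scale) : Prop where
  length_rot_le : ∀ v, 2 * ((T.rot v).length : ℤ) ≤ s.k
  pow_le : ∀ v, 8 * s.M * s.M ^ (2 * T.depth v) ≤ s.B

/-- `e` is the combinatorial description of the ray of the tree vertex `v`. -/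
def IsTreeSpec (M : ℤ) (v : V) (e : Spec) : Prop :=
  (v = T.root ∧ e = .root) ∨
    ∃ i, ∃ x ∈ T.entries M i, x.2.1 = v ∧ e = .tree i x.2.2.1 x.2.2.2

lemma level_nodup (i : ℕ) : (T.level i).Nodup := by
  cases i with
  | zero => simp [level]
  | succ i =>
    rw [level]
    induction i with
    | zero =>
      simp only [levelPairs, List.map_map]
      have : (Prod.snd ∘ fun u => (T.root, u)) = (id : V → V) := rfl
      rw [this, List.map_id, List.nodup_rotate]
      exact T.rot_nodup _
    | succ i ih =>
      simp only [levelPairs, List.map_flatMap, List.map_map]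
      have : ∀ a : V × V, (Prod.snd ∘ fun u => (a.2, u)) = (id : V → V) := fun _ => rfl
      simp only [this, List.map_id]
      rw [List.nodup_flatMap]
      constructor
      · intro a _
        exact ((List.nodup_rotate.2 (T.rot_nodup _)).sublist (List.dropLast_sublist _))
      · refine (List.Nodup.pairwise_of_forall_ne (List.Nodup.of_map _ ih) ?_)
        intro a ha b hb hab w hwa hwb
        obtain ⟨a1, a2, a3⟩ := T.mem_levelPairs.1 (show (a.1, a.2) ∈ _ from ha)
        obtain ⟨b1, b2, b3⟩ := T.mem_levelPairs.1 (show (b.1, b.2) ∈ _ from hb)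
        rw [T.mem_children a1.symm] at hwa
        rw [T.mem_children b1.symm] at hwb
        have h1 : ∀ {a b w : V}, T.graph.Adj a b → T.depth b = T.depth a + 1 → T.graph.Adj b w →
            w ≠ a → T.depth w = T.depth b + 1 := by
          intro a b w h1 h2 h3 h4
          rcases T.depth_adj h3 with h5 | h5
          · exact absurd (T.parent_unique h3.symm h1 h5 h2) h4
          · exact h5
        have ha' := h1 a1 (by omega) hwa.1 hwa.2
        have hb' := h1 b1 (by omega) hwb.1 hwb.2
        have h2 := T.parent_unique hwa.1 hwb.1 ha' hb'
        rw [← h2] at b1 b3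
        exact hab (Prod.ext (T.parent_unique a1 b1 (by omega) (by omega)) h2)

variable {T}

lemma entry_eq_of_vertex_eq {M : ℤ} {i j : ℕ} {x y : V × V × ℤ × ℤ} (hx : x ∈ T.entries M i)
    (hy : y ∈ T.entries M j) (h : x.2.1 = y.2.1) : i = j ∧ x = y := by
  have h1 := adj_of_mem_entries hx
  have h2 := adj_of_mem_entries hy
  have hij : i = j := by
    have h3 := h1.2.2
    rw [h, h2.2.2] at h3; omega
  subst hij
  have h3 := T.level_nodup (i + 1)
  rw [← T.map_entries_snd M] at h3
  exact ⟨rfl, List.inj_on_of_nodup_map h3 hx hy h⟩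

lemma IsTreeSpec.unique {M : ℤ} {v : V} {e f : Spec} (he : T.IsTreeSpec M v e)
    (hf : T.IsTreeSpec M v f) : e = f := by
  have hr : ∀ {i x}, x ∈ T.entries M i → x.2.1 ≠ T.root := by
    intro i x hx h
    have := (adj_of_mem_entries hx).2.2
    rw [h, T.depth_root] at this
    omega
  rcases he with ⟨rfl, rfl⟩ | ⟨i, x, hx, rfl, rfl⟩
  · rcases hf with ⟨-, rfl⟩ | ⟨j, y, hy, h, -⟩
    · rfl
    · exact absurd h (hr hy)
  · rcases hf with ⟨h, -⟩ | ⟨j, y, hy, h, rfl⟩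
    · exact absurd h (hr hx)
    · obtain ⟨rfl, rfl⟩ := entry_eq_of_vertex_eq hx hy h.symm
      rfl

variable (T) in
lemma exists_isTreeSpec (M : ℤ) (v : V) : ∃ e, T.IsTreeSpec M v e := by
  by_cases h : v = T.root
  · exact ⟨_, Or.inl ⟨h, rfl⟩⟩
  · obtain ⟨u, hu, hd⟩ := T.exists_parent h
    obtain ⟨x, hx, -, hx2⟩ := exists_entry M hu hd
    exact ⟨_, Or.inr ⟨_, x, hx, hx2, rfl⟩⟩

variable (T) in
/-- The combinatorial description of the ray of a tree vertex. -/
noncomputable def treeSpec (M : ℤ) (v : V) : Spec := (T.exists_isTreeSpec M v).choose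

lemma isTreeSpec_treeSpec (M : ℤ) (v : V) : T.IsTreeSpec M v (T.treeSpec M v) :=
  (T.exists_isTreeSpec M v).choose_spec

lemma IsTreeSpec.eq {M : ℤ} {v : V} {e : Spec} (h : T.IsTreeSpec M v e) : T.treeSpec M v = e :=
  (isTreeSpec_treeSpec M v).unique h

lemma treeSpec_root (M : ℤ) : T.treeSpec M T.root = .root :=
  IsTreeSpec.eq (Or.inl ⟨rfl, rfl⟩)

lemma treeSpec_of_mem {M : ℤ} {i : ℕ} {x : V × V × ℤ × ℤ} (hx : x ∈ T.entries M i) :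
    T.treeSpec M x.2.1 = .tree i x.2.2.1 x.2.2.2 :=
  IsTreeSpec.eq (Or.inr ⟨i, x, hx, rfl, rfl⟩)

lemma treeSpec_isTree (M : ℤ) (v : V) : (T.treeSpec M v).IsTree := by
  rcases isTreeSpec_treeSpec (T := T) M v with ⟨-, h⟩ | ⟨i, x, -, -, h⟩ <;> rw [h] <;> trivial

lemma treeSpec_loc (M : ℤ) (v : V) : (T.treeSpec M v).loc = T.depth v := by
  rcases isTreeSpec_treeSpec (T := T) M v with ⟨rfl, h⟩ | ⟨i, x, hx, rfl, h⟩
  · rw [h, T.depth_root]; rfl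
  · rw [h, (adj_of_mem_entries hx).2.2]; rfl

section scale

variable {s : Scale}

lemma pos_treeSpec_of_mem {i : ℕ} {x : V × V × ℤ × ℤ} (hx : x ∈ T.entries s.M i) :
    (T.treeSpec s.M x.2.1).pos s = entryPos s.M x := by
  rw [treeSpec_of_mem hx]; rfl

lemma posAt_treeSpec (v : V) : T.PosAt s.M (T.depth v) ((T.treeSpec s.M v).pos s) := by
  rcases isTreeSpec_treeSpec (T := T) s.M v with ⟨rfl, h⟩ | ⟨i, x, hx, rfl, h⟩
  · rw [h, T.depth_root]; rfl
  · rw [(adj_of_mem_entries hx).2.2, pos_treeSpec_of_mem hx]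
    exact ⟨x, hx, rfl⟩

lemma Fits.positions (hs : T.Fits s) : Spec.Positions s (T.PosAt s.M) where
  zero := fun _ h => h
  succ := by
    rintro h b ⟨e, he, rfl⟩
    obtain ⟨h1, h2⟩ := entry_bounds hs.length_rot_le he
    exact ⟨_, _, h1, h2, rfl⟩
  bound := by
    intro h b hb
    have hM := s.M_pos
    have h1 := posAt_abs_le hs.length_rot_le s.one_le_k (le_refl s.M) hb
    have h2 : ∃ v, T.depth v = h := by
      cases h with
      | zero => exact ⟨_, T.depth_root⟩
      | succ h =>
        obtain ⟨e, he, -⟩ := hb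
        exact ⟨_, (adj_of_mem_entries he).2.2⟩
    obtain ⟨v, rfl⟩ := h2
    calc 8 * s.M * |b| ≤ 8 * s.M * s.M ^ (2 * T.depth v) := by gcongr
      _ ≤ s.B := hs.pow_le v

lemma Fits.wf_treeSpec (hs : T.Fits s) (v : V) : Spec.WF s (T.PosAt s.M) (T.treeSpec s.M v) := by
  rcases isTreeSpec_treeSpec (T := T) s.M v with ⟨rfl, h⟩ | ⟨i, x, hx, rfl, h⟩
  · rw [h]; rfl
  · rw [h]
    obtain ⟨h1, h2⟩ := entry_bounds hs.length_rot_le hx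
    exact ⟨h1, ⟨x, hx, rfl⟩, h2⟩

lemma Fits.eq_of_pos_eq (hs : T.Fits s) {u v : V} (hd : T.depth u = T.depth v)
    (h : (T.treeSpec s.M u).pos s = (T.treeSpec s.M v).pos s) : u = v := by
  by_cases hu : u = T.root
  · subst hu
    rw [T.depth_root, eq_comm, T.depth_eq_zero] at hd
    exact hd.symm
  · have hv : v ≠ T.root := by
      rintro rfl
      rw [T.depth_root, T.depth_eq_zero] at hd
      exact hu hd
    obtain ⟨u', hu', hdu⟩ := T.exists_parent hu
    obtain ⟨v', hv', hdv⟩ := T.exists_parent hv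
    obtain ⟨x, hx, -, rfl⟩ := exists_entry s.M hu' hdu
    obtain ⟨y, hy, -, rfl⟩ := exists_entry s.M hv' hdv
    have hd' : T.depth u' = T.depth v' := by omega
    rw [← hd'] at hy
    rw [pos_treeSpec_of_mem hx, pos_treeSpec_of_mem hy] at h
    rw [entry_eq_of_pos_eq hs.length_rot_le s.k_lt_M s.M_pos hx hy h]

/-- The ray of a vertex cuts off exactly the parent of the vertex. -/
lemma Fits.par_treeSpec_iff (hs : T.Fits s) {u v : V} :
    Spec.Par s (T.treeSpec s.M u) (T.treeSpec s.M v) ↔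
      T.graph.Adj u v ∧ T.depth u = T.depth v + 1 := by
  rcases isTreeSpec_treeSpec (T := T) s.M u with ⟨rfl, h⟩ | ⟨i, x, hx, rfl, h⟩
  · rw [h, T.depth_root]
    simp [Spec.Par]
  · obtain ⟨h1, h2, h3⟩ := adj_of_mem_entries hx
    rw [h]
    have hp : (T.treeSpec s.M x.1).pos s = x.2.2.1 := by
      cases i with
      | zero =>
        rw [T.depth_eq_zero] at h2
        rw [h2, treeSpec_root]
        exact ((entry_bounds hs.length_rot_le hx).1).symm
      | succ i =>
        simp only [entries, List.mem_flatMap, List.mem_map] at hx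
        obtain ⟨f, hf, z, -, rfl⟩ := hx
        exact pos_treeSpec_of_mem hf
    simp only [Spec.Par, treeSpec_isTree, treeSpec_loc, true_and]
    constructor
    · rintro ⟨h4, h5⟩
      have : v = x.1 := hs.eq_of_pos_eq (by omega) (by rw [hp, h5])
      subst this
      exact ⟨h1.symm, by omega⟩
    · rintro ⟨h4, h5⟩
      have : v = x.1 := T.parent_unique h4.symm h1 h5 (by omega)
      subst this
      exact ⟨h2, hp⟩

/-- Consecutive vertices of a level have the same level and consecutive positions. -/
lemma Fits.consecutive (hs : T.Fits s) {u v : V} (h : T.Consecutive u v) :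
    T.depth u = T.depth v ∧ (T.treeSpec s.M u).pos s ≠ (T.treeSpec s.M v).pos s ∧
      ∀ a, T.PosAt s.M (T.depth u) a →
        a ≤ min ((T.treeSpec s.M u).pos s) ((T.treeSpec s.M v).pos s) ∨
          max ((T.treeSpec s.M u).pos s) ((T.treeSpec s.M v).pos s) ≤ a := by
  have key : ∀ {u v : V}, T.Next u v → T.depth u = T.depth v ∧
      (T.treeSpec s.M u).pos s ≠ (T.treeSpec s.M v).pos s ∧ ∀ a, T.PosAt s.M (T.depth u) a →
        a ≤ min ((T.treeSpec s.M u).pos s) ((T.treeSpec s.M v).pos s) ∨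
          max ((T.treeSpec s.M u).pos s) ((T.treeSpec s.M v).pos s) ≤ a := by
    rintro u v ⟨i, hi⟩
    cases i with
    | zero =>
      have := hi.length_le
      simp [level] at this
    | succ i =>
      rw [← T.map_entries_snd s.M, List.infix_map_iff] at hi
      obtain ⟨l, hl, hlm⟩ := hi
      obtain ⟨x, y, rfl⟩ : ∃ x y, l = [x, y] := by
        rw [← List.length_eq_two, ← List.length_map (f := fun e : V × V × ℤ × ℤ => e.2.1), ← hlm]
        rfl
      simp only [List.map_cons, List.map_nil, List.cons.injEq, and_true] at hlm
      obtain ⟨rfl, rfl⟩ := hlm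
      have hx : x ∈ T.entries s.M i := hl.subset (by simp)
      have hy : y ∈ T.entries s.M i := hl.subset (by simp)
      rw [pos_treeSpec_of_mem hx, pos_treeSpec_of_mem hy, (adj_of_mem_entries hx).2.2,
        (adj_of_mem_entries hy).2.2]
      exact ⟨rfl, gap_of_infix hs.length_rot_le s.k_lt_M s.M_pos hl⟩
  rcases h with h | h
  · exact key h
  · obtain ⟨h1, h2, h3⟩ := key h
    refine ⟨h1.symm, h2.symm, ?_⟩
    rw [min_comm, max_comm, ← h1]
    exact h3

end scale
end EmbeddedTree
end RayGraph

namespace RayGraph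

/-! ### The rays of the internal vertices of the paths -/

/-- `x` and `y` are neighbours on the path `p`. -/
def PathAdj {W : Type*} (p : List W) (x y : W) : Prop := [x, y] <:+: p ∨ [y, x] <:+: p

lemma pathAdj_three {W : Type*} {a b c x y : W} :
    PathAdj [a, b, c] x y ↔ s(x, y) = s(a, b) ∨ s(x, y) = s(b, c) := by
  simp only [PathAdj, List.infix_cons_iff, List.cons_prefix_cons, List.infix_nil, Sym2.eq_iff,
    List.nil_prefix, List.prefix_nil, List.cons_ne_nil, and_true, and_false, or_false]
  tauto

lemma pathAdj_four {W : Type*} {a b c d x y : W} :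
    PathAdj [a, b, c, d] x y ↔ s(x, y) = s(a, b) ∨ s(x, y) = s(b, c) ∨ s(x, y) = s(c, d) := by
  simp only [PathAdj, List.infix_cons_iff, List.cons_prefix_cons, List.infix_nil, Sym2.eq_iff,
    List.nil_prefix, List.prefix_nil, List.cons_ne_nil, and_true, and_false, or_false]
  tauto

lemma pathUnion_adj {W : Type*} {L : List (List W)} {x y : W} :
    (pathUnion L).Adj x y ↔ x ≠ y ∧ ∃ p ∈ L, PathAdj p x y := by
  rw [pathUnion, SimpleGraph.fromRel_adj]
  simp only [PathAdj]
  constructor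
  · rintro ⟨h, ⟨p, hp, h1⟩ | ⟨p, hp, h1⟩⟩
    · exact ⟨h, p, hp, Or.inl h1⟩
    · exact ⟨h, p, hp, Or.inr h1⟩
  · rintro ⟨h, p, hp, h1 | h1⟩
    · exact ⟨h, Or.inl ⟨p, hp, h1⟩⟩
    · exact ⟨h, Or.inr ⟨p, hp, h1⟩⟩

/-- The descriptions of the rays of the internal vertices of the path with number `i`, if the
endpoints of the path have the descriptions `σ u` and `σ v`. -/
def linkEntries {V N : Type*} (s : Scale) (σ : V → Spec) (i : ℤ) : List (V ⊕ N) → List (N × Spec)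
  | [.inl u, .inr w, .inl v] =>
    if (σ u).pos s < (σ v).pos s then [(w, .mid (σ u).loc ((σ u).pos s) ((σ v).pos s) i)]
    else [(w, .mid (σ u).loc ((σ v).pos s) ((σ u).pos s) i)]
  | [.inl u, .inr w, .inr w', .inl v] =>
    if (σ u).pos s < (σ v).pos s then
      [(w, .left (σ u).loc ((σ u).pos s) ((σ v).pos s) i),
        (w', .right (σ u).loc ((σ u).pos s) ((σ v).pos s) i)]
    else
      [(w', .left (σ u).loc ((σ v).pos s) ((σ u).pos s) i),
        (w, .right (σ u).loc ((σ v).pos s) ((σ u).pos s) i)]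
  | _ => []

namespace EmbeddedTree

variable {V N : Type*} [DecidableEq V] {T : EmbeddedTree V} {s : Scale}

/-- The two kinds of links, with the endpoints `u` and `v` in the order of their positions. -/
lemma Fits.link_cases (hs : T.Fits s) {p : List (V ⊕ N)} (hp : T.IsLink p) {i : ℤ}
    (hi : s.k < 2 * i) (hik : i ≤ s.k) :
    ∃ u v : V, T.depth v = T.depth u ∧
      Spec.Gap s (T.PosAt s.M) (T.depth u) ((T.treeSpec s.M u).pos s)
        ((T.treeSpec s.M v).pos s) i ∧
      ((∃ w, linkEntries s (T.treeSpec s.M) i p = [(w, .mid (T.depth u)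
            ((T.treeSpec s.M u).pos s) ((T.treeSpec s.M v).pos s) i)] ∧
          (∀ z, Sum.inr z ∈ p ↔ z = w) ∧
          ∀ x y, PathAdj p x y ↔ s(x, y) = s(.inl u, .inr w) ∨ s(x, y) = s(.inr w, .inl v)) ∨
        (∃ w w', w ≠ w' ∧ linkEntries s (T.treeSpec s.M) i p = [(w, .left (T.depth u)
            ((T.treeSpec s.M u).pos s) ((T.treeSpec s.M v).pos s) i), (w', .right (T.depth u)
            ((T.treeSpec s.M u).pos s) ((T.treeSpec s.M v).pos s) i)] ∧
          (∀ z, Sum.inr z ∈ p ↔ z = w ∨ z = w') ∧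
          ∀ x y, PathAdj p x y ↔ s(x, y) = s(.inl u, .inr w) ∨ s(x, y) = s(.inr w, .inr w') ∨
            s(x, y) = s(.inr w', .inl v))) := by
  obtain ⟨u, v, -, -, hc, hp⟩ := hp
  obtain ⟨hd, hne, hgap⟩ := hs.consecutive hc
  rcases lt_or_gt_of_ne hne with hlt | hlt
  · refine ⟨u, v, hd.symm, ⟨posAt_treeSpec u, hd ▸ posAt_treeSpec v, hlt, ?_, hi, hik⟩, ?_⟩
    · rwa [min_eq_left hlt.le, max_eq_right hlt.le] at hgap
    rcases hp with ⟨w, rfl⟩ | ⟨w, w', hw, rfl⟩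
    · refine Or.inl ⟨w, ?_, by simp, fun x y => pathAdj_three⟩
      simp [linkEntries, treeSpec_loc, hlt]
    · refine Or.inr ⟨w, w', hw, ?_, by simp, fun x y => pathAdj_four⟩
      simp [linkEntries, treeSpec_loc, hlt]
  · refine ⟨v, u, hd, ⟨posAt_treeSpec v, hd ▸ posAt_treeSpec u, hlt, ?_, hi, hik⟩, ?_⟩
    · rwa [min_eq_right hlt.le, max_eq_left hlt.le, hd] at hgap
    rcases hp with ⟨w, rfl⟩ | ⟨w, w', hw, rfl⟩
    · refine Or.inl ⟨w, ?_, by simp, fun x y => ?_⟩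
      · simp [linkEntries, treeSpec_loc, hlt.not_gt, hd]
      · simp only [pathAdj_three, Sym2.eq_iff]; tauto
    · refine Or.inr ⟨w', w, hw.symm, ?_, ?_, fun x y => ?_⟩
      · simp [linkEntries, treeSpec_loc, hlt.not_gt, hd]
      · intro z; simp [or_comm]
      · simp only [pathAdj_four, Sym2.eq_iff]; tauto

/-- The family of links fits the scale. -/
structure FitsLinks (T : EmbeddedTree V) (s : Scale) (L : List (List (V ⊕ N))) : Prop
    extends T.Fits s where
  length_le : 2 * (L.length : ℤ) ≤ s.k

/-- `e` describes the ray of the internal vertex `w` of a path of `L`. The path at place `j` of `L`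
gets the number `s.k / 2 + 1 + j`, which exceeds all child numbers. -/
def IsLinkSpec (T : EmbeddedTree V) (s : Scale) (L : List (List (V ⊕ N))) (w : N) (e : Spec) :
    Prop :=
  ∃ x ∈ L.zipIdx, (w, e) ∈ linkEntries s (T.treeSpec s.M) (s.k / 2 + 1 + (x.2 : ℤ)) x.1

section links

variable {L : List (List (V ⊕ N))}

lemma FitsLinks.idx_bounds (hs : T.FitsLinks s L) {x : List (V ⊕ N) × ℕ}
    (hx : x ∈ L.zipIdx) : s.k < 2 * (s.k / 2 + 1 + (x.2 : ℤ)) ∧ s.k / 2 + 1 + (x.2 : ℤ) ≤ s.k := by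
  have h1 := List.snd_lt_of_mem_zipIdx hx
  have h2 := hs.length_le
  omega

/-- The path through an internal vertex is unique. -/
lemma IsLinkSystem.eq_of_mem (hL : T.IsLinkSystem L) {w : N} {x y : List (V ⊕ N) × ℕ}
    (hx : x ∈ L.zipIdx) (hy : y ∈ L.zipIdx) (hwx : Sum.inr w ∈ x.1) (hwy : Sum.inr w ∈ y.1) :
    x = y := by
  have hd := List.pairwise_iff_getElem.1 hL.disjoint
  obtain ⟨p, i⟩ := x
  obtain ⟨q, j⟩ := y
  rw [List.mem_zipIdx_iff_getElem?, List.getElem?_eq_some_iff] at hx hy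
  obtain ⟨hi, hi'⟩ := hx
  obtain ⟨hj, hj'⟩ := hy
  simp only at hi hj hi' hj' hwx hwy
  subst hi' hj'
  rcases lt_trichotomy i j with h | h | h
  · exact absurd hwy (hd i j hi hj h w hwx)
  · subst h; rfl
  · exact absurd hwx (hd j i hj hi h w hwy)

lemma mem_of_mem_zipIdx {α : Type*} {l : List α} {x : α × ℕ} (h : x ∈ l.zipIdx) : x.1 ∈ l := by
  have := List.fst_eq_of_mem_zipIdx h
  rw [this]
  exact List.getElem_mem _

lemma FitsLinks.mem_of_entry (hs : T.FitsLinks s L) (hL : T.IsLinkSystem L) {w : N} {e : Spec}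
    {x : List (V ⊕ N) × ℕ} (hx : x ∈ L.zipIdx)
    (h : (w, e) ∈ linkEntries s (T.treeSpec s.M) (s.k / 2 + 1 + (x.2 : ℤ)) x.1) :
    Sum.inr w ∈ x.1 := by
  obtain ⟨hi, hik⟩ := hs.idx_bounds hx
  obtain ⟨u, v, -, -, ⟨z, hz, hm, -⟩ | ⟨z, z', -, hz, hm, -⟩⟩ :=
    hs.link_cases (hL.isLink x.1 (mem_of_mem_zipIdx hx)) hi hik
  all_goals
    rw [hz] at h
    rw [hm]
    grind

lemma FitsLinks.exists_isLinkSpec (hs : T.FitsLinks s L) (hL : T.IsLinkSystem L) (w : N) :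
    ∃ e, T.IsLinkSpec s L w e := by
  obtain ⟨p, hp, hw⟩ := hL.cover w
  obtain ⟨j, hj, rfl⟩ := List.getElem_of_mem hp
  have hx : (L[j], j) ∈ L.zipIdx := by
    rw [List.mem_zipIdx_iff_getElem?]; simp [hj]
  obtain ⟨hi, hik⟩ := hs.idx_bounds hx
  obtain ⟨u, v, -, -, ⟨z, hz, hm, -⟩ | ⟨z, z', -, hz, hm, -⟩⟩ :=
    hs.link_cases (hL.isLink _ hp) hi hik
  · obtain rfl := (hm w).1 hw
    exact ⟨_, (L[j], j), hx, by rw [hz]; exact List.mem_singleton_self _⟩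
  · rcases (hm w).1 hw with rfl | rfl
    · exact ⟨_, (L[j], j), hx, by rw [hz]; exact List.mem_cons_self⟩
    · exact ⟨_, (L[j], j), hx, by rw [hz]; exact List.mem_cons_of_mem _ (List.mem_singleton_self _)⟩

/-- The description of the ray of an internal vertex `w` of a path is admissible, it cuts off
exactly the neighbours of `w` in the tree, and it is compatible with the other descriptions on the
path. -/
lemma FitsLinks.entry_facts (hs : T.FitsLinks s L) (hL : T.IsLinkSystem L) {w : N} {e : Spec}
    {x : List (V ⊕ N) × ℕ} (hx : x ∈ L.zipIdx)
    (h : (w, e) ∈ linkEntries s (T.treeSpec s.M) (s.k / 2 + 1 + (x.2 : ℤ)) x.1) :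
    ¬ e.IsTree ∧ e.idx = s.k / 2 + 1 + (x.2 : ℤ) ∧ Spec.WF s (T.PosAt s.M) e ∧
      (∀ v, PathAdj x.1 (Sum.inl v) (Sum.inr w) ↔ Spec.Par s e (T.treeSpec s.M v)) ∧
      ∀ w' e', (w', e') ∈ linkEntries s (T.treeSpec s.M) (s.k / 2 + 1 + (x.2 : ℤ)) x.1 →
        (PathAdj x.1 (Sum.inr w) (Sum.inr w') ↔ Spec.Par s e e' ∨ Spec.Par s e' e) ∧
        (w = w' ↔ e = e') ∧ (e ≠ e' → Spec.Compat e e') := by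
  obtain ⟨hi, hik⟩ := hs.idx_bounds hx
  obtain ⟨u, v, hd, hg, hcase⟩ := hs.link_cases (hL.isLink x.1 (mem_of_mem_zipIdx hx)) hi hik
  have heq : ∀ {a b : V}, T.depth a = T.depth b ∧
      (T.treeSpec s.M a).pos s = (T.treeSpec s.M b).pos s ↔ a = b :=
    fun {a b} => ⟨fun h => hs.eq_of_pos_eq h.1 h.2, fun h => h ▸ ⟨rfl, rfl⟩⟩
  rcases hcase with ⟨z, hz, hm, hadj⟩ | ⟨z, z', hne, hz, hm, hadj⟩
  · rw [hz, List.mem_singleton, Prod.mk.injEq] at h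
    obtain ⟨rfl, rfl⟩ := h
    refine ⟨id, rfl, hg, fun a => ?_, fun w' e' h' => ?_⟩
    · rw [hadj]
      simp only [Spec.Par, treeSpec_isTree, treeSpec_loc, true_and, and_or_left, heq]
      rw [← hd, heq]
      simp
    · rw [hz, List.mem_singleton, Prod.mk.injEq] at h'
      obtain ⟨rfl, rfl⟩ := h'
      rw [hadj]
      simp [Spec.Par, Spec.IsTree]
  · have hne' := hne.symm
    rw [hz] at h ⊢
    simp only [List.mem_cons, Prod.mk.injEq, List.not_mem_nil, or_false] at h
    rcases h with ⟨rfl, rfl⟩ | ⟨rfl, rfl⟩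
    · refine ⟨id, rfl, hg, fun a => ?_, fun w' e' h' => ?_⟩
      · rw [hadj]
        simp [Spec.Par, treeSpec_isTree, treeSpec_loc, heq, hne]
      · rw [hadj]
        simp only [List.mem_cons, Prod.mk.injEq, List.not_mem_nil, or_false] at h'
        rcases h' with ⟨rfl, rfl⟩ | ⟨rfl, rfl⟩
        · simp [Spec.Par, Spec.IsTree, hne]
        · simp [Spec.Par, Spec.IsTree, hne, Spec.Compat, Spec.idx]
    · refine ⟨id, rfl, hg, fun a => ?_, fun w' e' h' => ?_⟩
      · rw [hadj]
        have : Spec.IsTree (T.treeSpec s.M a) := treeSpec_isTree _ _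
        have h3 : T.treeSpec s.M a ≠ .left (T.depth u) ((T.treeSpec s.M u).pos s)
            ((T.treeSpec s.M v).pos s) (s.k / 2 + 1 + (x.2 : ℤ)) := by
          intro h3; rw [h3] at this; exact this
        simp only [Spec.Par, this, treeSpec_loc, true_and, h3, or_false]
        rw [← hd, heq]
        simp [hne']
      · rw [hadj]
        simp only [List.mem_cons, Prod.mk.injEq, List.not_mem_nil, or_false] at h'
        rcases h' with ⟨rfl, rfl⟩ | ⟨rfl, rfl⟩
        · simp [Spec.Par, Spec.IsTree, hne', Spec.Compat, Spec.idx]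
        · simp [Spec.Par, Spec.IsTree, hne']

lemma FitsLinks.isLinkSpec_unique (hs : T.FitsLinks s L) (hL : T.IsLinkSystem L) {w : N}
    {e f : Spec} (he : T.IsLinkSpec s L w e) (hf : T.IsLinkSpec s L w f) : e = f := by
  obtain ⟨x, hx, he⟩ := he
  obtain ⟨y, hy, hf⟩ := hf
  obtain rfl := hL.eq_of_mem hx hy (hs.mem_of_entry hL hx he) (hs.mem_of_entry hL hy hf)
  exact (((hs.entry_facts hL hx he).2.2.2.2 w f hf).2.1).1 rfl

open Classical in
/-- The combinatorial description of the ray of a vertex of the graph. The value `root` in the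
second case is never taken if `L` is a link system that fits the scale. -/
noncomputable def spec (T : EmbeddedTree V) (s : Scale) (L : List (List (V ⊕ N))) : V ⊕ N → Spec
  | .inl v => T.treeSpec s.M v
  | .inr w => if h : ∃ e, T.IsLinkSpec s L w e then h.choose else .root

lemma FitsLinks.isLinkSpec_spec (hs : T.FitsLinks s L) (hL : T.IsLinkSystem L) (w : N) :
    T.IsLinkSpec s L w (T.spec s L (.inr w)) := by
  have h := hs.exists_isLinkSpec hL w
  rw [spec, dif_pos h]
  exact h.choose_spec

lemma FitsLinks.spec_inr_eq (hs : T.FitsLinks s L) (hL : T.IsLinkSystem L) {w : N} {e : Spec}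
    (h : T.IsLinkSpec s L w e) : T.spec s L (.inr w) = e :=
  hs.isLinkSpec_unique hL (hs.isLinkSpec_spec hL w) h

lemma pathAdj_mem {W : Type*} {p : List W} {x y : W} (h : PathAdj p x y) : x ∈ p ∧ y ∈ p := by
  rcases h with h | h
  · exact ⟨h.subset (by simp), h.subset (by simp)⟩
  · exact ⟨h.subset (by simp), h.subset (by simp)⟩

/-- The descriptions of the rays are compatible and reflect the adjacency in the graph. -/
lemma FitsLinks.spec_facts (hs : T.FitsLinks s L) (hL : T.IsLinkSystem L) {x y : V ⊕ N}
    (hxy : x ≠ y) :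
    T.spec s L x ≠ T.spec s L y ∧ Spec.Compat (T.spec s L x) (T.spec s L y) ∧
      ((T.plus (pathUnion L)).Adj x y ↔ Spec.Par s (T.spec s L x) (T.spec s L y) ∨
        Spec.Par s (T.spec s L y) (T.spec s L x)) := by
  have htl : ∀ (v : V) (w : N), T.spec s L (.inl v) ≠ T.spec s L (.inr w) ∧
      ((T.plus (pathUnion L)).Adj (.inl v) (.inr w) ↔
        Spec.Par s (T.spec s L (.inr w)) (T.spec s L (.inl v))) ∧
        ¬ Spec.Par s (T.spec s L (.inl v)) (T.spec s L (.inr w)) := by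
    intro v w
    obtain ⟨a, ha, h⟩ := hs.isLinkSpec_spec hL w
    obtain ⟨h1, h2, h3, h4, h5⟩ := hs.entry_facts hL ha h
    have h6 : (T.spec s L (.inl v)).IsTree := treeSpec_isTree _ _
    refine ⟨fun h7 => h1 (h7 ▸ h6), ?_, ?_⟩
    · refine Iff.trans ?_ (h4 v)
      simp only [plus, SimpleGraph.sup_adj, pathUnion_adj, SimpleGraph.map_adj]
      constructor
      · rintro (⟨_, _, _, _, h7⟩ | ⟨-, p, hp, h7⟩)
        · cases h7
        · obtain ⟨j, hj, rfl⟩ := List.getElem_of_mem hp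
          have hx : (L[j], j) ∈ L.zipIdx := by
            rw [List.mem_zipIdx_iff_getElem?]; simp [hj]
          have := hL.eq_of_mem hx ha (pathAdj_mem h7).2 (hs.mem_of_entry hL ha h)
          rw [← this]; exact h7
      · intro h7
        exact Or.inr ⟨by simp, a.1, mem_of_mem_zipIdx ha, h7⟩
    · intro h7
      have h8 : ∀ e f : Spec, e.IsTree → Spec.Par s e f → f.IsTree := by
        intro e f h8 h9
        cases e with
        | root => exact h9.elim
        | tree h p b => exact h9.1
        | _ => exact h8.elim
      exact h1 (h8 _ _ h6 h7)
  rcases x with u | w <;> rcases y with v | z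
  · have huv : u ≠ v := fun h => hxy (congrArg _ h)
    refine ⟨fun h => ?_, fun h => absurd (treeSpec_isTree _ _) h, ?_⟩
    · refine huv (hs.eq_of_pos_eq ?_ (congrArg _ h))
      have := congrArg Spec.loc h
      rwa [spec, spec, treeSpec_loc, treeSpec_loc] at this
    · rw [spec, spec, hs.par_treeSpec_iff, hs.par_treeSpec_iff]
      simp only [plus, SimpleGraph.sup_adj, pathUnion_adj, SimpleGraph.map_adj]
      constructor
      · rintro (⟨a, b, h, h1, h2⟩ | ⟨-, p, hp, h⟩)
        · obtain rfl : a = u := Sum.inl.inj h1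
          obtain rfl : b = v := Sum.inl.inj h2
          rcases T.depth_adj h with h3 | h3
          · exact Or.inl ⟨h, h3⟩
          · exact Or.inr ⟨h.symm, h3⟩
        · exfalso
          obtain ⟨_, _, -, -, -, ⟨_, hp'⟩ | ⟨_, _, -, hp'⟩⟩ := hL.isLink p hp
          · rw [hp', pathAdj_three] at h; simp at h
          · rw [hp', pathAdj_four] at h; simp at h
      · rintro (⟨h, -⟩ | ⟨h, -⟩)
        · exact Or.inl ⟨u, v, h, rfl, rfl⟩
        · exact Or.inl ⟨u, v, h.symm, rfl, rfl⟩
  · obtain ⟨h1, h2, h3⟩ := htl u z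
    exact ⟨h1, fun h => absurd (treeSpec_isTree _ _) h, by rw [h2, or_iff_right h3]⟩
  · obtain ⟨h1, h2, h3⟩ := htl v w
    exact ⟨h1.symm, fun _ h => absurd (treeSpec_isTree _ _) h, by
      rw [SimpleGraph.adj_comm, h2, or_iff_left h3]⟩
  · have hwz : w ≠ z := fun h => hxy (congrArg _ h)
    obtain ⟨a, ha, hw⟩ := hs.isLinkSpec_spec hL w
    obtain ⟨b, hb, hz⟩ := hs.isLinkSpec_spec hL z
    obtain ⟨w1, w2, w3, w4, w5⟩ := hs.entry_facts hL ha hw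
    obtain ⟨z1, z2, z3, z4, z5⟩ := hs.entry_facts hL hb hz
    have hadj : (T.plus (pathUnion L)).Adj (.inr w) (.inr z) ↔ PathAdj a.1 (.inr w) (.inr z) := by
      simp only [plus, SimpleGraph.sup_adj, pathUnion_adj, SimpleGraph.map_adj]
      constructor
      · rintro (⟨_, _, _, h7, _⟩ | ⟨-, p, hp, h7⟩)
        · cases h7
        · obtain ⟨j, hj, rfl⟩ := List.getElem_of_mem hp
          have hx : (L[j], j) ∈ L.zipIdx := by
            rw [List.mem_zipIdx_iff_getElem?]; simp [hj]
          have := hL.eq_of_mem hx ha (pathAdj_mem h7).1 (hs.mem_of_entry hL ha hw)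
          rw [← this]; exact h7
      · intro h7
        exact Or.inr ⟨hxy, a.1, mem_of_mem_zipIdx ha, h7⟩
    rw [hadj]
    by_cases hab : a = b
    · subst hab
      obtain ⟨c1, c2, c3⟩ := w5 _ _ hz
      have hne : T.spec s L (.inr w) ≠ T.spec s L (.inr z) := fun h => hwz (c2.2 h)
      exact ⟨hne, c3 hne, c1⟩
    · have hidx : (T.spec s L (.inr w)).idx ≠ (T.spec s L (.inr z)).idx := by
        intro h
        rw [w2, z2] at h
        have h' : a.2 = b.2 := by omega
        apply hab
        have h1 := List.mem_zipIdx_iff_getElem?.1 ha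
        have h2 := List.mem_zipIdx_iff_getElem?.1 hb
        rw [h', h2] at h1
        exact Prod.ext (Option.some.inj h1).symm h'
      have hpar : ∀ e f : Spec, ¬ f.IsTree → e.idx ≠ f.idx → ¬ Spec.Par s e f := by
        intro e f h1 h2 h3
        cases e with
        | root => exact h3
        | right h p q i =>
          rcases h3 with h3 | rfl
          · exact h1 h3.1
          · exact h2 rfl
        | _ => exact h1 h3.1
      refine ⟨fun h => hidx (congrArg _ h), fun _ _ h => absurd h hidx, ?_⟩
      have h8 : ¬ PathAdj a.1 (.inr w) (.inr z) := fun h8 =>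
        hab (hL.eq_of_mem ha hb (pathAdj_mem h8).2 (hs.mem_of_entry hL hb hz))
      simp [h8, hpar _ _ z1 hidx, hpar _ _ w1 hidx.symm]

lemma FitsLinks.wf_spec (hs : T.FitsLinks s L) (hL : T.IsLinkSystem L) (x : V ⊕ N) :
    Spec.WF s (T.PosAt s.M) (T.spec s L x) := by
  rcases x with v | w
  · exact hs.wf_treeSpec v
  · obtain ⟨a, ha, hw⟩ := hs.isLinkSpec_spec hL w
    exact (hs.entry_facts hL ha hw).2.2.1

/-- The rays represent the complement of the graph. -/
theorem FitsLinks.isIntersectionGraph (hs : T.FitsLinks s L) (hL : T.IsLinkSystem L) :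
    IsIntersectionGraph (T.plus (pathUnion L))ᶜ (fun x => ((T.spec s L x).ray s).toSet) := by
  intro x y hxy
  obtain ⟨h1, h2, h3⟩ := hs.spec_facts hL hxy
  obtain ⟨-, h2', -⟩ := hs.spec_facts hL hxy.symm
  rw [Spec.ray_inter_iff hs.positions (hs.wf_spec hL x) (hs.wf_spec hL y) h1 h2 h2', ← h3,
    SimpleGraph.compl_adj]
  simp [hxy]

end links

/-! ### The choice of the scale -/

/-- A scale that fits a tree with `m` vertices and paths with `k` internal vertices. -/
def scaleOf (m k : ℕ) : Scale where
  k := 2 * (m + k + 1)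
  B := (128 * (m + k + 1)) ^ (2 * m + 2)
  one_le_k := by omega
  k_le_B := by
    have h1 : (1 : ℤ) ≤ 128 * (m + k + 1) := by omega
    have h2 : (128 * ((m : ℤ) + k + 1)) ^ 2 ≤ (128 * ((m : ℤ) + k + 1)) ^ (2 * m + 2) :=
      pow_le_pow_right₀ h1 (by omega)
    linarith

lemma fitsLinks_scaleOf [Fintype V] [Fintype N] {L : List (List (V ⊕ N))}
    (hL : T.IsLinkSystem L) : T.FitsLinks (scaleOf (Fintype.card V) (Fintype.card N)) L where
  length_rot_le v := by
    have := (T.rot_nodup v).length_le_card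
    simp only [scaleOf]
    omega
  pow_le v := by
    have h1 := T.depth_lt_card v
    have h2 : (1 : ℤ) ≤ (Fintype.card V + Fintype.card N + 1 : ℤ) := by omega
    simp only [scaleOf, Scale.M]
    obtain ⟨n, hn⟩ : ∃ n : ℤ, n = (Fintype.card V + Fintype.card N + 1 : ℤ) := ⟨_, rfl⟩
    rw [← hn] at h2 ⊢
    rw [show 64 * (2 * n) = 128 * n by ring]
    calc 8 * (128 * n) * (128 * n) ^ (2 * T.depth v)
        ≤ (128 * n) * (128 * n) * (128 * n) ^ (2 * T.depth v) := by gcongr; linarith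
      _ = (128 * n) ^ (2 * T.depth v + 2) := by ring
      _ ≤ (128 * n) ^ (2 * Fintype.card V + 2) := by
        apply pow_le_pow_right₀ (by linarith) (by omega)
  length_le := by
    have h1 : ∀ p ∈ L, ∃ w : N, Sum.inr w ∈ p := by
      intro p hp
      obtain ⟨_, _, -, -, -, ⟨w, rfl⟩ | ⟨w, _, -, rfl⟩⟩ := hL.isLink p hp
      · exact ⟨w, by simp⟩
      · exact ⟨w, by simp⟩
    choose f hf using h1
    have h2 : (L.attach.map fun p => f p.1 p.2).Nodup := by
      rw [List.Nodup, List.pairwise_map]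
      have h3 : L.attach.Pairwise fun p q => ∀ w : N, Sum.inr w ∈ p.1 → Sum.inr w ∉ q.1 := by
        rw [← List.pairwise_map (f := Subtype.val)
          (R := fun p q : List (V ⊕ N) => ∀ w : N, Sum.inr w ∈ p → Sum.inr w ∉ q),
          List.attach_map_subtype_val]
        exact hL.disjoint
      refine h3.imp fun {p q} h h4 => h _ (hf p.1 p.2) ?_
      rw [h4]; exact hf q.1 q.2
    have h3 := h2.length_le_card
    rw [List.length_map, List.length_attach] at h3
    simp only [scaleOf]
    omega

end EmbeddedTree

theorem isRay_toSet (ρ : IntRay) : IsRay ρ.toSet := by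
  refine ⟨_, _, ?_, rfl⟩
  intro h
  apply ρ.direction_ne_zero
  obtain ⟨h1, h2⟩ := Prod.ext_iff.1 h
  simp only [Prod.fst_zero, Prod.snd_zero, Int.cast_eq_zero] at h1 h2
  exact Prod.ext h1 h2

theorem EmbeddedTree.isRayIntersectionGraph_compl_plus {V N : Type*} [Finite V] [Finite N]
    [DecidableEq V] (T : EmbeddedTree V) {P : SimpleGraph (V ⊕ N)}
    (hP : T.IsAdmissibleExtension P) : IsRayIntersectionGraph (T.plus P)ᶜ := by
  obtain ⟨L, hL, rfl⟩ := hP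
  have := Fintype.ofFinite V
  have := Fintype.ofFinite N
  exact ⟨_, fun _ => isRay_toSet _, (fitsLinks_scaleOf hL).isIntersectionGraph hL⟩

end RayGraph

namespace RayGraph

/-! ### Polynomial bounds -/

variable {Γ : Type*} {μ : Γ → ℕ}

/-- The numbers `b γ` are bounded by a polynomial in the numbers `μ γ`. -/
def PolyBound (μ b : Γ → ℕ) : Prop := ∃ q : Polynomial ℕ, ∀ γ, b γ ≤ q.eval (μ γ)

namespace PolyBound

variable {a b : Γ → ℕ}

lemma const (c : ℕ) : PolyBound μ fun _ => c := ⟨Polynomial.C c, by simp⟩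

lemma self : PolyBound μ μ := ⟨Polynomial.X, by simp⟩

lemma mono (hb : PolyBound μ b) (h : ∀ γ, a γ ≤ b γ) : PolyBound μ a :=
  hb.imp fun _ hq γ => (h γ).trans (hq γ)

lemma add (ha : PolyBound μ a) (hb : PolyBound μ b) : PolyBound μ fun γ => a γ + b γ := by
  obtain ⟨p, hp⟩ := ha
  obtain ⟨q, hq⟩ := hb
  exact ⟨p + q, fun γ => by rw [Polynomial.eval_add]; exact add_le_add (hp γ) (hq γ)⟩

lemma mul (ha : PolyBound μ a) (hb : PolyBound μ b) : PolyBound μ fun γ => a γ * b γ := by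
  obtain ⟨p, hp⟩ := ha
  obtain ⟨q, hq⟩ := hb
  exact ⟨p * q, fun γ => by rw [Polynomial.eval_mul]; exact Nat.mul_le_mul (hp γ) (hq γ)⟩

lemma reindex {Δ : Type*} (ha : PolyBound μ a) (r : Δ → Γ) :
    PolyBound (fun δ => μ (r δ)) fun δ => a (r δ) :=
  ha.imp fun _ hq δ => hq (r δ)

end PolyBound

namespace Data

lemma size_pos (d : Data) : 1 ≤ d.size := by cases d <;> simp [size]

lemma size_ofList_le {l : List Data} {b : ℕ} (h : ∀ d ∈ l, d.size ≤ b) :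
    (ofList l).size ≤ l.length * (b + 1) + 1 := by
  induction l with
  | nil => simp [ofList, size]
  | cons d l ih =>
    have h1 := ih fun x hx => h x (List.mem_cons_of_mem _ hx)
    have h2 := h d List.mem_cons_self
    simp only [ofList, size, List.length_cons]
    linarith

lemma length_le_size_ofList (l : List Data) : l.length ≤ (ofList l).size := by
  induction l with
  | nil => simp
  | cons d l ih => simp only [ofList, size, List.length_cons]; omega

lemma size_le_size_ofList {l : List Data} {d : Data} (h : d ∈ l) :
    d.size ≤ (ofList l).size := by
  induction l with
  | nil => cases h
  | cons a l ih =>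
    simp only [ofList, size]
    rcases List.mem_cons.1 h with rfl | h
    · omega
    · have := ih h; omega

lemma size_int_le_iff {z : ℤ} {b : ℕ} : (int z).size ≤ b + 1 ↔ z.natAbs < 2 ^ b := by
  rw [size, Nat.add_le_add_iff_right, Nat.size_le]

lemma natAbs_lt (z : ℤ) : z.natAbs < 2 ^ z.natAbs.size := Nat.lt_size_self _

lemma size_add_le (a b : ℤ) : (int (a + b)).size ≤ (int a).size + (int b).size := by
  have : (int (a + b)).size ≤ (a.natAbs.size + b.natAbs.size + 1) + 1 := by
    rw [size_int_le_iff]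
    have h1 := natAbs_lt a
    have h2 := natAbs_lt b
    have h3 : 2 ^ a.natAbs.size ≤ 2 ^ (a.natAbs.size + b.natAbs.size) :=
      Nat.pow_le_pow_right (by norm_num) (by omega)
    have h4 : 2 ^ b.natAbs.size ≤ 2 ^ (a.natAbs.size + b.natAbs.size) :=
      Nat.pow_le_pow_right (by norm_num) (by omega)
    have h5 := Int.natAbs_add_le a b
    rw [pow_succ]
    omega
  simp only [size] at this ⊢
  omega

lemma size_neg (a : ℤ) : (int (-a)).size = (int a).size := by simp [size]

lemma size_mul_le (a b : ℤ) : (int (a * b)).size ≤ (int a).size + (int b).size := by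
  have : (int (a * b)).size ≤ (a.natAbs.size + b.natAbs.size) + 1 := by
    rw [size_int_le_iff, Int.natAbs_mul, pow_add]
    exact Nat.mul_lt_mul'' (natAbs_lt a) (natAbs_lt b)
  simp only [size] at this ⊢
  omega

lemma size_le_of_natAbs_le {a b : ℤ} (h : a.natAbs ≤ b.natAbs) : (int a).size ≤ (int b).size :=
  Nat.add_le_add_right (Nat.size_le_size h) 1

lemma size_le_of_abs_le {a b : ℤ} (h : |a| ≤ b) : (int a).size ≤ (int b).size :=
  size_le_of_natAbs_le (by rw [Int.abs_eq_natAbs] at h; omega)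

lemma size_div_le (a b : ℤ) : (int (a / b)).size ≤ (int a).size := by
  apply size_le_of_natAbs_le
  have := Int.abs_ediv_le_abs a b
  rw [Int.abs_eq_natAbs, Int.abs_eq_natAbs] at this
  omega

lemma size_pow_le (a : ℤ) (n : ℕ) : (int (a ^ n)).size ≤ (n + 1) * (int a).size + 1 := by
  induction n with
  | zero => simp [size]
  | succ n ih =>
    rw [pow_succ]
    have := size_mul_le (a ^ n) a
    linarith

lemma size_nat_le (n : ℕ) : (int n).size ≤ n + 1 := by
  rw [size_int_le_iff, Int.natAbs_natCast]
  exact Nat.lt_two_pow_self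

end Data

open Data

lemma PolyBound.size_pair {a b : Γ → Data} (ha : PolyBound μ fun γ => (a γ).size)
    (hb : PolyBound μ fun γ => (b γ).size) : PolyBound μ fun γ => (Data.pair (a γ) (b γ)).size :=
  (ha.add hb).add (const 1)

lemma PolyBound.size_ofList {l : Γ → List Data} {c b : Γ → ℕ} (hc : PolyBound μ c)
    (hb : PolyBound μ b) (h : ∀ γ, (l γ).length ≤ c γ) (hl : ∀ γ, ∀ d ∈ l γ, d.size ≤ b γ) :
    PolyBound μ fun γ => (ofList (l γ)).size := by
  refine ((hc.mul (hb.add (const 1))).add (const 1)).mono fun γ => ?_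
  refine (size_ofList_le (hl γ)).trans ?_
  gcongr
  exact h γ

/-! ### Polynomial time computations -/

/-- Programs read their input and write their output, so their sizes bound the time from below. -/
lemma Run.size_le {A : Prog} {x y : Data} {t : ℕ} (h : Run A x y t) :
    x.size ≤ t ∧ y.size ≤ t := by
  induction h with
  | op o x => omega
  | seq => omega
  | pair => simp only [Data.size]; omega
  | cond_true => omega
  | cond_false => omega
  | loop_step => omega
  | loop_stop => omega

/-- Some program computes `f γ` from `e γ`, for all `γ`, in time polynomial in `μ γ`. Here `e γ`
holds the values of all the variables that are in scope. -/
def PolyTime (μ : Γ → ℕ) (e f : Γ → Data) : Prop :=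
  ∃ (A : Prog) (b : Γ → ℕ), PolyBound μ b ∧ ∀ γ, ∃ t ≤ b γ, Run A (e γ) (f γ) t

namespace PolyTime

variable {e f g : Γ → Data} {a b c : Γ → ℤ}

lemma size_left (h : PolyTime μ e f) : PolyBound μ fun γ => (e γ).size := by
  obtain ⟨A, b, hb, h⟩ := h
  refine hb.mono fun γ => ?_
  obtain ⟨t, ht, hr⟩ := h γ
  exact hr.size_le.1.trans ht

lemma size_right (h : PolyTime μ e f) : PolyBound μ fun γ => (f γ).size := by
  obtain ⟨A, b, hb, h⟩ := h
  refine hb.mono fun γ => ?_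
  obtain ⟨t, ht, hr⟩ := h γ
  exact hr.size_le.2.trans ht

lemma congr (h : PolyTime μ e f) (hf : ∀ γ, f γ = g γ) : PolyTime μ e g := by
  obtain rfl : f = g := funext hf
  exact h

/-- Restriction of a computation to a family of instances. -/
lemma reindex {Δ : Type*} (h : PolyTime μ e f) (r : Δ → Γ) :
    PolyTime (fun δ => μ (r δ)) (fun δ => e (r δ)) fun δ => f (r δ) := by
  obtain ⟨A, b, hb, h⟩ := h
  exact ⟨A, _, hb.reindex r, fun δ => h (r δ)⟩

lemma trans (h : PolyTime μ e f) (h' : PolyTime μ f g) : PolyTime μ e g := by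
  obtain ⟨A, b, hb, h⟩ := h
  obtain ⟨A', b', hb', h'⟩ := h'
  refine ⟨.seq A A', _, (hb.add hb').add (.const 1), fun γ => ?_⟩
  obtain ⟨t, ht, hr⟩ := h γ
  obtain ⟨t', ht', hr'⟩ := h' γ
  exact ⟨_, by omega, hr.seq hr'⟩

lemma of_op (o : Op) (he : PolyBound μ fun γ => (e γ).size)
    (ho : PolyBound μ fun γ => (o.apply (e γ)).size) : PolyTime μ e fun γ => o.apply (e γ) :=
  ⟨.op o, _, he.add ho, fun _ => ⟨_, le_rfl, .op o _⟩⟩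

lemma op (o : Op) (h : PolyTime μ e f) (ho : PolyBound μ fun γ => (o.apply (f γ)).size) :
    PolyTime μ e fun γ => o.apply (f γ) :=
  h.trans (of_op o h.size_right ho)

lemma refl (he : PolyBound μ fun γ => (e γ).size) : PolyTime μ e e := of_op .id he he

lemma pair (h : PolyTime μ e f) (h' : PolyTime μ e g) :
    PolyTime μ e fun γ => .pair (f γ) (g γ) := by
  obtain ⟨A, b, hb, h⟩ := h
  obtain ⟨A', b', hb', h'⟩ := h'
  refine ⟨.pair A A', _, (hb.add hb').add (.const 1), fun γ => ?_⟩
  obtain ⟨t, ht, hr⟩ := h γ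
  obtain ⟨t', ht', hr'⟩ := h' γ
  exact ⟨_, by omega, hr.pair hr'⟩

lemma fst (h : PolyTime μ e fun γ => .pair (f γ) (g γ)) : PolyTime μ e f :=
  h.op .fst (h.size_right.mono fun _ => by simp only [Op.apply, size]; omega)

lemma snd (h : PolyTime μ e fun γ => .pair (f γ) (g γ)) : PolyTime μ e g :=
  h.op .snd (h.size_right.mono fun _ => by simp only [Op.apply, size]; omega)

lemma op_snd (h : PolyTime μ e f) : PolyTime μ e fun γ => Op.snd.apply (f γ) :=
  h.op .snd (h.size_right.mono fun γ => by
    cases f γ <;> simp only [Op.apply, size] <;> first | omega | simp)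

lemma isPair (h : PolyTime μ e f) : PolyTime μ e fun γ => Op.isPair.apply (f γ) :=
  h.op .isPair ((PolyBound.const 2).mono fun γ => by
    cases f γ with
    | int z => exact (show (Data.int 0).size ≤ 2 by decide)
    | pair a b => exact (show (Data.int 1).size ≤ 2 by decide))

lemma const (he : PolyBound μ fun γ => (e γ).size) (z : ℤ) : PolyTime μ e fun _ => .int z :=
  of_op (.const z) he (.const _)

lemma add (ha : PolyTime μ e fun γ => .int (a γ)) (hb : PolyTime μ e fun γ => .int (b γ)) :
    PolyTime μ e fun γ => .int (a γ + b γ) :=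
  (ha.pair hb).op .add ((ha.size_right.add hb.size_right).mono fun _ => size_add_le _ _)

lemma sub (ha : PolyTime μ e fun γ => .int (a γ)) (hb : PolyTime μ e fun γ => .int (b γ)) :
    PolyTime μ e fun γ => .int (a γ - b γ) :=
  (ha.pair hb).op .sub ((ha.size_right.add hb.size_right).mono fun γ => by
    have := size_add_le (a γ) (-(b γ))
    rwa [size_neg, ← sub_eq_add_neg] at this)

lemma mul (ha : PolyTime μ e fun γ => .int (a γ)) (hb : PolyTime μ e fun γ => .int (b γ)) :
    PolyTime μ e fun γ => .int (a γ * b γ) :=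
  (ha.pair hb).op .mul ((ha.size_right.add hb.size_right).mono fun _ => size_mul_le _ _)

lemma div (ha : PolyTime μ e fun γ => .int (a γ)) (hb : PolyTime μ e fun γ => .int (b γ)) :
    PolyTime μ e fun γ => .int (a γ / b γ) :=
  (ha.pair hb).op .div (ha.size_right.mono fun _ => size_div_le _ _)

lemma neg (ha : PolyTime μ e fun γ => .int (a γ)) : PolyTime μ e fun γ => .int (-(a γ)) :=
  ((const ha.size_left 0).sub ha).congr fun _ => by rw [zero_sub]

lemma pow (ha : PolyTime μ e fun γ => .int (a γ)) (n : ℕ) :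
    PolyTime μ e fun γ => .int (a γ ^ n) := by
  induction n with
  | zero => exact (const ha.size_left 1).congr fun _ => by rw [pow_zero]
  | succ n ih => exact (ih.mul ha).congr fun γ => by rw [pow_succ]

lemma le (ha : PolyTime μ e fun γ => .int (a γ)) (hb : PolyTime μ e fun γ => .int (b γ)) :
    PolyTime μ e fun γ => .int (if a γ ≤ b γ then 1 else 0) :=
  ((ha.pair hb).op .le ((PolyBound.const 2).mono fun _ => by
    simp only [Op.apply]; split_ifs <;> decide)).congr fun γ => by
      simp only [Op.apply]

lemma eq (ha : PolyTime μ e fun γ => .int (a γ)) (hb : PolyTime μ e fun γ => .int (b γ)) :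
    PolyTime μ e fun γ => .int (if a γ = b γ then 1 else 0) :=
  ((ha.le hb).mul (hb.le ha)).congr fun γ => by
    congr 1
    rcases lt_trichotomy (a γ) (b γ) with h | h | h
    · simp [h.ne, h.not_ge]
    · simp [h]
    · simp [h.ne', h.not_ge]

lemma lt (ha : PolyTime μ e fun γ => .int (a γ)) (hb : PolyTime μ e fun γ => .int (b γ)) :
    PolyTime μ e fun γ => .int (if a γ < b γ then 1 else 0) :=
  ((const ha.size_left 1).sub (hb.le ha)).congr fun γ => by
    congr 1
    by_cases h : a γ < b γ
    · simp [h, h.not_ge]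
    · simp [h, not_lt.1 h]

/-- Case distinction; each branch need only be correct where it is taken. -/
lemma ite_of_subtype {P : Γ → Prop} [DecidablePred P]
    (hc : PolyTime μ e fun γ => .int (if P γ then 1 else 0))
    (hf : PolyTime (fun γ : {γ // P γ} => μ γ) (fun γ => e γ) fun γ => f γ)
    (hg : PolyTime (fun γ : {γ // ¬ P γ} => μ γ) (fun γ => e γ) fun γ => g γ) :
    PolyTime μ e fun γ => if P γ then f γ else g γ := by
  obtain ⟨A, a, ⟨p, hp⟩, h⟩ := hc
  obtain ⟨A', a', ⟨p', hp'⟩, h'⟩ := hf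
  obtain ⟨A'', a'', ⟨p'', hp''⟩, h''⟩ := hg
  refine ⟨.cond A A' A'', _, ⟨p + p' + p'' + 1, fun γ => le_rfl⟩, fun γ => ?_⟩
  simp only [Polynomial.eval_add, Polynomial.eval_one]
  obtain ⟨t, ht, hr⟩ := h γ
  have := hp γ
  by_cases hP : P γ
  · obtain ⟨t', ht', hr'⟩ := h' ⟨γ, hP⟩
    have := hp' ⟨γ, hP⟩
    simp only [if_pos hP] at hr ht' hr' this ⊢
    exact ⟨_, by omega, hr.cond_true (by simp) hr'⟩
  · obtain ⟨t', ht', hr'⟩ := h'' ⟨γ, hP⟩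
    have := hp'' ⟨γ, hP⟩
    simp only [if_neg hP] at hr ht' hr' this ⊢
    exact ⟨_, by omega, hr.cond_false hr'⟩

lemma ite {P : Γ → Prop} [DecidablePred P]
    (hc : PolyTime μ e fun γ => .int (if P γ then 1 else 0))
    (hf : PolyTime μ e f) (hg : PolyTime μ e g) : PolyTime μ e fun γ => if P γ then f γ else g γ :=
  ite_of_subtype hc (hf.reindex Subtype.val) (hg.reindex Subtype.val)

/-- A loop that makes `N γ` steps. It is polynomial since all the states it passes are instances of
the computations of the test and of the step. -/
lemma iterate {st : Γ → ℕ → Data} {N : Γ → ℕ} (hN : PolyBound μ N)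
    {test : {p : Γ × ℕ // p.2 ≤ N p.1} → Data}
    (ht : PolyTime (fun p : {p : Γ × ℕ // p.2 ≤ N p.1} => μ p.1.1) (fun p => st p.1.1 p.1.2) test)
    (htest : ∀ p, test p = .int 0 ↔ p.1.2 = N p.1.1)
    (hs : PolyTime (fun p : {p : Γ × ℕ // p.2 < N p.1} => μ p.1.1) (fun p => st p.1.1 p.1.2)
      fun p => st p.1.1 (p.1.2 + 1)) :
    PolyTime μ (fun γ => st γ 0) fun γ => st γ (N γ) := by
  obtain ⟨C, b, ⟨q, hq⟩, h⟩ := ht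
  obtain ⟨A, b', ⟨q', hq'⟩, h'⟩ := hs
  obtain ⟨qN, hqN⟩ := hN
  refine ⟨.loop C A, _, ⟨(qN + 1) * (q + q' + 1), fun γ => le_rfl⟩, fun γ => ?_⟩
  simp only [Polynomial.eval_add, Polynomial.eval_one, Polynomial.eval_mul]
  have key : ∀ j i, i + j = N γ → ∃ t ≤ (j + 1) * (q.eval (μ γ) + q'.eval (μ γ) + 1),
      Run (.loop C A) (st γ i) (st γ (N γ)) t := by
    intro j
    induction j with
    | zero =>
      intro i hi
      obtain ⟨t, ht, hr⟩ := h ⟨(γ, i), by simp only; omega⟩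
      have := hq ⟨(γ, i), by simp only; omega⟩
      rw [(htest _).2 (by simpa using hi)] at hr
      simp only at ht this hr
      obtain rfl : i = N γ := by omega
      exact ⟨_, by omega, Run.loop_stop hr⟩
    | succ j ih =>
      intro i hi
      obtain ⟨t, ht, hr⟩ := h ⟨(γ, i), by simp only; omega⟩
      have h1 := hq ⟨(γ, i), by simp only; omega⟩
      obtain ⟨t', ht', hr'⟩ := h' ⟨(γ, i), by simp only; omega⟩
      have h2 := hq' ⟨(γ, i), by simp only; omega⟩
      obtain ⟨u, hu, hru⟩ := ih (i + 1) (by omega)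
      simp only at ht h1 hr ht' h2 hr'
      refine ⟨_, ?_, .loop_step hr ?_ hr' hru⟩
      · rw [add_mul _ 1, one_mul]
        omega
      · rw [Ne, htest]; simp only; omega
  obtain ⟨t, ht, hr⟩ := key (N γ) 0 (by omega)
  refine ⟨t, ht.trans ?_, hr⟩
  gcongr
  exact hqN γ

/-- Recursion on a natural number; the step may use the number of the remaining steps. -/
lemma natRec {n : Γ → ℕ} {f : Γ → ℕ → Data} (hn : PolyBound μ n)
    (hne : PolyTime μ e fun γ => .int (n γ)) (h0 : PolyTime μ e fun γ => f γ 0)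
    (hs : PolyTime (fun p : {p : Γ × ℕ // p.2 < n p.1} => μ p.1.1)
      (fun p => .pair (e p.1.1) (.pair (f p.1.1 p.1.2) (.int (n p.1.1 - 1 - p.1.2))))
      fun p => f p.1.1 (p.1.2 + 1)) :
    PolyTime μ e fun γ => f γ (n γ) := by
  obtain ⟨st, hst⟩ : ∃ st : Γ → ℕ → Data, st = fun γ i =>
    .pair (.int (n γ - i)) (.pair (e γ) (f γ i)) := ⟨_, rfl⟩
  have hsz : PolyBound (fun p : {p : Γ × ℕ // p.2 ≤ n p.1} => μ p.1.1)
      fun p => (st p.1.1 p.1.2).size := by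
    have h1 := hs.size_left
    have h2 := h0.size_right
    have h3 := hs.size_right
    have h4 := hne.size_right
    have h5 := hne.size_left
    obtain ⟨q2, h2⟩ := h2
    obtain ⟨q3, h3⟩ := h3
    obtain ⟨q4, h4⟩ := h4
    obtain ⟨q5, h5⟩ := h5
    refine ⟨q2 + q3 + q4 + q5 + 2, ?_⟩
    rintro ⟨⟨γ, i⟩, hi⟩
    simp only [hst, size, Polynomial.eval_add, Polynomial.eval_ofNat]
    have h6 : (n γ - i : ℤ).natAbs.size + 1 ≤ (Data.int (n γ)).size := by
      apply size_le_of_natAbs_le (a := (n γ - i : ℤ))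
      simp only at hi
      omega
    have h7 := h4 γ
    have h8 := h5 γ
    have h9 : (f γ i).size ≤ q2.eval (μ γ) + q3.eval (μ γ) := by
      cases i with
      | zero => have := h2 γ; simp only at this; omega
      | succ i => have := h3 ⟨(γ, i), hi⟩; simp only at this; omega
    simp only at h7 h8
    omega
  have hit : PolyTime μ (fun γ => st γ 0) fun γ => st γ (n γ) := by
    refine iterate hn (test := fun p => .int (n p.1.1 - p.1.2)) ?_ ?_ ?_
    · have := refl hsz
      simp only [hst] at this ⊢
      exact this.fst
    · rintro ⟨⟨γ, i⟩, hi⟩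
      simp only [Data.int.injEq]
      omega
    · have h1 := (refl hsz).reindex
        fun p : {p : Γ × ℕ // p.2 < n p.1} => (⟨p.1, p.2.le⟩ : {p : Γ × ℕ // p.2 ≤ n p.1})
      simp only [hst] at h1 ⊢
      have h2 := h1.fst
      have h3 := h1.snd.fst
      have h4 := h1.snd.snd
      have h5 := (h2.sub (const h2.size_left 1)).congr
        (g := fun p => .int (n p.1.1 - 1 - p.1.2)) fun p => by congr 1; ring
      exact (h5.pair (h3.pair ((h3.pair (h4.pair h5)).trans hs))).congr fun p => by
        congr 2; push_cast; ring
  have h1 : PolyTime μ e fun γ => st γ 0 := by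
    simp only [hst]
    exact (hne.congr fun γ => by simp).pair ((refl h0.size_left).pair h0)
  have h2 := h1.trans hit
  simp only [hst] at h2
  exact h2.snd.snd

end PolyTime
end RayGraph

namespace RayGraph

open Data

/-! ### Lists in polynomial time -/

namespace Data

lemma size_ofList (l : List Data) : (ofList l).size = (l.map fun d => d.size + 1).sum + 1 := by
  induction l with
  | nil => rfl
  | cons d l ih => simp only [ofList, size, ih, List.map_cons, List.sum_cons]; omega

lemma size_ofList_append (l l' : List Data) :
    (ofList (l ++ l')).size + 1 = (ofList l).size + (ofList l').size := by
  simp only [size_ofList, List.map_append, List.sum_append]; omega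

lemma size_ofList_reverse (l : List Data) : (ofList l.reverse).size = (ofList l).size := by
  simp only [size_ofList, List.map_reverse, List.sum_reverse]

lemma size_ofList_flatten_le (l : List (List Data)) :
    (ofList l.flatten).size ≤ (ofList (l.map ofList)).size := by
  induction l with
  | nil => simp
  | cons d l ih =>
    have := size_ofList_append d l.flatten
    simp only [List.flatten_cons, List.map_cons, ofList, size]
    omega

end Data

variable {Γ : Type*} {μ : Γ → ℕ}

/-- A place in one of the lists `l γ`. -/
structure ListIdx {α : Γ → Type*} (l : ∀ γ, List (α γ)) where
  base : Γ
  pre : List (α base)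
  cur : α base
  post : List (α base)
  eq : l base = pre ++ cur :: post

namespace ListIdx

variable {α : Γ → Type*} {l : ∀ γ, List (α γ)}

lemma mem (i : ListIdx l) : i.cur ∈ l i.base := by rw [i.eq]; simp

lemma length_pre_lt (i : ListIdx l) : i.pre.length < (l i.base).length := by
  rw [i.eq, List.length_append, List.length_cons]; omega

/-- The place with a given number. -/
def ofGetElem {γ : Γ} {i : ℕ} (h : i < (l γ).length) : ListIdx l where
  base := γ
  pre := (l γ).take i
  cur := (l γ)[i]
  post := (l γ).drop (i + 1)
  eq := by simp

end ListIdx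

namespace PolyTime

variable {e : Γ → Data}

lemma nil (he : PolyBound μ fun γ => (e γ).size) : PolyTime μ e fun _ => ofList [] := const he 0

lemma cons {a : Γ → Data} {l : Γ → List Data} (ha : PolyTime μ e a)
    (hl : PolyTime μ e fun γ => ofList (l γ)) : PolyTime μ e fun γ => ofList (a γ :: l γ) :=
  ha.pair hl

lemma length_bound {α : Γ → Type*} {l : ∀ γ, List (α γ)} {enc : ∀ γ, α γ → Data}
    (hl : PolyTime μ e fun γ => ofList ((l γ).map (enc γ))) :
    PolyBound μ fun γ => (l γ).length :=
  hl.size_right.mono fun γ => by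
    have := length_le_size_ofList ((l γ).map (enc γ))
    rwa [List.length_map] at this

/-- Evaluation of a function on lists that can be computed while reading the list. -/
lemma fold {α : Γ → Type*} {l : ∀ γ, List (α γ)} {enc : ∀ γ, α γ → Data}
    {f : ∀ γ, List (α γ) → Data} (hl : PolyTime μ e fun γ => ofList ((l γ).map (enc γ)))
    (h0 : PolyTime μ e fun γ => f γ [])
    (hs : PolyTime (fun i : ListIdx l => μ i.base)
      (fun i => .pair (e i.base) (.pair (f i.base i.pre) (enc i.base i.cur)))
      fun i => f i.base (i.pre ++ [i.cur])) :
    PolyTime μ e fun γ => f γ (l γ) := by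
  have hlen := length_bound hl
  -- the state: the unread part of the list, the variables in scope, and the value so far
  obtain ⟨st, hst⟩ : ∃ st : Γ → ℕ → Data, st = fun γ i =>
    .pair (ofList (((l γ).drop i).map (enc γ))) (.pair (e γ) (f γ ((l γ).take i))) := ⟨_, rfl⟩
  have hsz : PolyBound (fun p : {p : Γ × ℕ // p.2 ≤ (l p.1).length} => μ p.1.1)
      fun p => (st p.1.1 p.1.2).size := by
    obtain ⟨q2, h2⟩ := h0.size_right
    obtain ⟨q3, h3⟩ := hs.size_right
    obtain ⟨q4, h4⟩ := hl.size_right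
    obtain ⟨q5, h5⟩ := hl.size_left
    refine ⟨q2 + q3 + q4 + q5 + 2, ?_⟩
    rintro ⟨⟨γ, i⟩, hi⟩
    simp only [hst, size, Polynomial.eval_add, Polynomial.eval_ofNat]
    have h6 : (ofList (((l γ).drop i).map (enc γ))).size ≤ (ofList ((l γ).map (enc γ))).size := by
      have := size_ofList_append (((l γ).take i).map (enc γ)) (((l γ).drop i).map (enc γ))
      rw [← List.map_append, List.take_append_drop] at this
      have := size_pos (ofList (((l γ).take i).map (enc γ)))
      omega
    have h7 := h4 γ
    have h8 := h5 γ
    have h9 : (f γ ((l γ).take i)).size ≤ q2.eval (μ γ) + q3.eval (μ γ) := by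
      cases i with
      | zero => have := h2 γ; simp only at this; rw [List.take_zero]; omega
      | succ i =>
        replace hi : i < (l γ).length := hi
        have h10 : (f γ ((l γ).take i ++ [(l γ)[i]'hi])).size ≤ q3.eval (μ γ) :=
          h3 (ListIdx.ofGetElem (γ := γ) (i := i) hi)
        rw [← List.take_succ_eq_append_getElem hi] at h10
        omega
    simp only at h7 h8
    omega
  have hit : PolyTime μ (fun γ => st γ 0) fun γ => st γ (l γ).length := by
    refine iterate hlen
      (test := fun p => .int (if p.1.2 = (l p.1.1).length then 0 else 1)) ?_ ?_ ?_
    · have := refl hsz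
      simp only [hst] at this ⊢
      refine this.fst.isPair.congr ?_
      · rintro ⟨⟨γ, i⟩, hi⟩
        simp only at hi ⊢
        rcases hi.eq_or_lt with rfl | h
        · simp [ofList, Op.apply]
        · rw [if_neg h.ne, List.drop_eq_getElem_cons h]; rfl
    · rintro ⟨⟨γ, i⟩, hi⟩
      simp
    · have h1 := (refl hsz).reindex fun p : {p : Γ × ℕ // p.2 < (l p.1).length} =>
        (⟨p.1, p.2.le⟩ : {p : Γ × ℕ // p.2 ≤ (l p.1).length})
      simp only [hst] at h1 ⊢
      have h2 := h1.fst
      have h3 := h1.snd.fst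
      have h4 := h1.snd.snd
      have h5 := h2.congr (g := fun p => .pair (enc p.1.1 ((l p.1.1)[p.1.2]'p.2))
        (ofList (((l p.1.1).drop (p.1.2 + 1)).map (enc p.1.1)))) fun p => by
          rw [List.drop_eq_getElem_cons p.2]; rfl
      have h6 := hs.reindex fun p : {p : Γ × ℕ // p.2 < (l p.1).length} =>
        ListIdx.ofGetElem (l := l) p.2
      refine h5.snd.pair (h3.pair (((h3.pair (h4.pair h5.fst)).trans h6).congr fun p => ?_))
      rw [List.take_succ_eq_append_getElem p.2]
      rfl
  have h1 : PolyTime μ e fun γ => st γ 0 := by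
    simp only [hst]
    exact (hl.congr fun γ => by simp).pair ((refl h0.size_left).pair (h0.congr fun γ => by simp))
  have h2 := h1.trans hit
  simp only [hst] at h2
  exact h2.snd.snd.congr fun γ => by simp

section

variable {α : Γ → Type*} {l : ∀ γ, List (α γ)} {enc : ∀ γ, α γ → Data}

/-- The variables in scope in the body of a fold. For a body given by a `PolyTime` expression in
these variables, it only remains to bound the size of the intermediate values. -/
lemma fold_env {f : ∀ γ, List (α γ) → Data} (hl : PolyTime μ e fun γ => ofList ((l γ).map (enc γ)))
    (hf : PolyBound (fun i : ListIdx l => μ i.base) fun i => (f i.base i.pre).size) :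
    PolyTime (fun i : ListIdx l => μ i.base)
      (fun i => .pair (e i.base) (.pair (f i.base i.pre) (enc i.base i.cur)))
      (fun i => .pair (e i.base) (.pair (f i.base i.pre) (enc i.base i.cur))) := by
  refine refl ((hl.size_left.reindex ListIdx.base).size_pair (hf.size_pair ?_))
  refine (hl.size_right.reindex ListIdx.base).mono fun i => ?_
  exact size_le_size_ofList (List.mem_map_of_mem i.mem)

end

lemma reverse {l : Γ → List Data} (hl : PolyTime μ e fun γ => ofList (l γ)) :
    PolyTime μ e fun γ => ofList (l γ).reverse := by
  have hl' : PolyTime μ e fun γ => ofList ((l γ).map id) := hl.congr fun γ => by rw [List.map_id]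
  refine fold (l := l) (f := fun _ p => ofList p.reverse) hl' (nil hl.size_left) ?_
  have h := fold_env (f := fun _ p => ofList p.reverse) hl' ((hl.size_right.reindex _).mono
    fun i => by
      rw [i.eq, size_ofList_reverse]
      have := size_ofList_append i.pre (i.cur :: i.post)
      have := size_pos (ofList (i.cur :: i.post))
      omega)
  exact (h.snd.snd.cons h.snd.fst).congr fun i => by simp

lemma append {l l' : Γ → List Data} (hl : PolyTime μ e fun γ => ofList (l γ))
    (hl' : PolyTime μ e fun γ => ofList (l' γ)) : PolyTime μ e fun γ => ofList (l γ ++ l' γ) := by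
  have hr : PolyTime μ e fun γ => ofList ((l γ).reverse.map id) :=
    hl.reverse.congr fun γ => by rw [List.map_id]
  have := fold (l := fun γ => (l γ).reverse) (f := fun γ p => ofList (p.reverse ++ l' γ)) hr
    (hl'.congr fun γ => by simp) ?_
  · exact this.congr fun γ => by simp
  have h := fold_env (f := fun γ p => ofList (p.reverse ++ l' γ)) hr
    (((hl.size_right.add hl'.size_right).reindex _).mono fun i => by
      have h1 := size_ofList_append i.pre.reverse (l' i.base)
      have h2 := size_ofList_append i.pre (i.cur :: i.post)
      have h3 := size_pos (ofList (i.cur :: i.post))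
      rw [← i.eq, size_ofList_reverse] at h2
      rw [size_ofList_reverse] at h1
      omega)
  exact (h.snd.snd.cons h.snd.fst).congr fun i => by simp

lemma flatten {l : Γ → List (List Data)} (hl : PolyTime μ e fun γ => ofList ((l γ).map ofList)) :
    PolyTime μ e fun γ => ofList (l γ).flatten := by
  refine fold (l := l) (f := fun _ p => ofList p.flatten) hl (nil hl.size_left) ?_
  have h := fold_env (f := fun _ p => ofList p.flatten) hl ((hl.size_right.reindex _).mono
    fun i => by
      rw [i.eq, List.map_append]
      have := size_ofList_append (i.pre.map ofList) ((i.cur :: i.post).map ofList)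
      have := size_pos (ofList ((i.cur :: i.post).map ofList))
      have := size_ofList_flatten_le i.pre
      omega)
  exact (h.snd.fst.append h.snd.snd).congr fun i => by simp

section

variable {α : Γ → Type*} {l : ∀ γ, List (α γ)} {enc : ∀ γ, α γ → Data}

/-- Application of a function to the elements of a list and their numbers. -/
lemma mapIdx {g : ∀ γ, α γ → ℕ → Data} (hl : PolyTime μ e fun γ => ofList ((l γ).map (enc γ)))
    (hg : PolyTime (fun i : ListIdx l => μ i.base)
      (fun i => .pair (e i.base) (.pair (enc i.base i.cur) (.int i.pre.length)))
      fun i => g i.base i.cur i.pre.length) :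
    PolyTime μ e fun γ => ofList ((l γ).zipIdx.map fun x => g γ x.1 x.2) := by
  have hlen := length_bound hl
  obtain ⟨f, hf⟩ : ∃ f : ∀ γ, List (α γ) → Data, f = fun γ p =>
    .pair (.int p.length) (ofList (p.zipIdx.map fun x => g γ x.1 x.2).reverse) := ⟨_, rfl⟩
  have key : PolyTime μ e fun γ => f γ (l γ) := by
    refine fold hl ?_ ?_
    · simp only [hf]
      exact (const hl.size_left 0).pair (nil hl.size_left)
    have h := fold_env (f := f) hl ?_
    · simp only [hf] at h ⊢
      have h1 := h.fst
      have h2 := h.snd.fst.fst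
      have h3 := h.snd.fst.snd
      have h4 := h.snd.snd
      exact ((h2.add (const h.size_left 1)).pair
        (((h1.pair (h4.pair h2)).trans hg).cons h3)).congr fun i => by
          simp [List.zipIdx_append]
    · simp only [hf]
      obtain ⟨q, hq⟩ := hg.size_right
      refine PolyBound.size_pair (((hlen.add (.const 1)).reindex _).mono fun i =>
        (size_nat_le _).trans ?_) (PolyBound.size_ofList (hlen.reindex _)
          (b := fun i => q.eval (μ i.base)) ⟨q, fun _ => le_rfl⟩ ?_ ?_)
      · exact Nat.succ_le_succ i.length_pre_lt.le
      · intro i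
        rw [List.length_reverse, List.length_map, List.length_zipIdx]
        exact i.length_pre_lt.le
      · intro i d hd
        simp only [List.mem_reverse, List.mem_map] at hd
        obtain ⟨⟨a, j⟩, hx, rfl⟩ := hd
        rw [List.mem_zipIdx_iff_getElem?, List.getElem?_eq_some_iff] at hx
        obtain ⟨hj, hx⟩ := hx
        simp only at hj hx
        subst hx
        have h1 := hq ⟨i.base, i.pre.take j, i.pre[j], i.pre.drop (j + 1) ++ i.cur :: i.post, by
          rw [i.eq, ← List.cons_append, ← List.append_assoc, ← List.drop_eq_getElem_cons hj,
            List.take_append_drop]⟩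
        simp only [List.length_take, min_eq_left hj.le] at h1
        exact h1
  simp only [hf] at key
  exact key.snd.reverse.congr fun γ => by simp

lemma map {g : ∀ γ, α γ → Data} (hl : PolyTime μ e fun γ => ofList ((l γ).map (enc γ)))
    (hg : PolyTime (fun i : ListIdx l => μ i.base) (fun i => .pair (e i.base) (enc i.base i.cur))
      fun i => g i.base i.cur) :
    PolyTime μ e fun γ => ofList ((l γ).map (g γ)) := by
  have h1 : PolyTime (fun i : ListIdx l => μ i.base)
      (fun i => .pair (e i.base) (.pair (enc i.base i.cur) (.int i.pre.length)))
      (fun i => .pair (e i.base) (.pair (enc i.base i.cur) (.int i.pre.length))) := by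
    refine refl ((hl.size_left.reindex _).size_pair (PolyBound.size_pair ?_ ?_))
    · exact (hl.size_right.reindex _).mono fun i =>
        size_le_size_ofList (List.mem_map_of_mem i.mem)
    · refine (((length_bound hl).add (.const 1)).reindex _).mono fun i => (size_nat_le _).trans ?_
      exact Nat.succ_le_succ i.length_pre_lt.le
  refine (mapIdx (g := fun γ a _ => g γ a) hl ((h1.fst.pair h1.snd.fst).trans hg)).congr fun γ => ?_
  conv_rhs => rw [← List.zipIdx_map_fst 0 (l γ), List.map_map]
  rfl

lemma flatMap {g : ∀ γ, α γ → List Data} (hl : PolyTime μ e fun γ => ofList ((l γ).map (enc γ)))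
    (hg : PolyTime (fun i : ListIdx l => μ i.base) (fun i => .pair (e i.base) (enc i.base i.cur))
      fun i => ofList (g i.base i.cur)) :
    PolyTime μ e fun γ => ofList ((l γ).flatMap (g γ)) := by
  have h := map (g := fun γ a => ofList (g γ a)) hl hg
  exact (flatten (l := fun γ => (l γ).map (g γ)) (h.congr fun γ => by rw [List.map_map]; rfl)).congr
    fun γ => by rw [List.flatMap]

/-- Search for a key in a table. -/
lemma lookup {key : ∀ γ, α γ → ℤ} {val : ∀ γ, α γ → Data} {k : Γ → ℤ} {v : Γ → Data}
    (hl : PolyTime μ e fun γ => ofList ((l γ).map fun x => .pair (.int (key γ x)) (val γ x)))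
    (hk : PolyTime μ e fun γ => .int (k γ)) (hmem : ∀ γ, ∃ x ∈ l γ, key γ x = k γ)
    (hv : ∀ γ, ∀ x ∈ l γ, key γ x = k γ → val γ x = v γ) : PolyTime μ e v := by
  classical
  obtain ⟨f, hf⟩ : ∃ f : ∀ γ, List (α γ) → Data, f = fun γ p =>
    if ∃ x ∈ p, key γ x = k γ then v γ else .int 0 := ⟨_, rfl⟩
  have hfl : PolyTime μ e fun γ => f γ (l γ) := by
    refine fold hl ?_ ?_
    · exact (const hl.size_left 0).congr fun γ => by simp [hf]
    have h := fold_env (f := f) hl ((hl.size_right.reindex ListIdx.base).mono fun i => ?_)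
    · have h1 := hk.reindex (ListIdx.base : ListIdx l → Γ)
      refine (ite ((h.snd.snd.fst).eq (h.fst.trans h1)) h.snd.snd.snd h.snd.fst).congr fun i => ?_
      by_cases hc : key i.base i.cur = k i.base
      · rw [if_pos hc, hf]
        simp [hc, hv _ _ i.mem hc]
      · rw [if_neg hc]
        simp [hf, hc]
    · simp only [hf]
      split_ifs
      · obtain ⟨x, hx, hxk⟩ := hmem i.base
        rw [← hv _ x hx hxk]
        have := size_le_size_ofList
          (List.mem_map_of_mem (f := fun x => Data.pair (.int (key i.base x)) (val i.base x)) hx)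
        simp only [size] at this ⊢
        omega
      · exact size_pos _
  exact hfl.congr fun γ => by rw [hf]; exact if_pos (hmem γ)

end

/-- Rotation of a list until a given element is its head. The loop over the list makes a rotation by
one as long as the head is a different element. -/
lemma rotate {l : Γ → List ℤ} {k : Γ → ℤ} (hl : PolyTime μ e fun γ => ofList ((l γ).map .int))
    (hk : PolyTime μ e fun γ => .int (k γ)) (hmem : ∀ γ, k γ ∈ l γ) :
    PolyTime μ e fun γ => ofList (((l γ).rotate ((l γ).idxOf (k γ))).map .int) := by
  obtain ⟨f, hf⟩ : ∃ f : Γ → List ℤ → Data, f = fun γ p =>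
    ofList (((l γ).rotate (min p.length ((l γ).idxOf (k γ)))).map .int) := ⟨_, rfl⟩
  have hfl : PolyTime μ e fun γ => f γ (l γ) := by
    refine fold (l := l) hl (hl.congr fun γ => by simp [hf]) ?_
    have h := fold_env (f := f) hl ((hl.size_right.reindex _).mono fun i => ?_)
    · obtain ⟨r, hr⟩ : ∃ r : ListIdx l → List ℤ, r = fun i =>
        (l i.base).rotate (min i.pre.length ((l i.base).idxOf (k i.base))) := ⟨_, rfl⟩
      have hidx : ∀ i : ListIdx l, (l i.base).idxOf (k i.base) < (l i.base).length := fun i =>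
        List.idxOf_lt_length_of_mem (hmem _)
      have hrt : ∀ i, r i = (r i).headD 0 :: (r i).tail := by
        intro i
        have h1 := hidx i
        have h2 : (r i).length = (l i.base).length := by rw [hr]; simp
        cases h3 : r i with
        | nil => rw [h3, List.length_nil] at h2; omega
        | cons a t => rfl
      have hhead : ∀ i, (r i).headD 0 = k i.base ↔ (l i.base).idxOf (k i.base) ≤ i.pre.length := by
        intro i
        have h1 := hidx i
        have h2 : (r i).headD 0 = (l i.base)[min i.pre.length ((l i.base).idxOf (k i.base))]'
            (lt_of_le_of_lt (min_le_right _ _) h1) := by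
          rw [List.headD_eq_head?_getD, hr,
            List.head?_rotate (lt_of_le_of_lt (min_le_right _ _) h1),
            List.getElem?_eq_getElem (lt_of_le_of_lt (min_le_right _ _) h1)]
          rfl
        rw [h2]
        constructor
        · intro h3
          by_contra h4
          simp only [min_eq_left (not_le.1 h4).le] at h3
          have h5 := List.not_of_lt_findIdx (not_le.1 h4)
          simp [h3] at h5
        · intro h3
          simp only [min_eq_right h3]
          exact List.getElem_idxOf h1
      have h2 : PolyTime (fun i : ListIdx l => μ i.base) _ fun i =>
          .pair (.int ((r i).headD 0)) (ofList ((r i).tail.map .int)) :=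
        h.snd.fst.congr fun i => by
          have : f i.base i.pre = ofList ((r i).map .int) := by rw [hf, hr]
          rw [this]
          rw [hrt i]; rfl
      refine (ite (h2.fst.eq (h.fst.trans (hk.reindex (ListIdx.base : ListIdx l → Γ)))) h.snd.fst
        (h2.snd.append (h2.fst.cons (nil h2.size_left)))).congr fun i => ?_
      simp only [hf, hhead]
      split_ifs with h3
      · congr 3
        simp [h3]; omega
      · congr 1
        have h4 : min (i.pre ++ [i.cur]).length ((l i.base).idxOf (k i.base)) =
            min i.pre.length ((l i.base).idxOf (k i.base)) + 1 := by simp; omega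
        have h5 := hrt i
        rw [h4, ← List.rotate_rotate]
        have h6 : (l i.base).rotate (min i.pre.length ((l i.base).idxOf (k i.base))) = r i := by
          rw [hr]
        rw [h6, h5]
        simp
    · simp only [hf]
      apply le_of_eq
      rw [size_ofList, size_ofList, List.map_map, List.map_map]
      congr 1
      exact (List.Perm.map _ (List.rotate_perm _ _)).sum_eq
  refine hfl.congr fun γ => ?_
  simp only [hf]
  rw [min_eq_right (List.idxOf_le_length)]

/-- The list of the first `n` natural numbers. -/
lemma range {n : Γ → ℕ} (hn : PolyBound μ n) (h : PolyTime μ e fun γ => .int (n γ)) :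
    PolyTime μ e fun γ => ofList ((List.range (n γ)).map fun i : ℕ => .int i) := by
  obtain ⟨f, hf⟩ : ∃ f : Γ → ℕ → Data, f = fun γ i =>
    ofList (((List.range (n γ)).drop (n γ - i)).map fun i : ℕ => .int i) := ⟨_, rfl⟩
  have key : PolyTime μ e fun γ => f γ (n γ) := by
    refine natRec hn h ?_ ?_
    · refine (nil h.size_left).congr fun γ => ?_
      simp only [hf, Nat.sub_zero]
      rw [List.drop_eq_nil_of_le (by simp)]
      rfl
    · have hsz : PolyTime (fun p : {p : Γ × ℕ // p.2 < n p.1} => μ p.1.1)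
          (fun p => .pair (e p.1.1) (.pair (f p.1.1 p.1.2) (.int (n p.1.1 - 1 - p.1.2))))
          (fun p => .pair (e p.1.1) (.pair (f p.1.1 p.1.2) (.int (n p.1.1 - 1 - p.1.2)))) := by
        refine refl (PolyBound.size_pair (h.size_left.reindex fun
          p : {p : Γ × ℕ // p.2 < n p.1} => p.1.1) (PolyBound.size_pair ?_ ?_))
        · simp only [hf]
          refine PolyBound.size_ofList (hn.reindex fun
            p : {p : Γ × ℕ // p.2 < n p.1} => p.1.1) ((hn.add (.const 1)).reindex fun
            p : {p : Γ × ℕ // p.2 < n p.1} => p.1.1) ?_ ?_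
          · intro p; simp
          · intro p d hd
            rw [List.mem_map] at hd
            obtain ⟨i, hi, rfl⟩ := hd
            have := List.mem_range.1 (List.mem_of_mem_drop hi)
            exact (size_nat_le i).trans (by omega)
        · refine (hn.add (.const 1)).reindex (fun
            p : {p : Γ × ℕ // p.2 < n p.1} => p.1.1) |>.mono fun p => ?_
          refine le_trans ?_ (size_nat_le (n p.1.1))
          have := p.2
          apply size_le_of_natAbs_le
          omega
      refine (hsz.snd.snd.cons (l := fun p => ((List.range (n p.1.1)).drop (n p.1.1 - p.1.2)).map
        fun i : ℕ => .int i) (hsz.snd.fst.congr fun p => by rw [hf])).congr fun p => ?_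
      obtain ⟨⟨γ, i⟩, hi⟩ := p
      simp only at hi
      simp only [hf]
      have h1 : n γ - i = n γ - (i + 1) + 1 := by omega
      have h2 : n γ - (i + 1) < (List.range (n γ)).length := by rw [List.length_range]; omega
      rw [List.drop_eq_getElem_cons h2, ← h1, List.map_cons, List.getElem_range]
      congr 3
      omega
  exact key.congr fun γ => by simp [hf]

end PolyTime
end RayGraph

namespace RayGraph

open Data

/-! ### Computing the rays -/

namespace PolyTime

variable {Γ : Type*} {μ : Γ → ℕ} {e : Γ → Data}

lemma ite_int {P : Γ → Prop} [DecidablePred P] {a b : Γ → ℤ}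
    (hc : PolyTime μ e fun γ => .int (if P γ then 1 else 0))
    (ha : PolyTime μ e fun γ => .int (a γ)) (hb : PolyTime μ e fun γ => .int (b γ)) :
    PolyTime μ e fun γ => .int (if P γ then a γ else b γ) :=
  (ite hc ha hb).congr fun _ => (apply_ite Data.int _ _ _).symm

/-- Parity of a natural number. -/
lemma parity {a : Γ → ℕ} (ha : PolyTime μ e fun γ => .int (a γ)) (r : ℕ) :
    PolyTime μ e fun γ => .int (if a γ % 2 = r then 1 else 0) := by
  have h1 := const ha.size_left 2
  refine ((ha.sub (h1.mul (ha.div h1))).eq (const ha.size_left r)).congr fun γ => ?_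
  congr 1
  have : (a γ : ℤ) - 2 * ((a γ : ℤ) / 2) = r ↔ a γ % 2 = r := by omega
  simp only [this]

section scale

variable {s : Γ → Scale}

lemma scale_M (hk : PolyTime μ e fun γ => .int (s γ).k) : PolyTime μ e fun γ => .int (s γ).M :=
  (const hk.size_left 64).mul hk

lemma scale_R (hB : PolyTime μ e fun γ => .int (s γ).B) : PolyTime μ e fun γ => .int (s γ).R :=
  hB.pow 12

lemma scale_Z (hB : PolyTime μ e fun γ => .int (s γ).B) : PolyTime μ e fun γ => .int (s γ).Z :=
  hB.pow 5

lemma scale_lift (hB : PolyTime μ e fun γ => .int (s γ).B) :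
    PolyTime μ e fun γ => .int (s γ).lift :=
  hB.pow 3

lemma scale_D (hk : PolyTime μ e fun γ => .int (s γ).k)
    (hB : PolyTime μ e fun γ => .int (s γ).B) : PolyTime μ e fun γ => .int (s γ).D :=
  ((scale_M hk).mul (scale_R hB)).mul (scale_R hB)

/-- The ray of a description, computed from its level, its point and its cutoff. -/
lemma ray (hk : PolyTime μ e fun γ => .int (s γ).k) (hB : PolyTime μ e fun γ => .int (s γ).B)
    {σ : Γ → Spec} (hloc : PolyTime μ e fun γ => .int (σ γ).loc)
    (hlev : PolyTime μ e fun γ => .int (σ γ).lev)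
    (hX : PolyTime μ e fun γ => .int ((σ γ).locX (s γ)))
    (hY : PolyTime μ e fun γ => .int ((σ γ).locY (s γ)))
    (hS : PolyTime μ e fun γ => .int ((σ γ).slope (s γ))) :
    PolyTime μ e fun γ => ((σ γ).ray (s γ)).encode := by
  have hD := scale_D hk hB
  have hx : PolyTime μ e fun γ => .int ((σ γ).dual (s γ)).x := (hloc.mul hD).neg.add hX
  have hy : PolyTime μ e fun γ => .int ((σ γ).dual (s γ)).y := by
    refine ((((hloc.div (const hk.size_left 2)).mul hD).neg).add
      (ite_int (parity hloc 0) hY (hX.sub hY))).congr fun γ => ?_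
    simp only [Spec.dual]
    push_cast
    rfl
  have hc : PolyTime μ e fun γ => .int ((σ γ).dual (s γ)).cut :=
    ite_int (parity hlev 1) hS (hD.sub hS)
  have hs : PolyTime μ e fun γ => .int ((σ γ).dual (s γ)).sgn := by
    refine (ite_int (parity hlev 1) (const hk.size_left 1) (const hk.size_left (-1))).congr
      fun γ => ?_
    simp [DualRay.sgn, Spec.dual]
  exact (hc.pair ((hD.mul hy).sub (hc.mul hx))).pair (hs.pair (hs.mul hx).neg)

lemma hang (hk : PolyTime μ e fun γ => .int (s γ).k) (hB : PolyTime μ e fun γ => .int (s γ).B)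
    {p q b : Γ → ℤ} (hp : PolyTime μ e fun γ => .int (p γ)) (hq : PolyTime μ e fun γ => .int (q γ))
    (hb : PolyTime μ e fun γ => .int (b γ)) :
    PolyTime μ e fun γ => .int (Spec.hang (s γ) (p γ) (q γ) (b γ)) := by
  have hM := scale_M hk
  have h1 := (hp.add hq).add hb
  exact ((((((hM.mul h1).pow 2).sub (hM.mul (h1.pow 2))).sub (hp.mul hq)).sub (hb.mul hp)).add
    (const hk.size_left 1)).add ((scale_R hB).mul (hM.mul h1))

lemma ray_root (hk : PolyTime μ e fun γ => .int (s γ).k)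
    (hB : PolyTime μ e fun γ => .int (s γ).B) :
    PolyTime μ e fun γ => (Spec.root.ray (s γ)).encode :=
  have h0 := const hk.size_left 0
  ray hk hB (σ := fun _ => .root) h0 h0 (((scale_R hB).mul h0).add h0) h0 (scale_D hk hB).neg

variable {h : Γ → ℕ} {p q i : Γ → ℤ}

lemma ray_tree (hk : PolyTime μ e fun γ => .int (s γ).k)
    (hB : PolyTime μ e fun γ => .int (s γ).B) (hh : PolyTime μ e fun γ => .int (h γ))
    (hp : PolyTime μ e fun γ => .int (p γ)) (hi : PolyTime μ e fun γ => .int (i γ)) :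
    PolyTime μ e fun γ => ((Spec.tree (h γ) (p γ) (i γ)).ray (s γ)).encode := by
  have h0 := const hk.size_left 0
  have h1 : PolyTime μ e fun γ => .int ((h γ + 1 : ℕ) : ℤ) :=
    (hh.add (const hk.size_left 1)).congr fun γ => by push_cast; rfl
  have hpos := ((scale_M hk).mul ((hp.add hp).add hi)).neg
  exact ray hk hB (σ := fun γ => .tree (h γ) (p γ) (i γ)) h1 h1 (((scale_R hB).mul hpos).add h0)
    (hpos.pow 2) (hang hk hB hp hp hi)

lemma ray_mid (hk : PolyTime μ e fun γ => .int (s γ).k)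
    (hB : PolyTime μ e fun γ => .int (s γ).B) (hh : PolyTime μ e fun γ => .int (h γ))
    (hp : PolyTime μ e fun γ => .int (p γ)) (hq : PolyTime μ e fun γ => .int (q γ))
    (hi : PolyTime μ e fun γ => .int (i γ)) :
    PolyTime μ e fun γ => ((Spec.mid (h γ) (p γ) (q γ) (i γ)).ray (s γ)).encode := by
  have h1 : PolyTime μ e fun γ => .int ((h γ + 1 : ℕ) : ℤ) :=
    (hh.add (const hk.size_left 1)).congr fun γ => by push_cast; rfl
  have hpos := ((scale_M hk).mul ((hp.add hq).add hi)).neg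
  exact ray hk hB (σ := fun γ => .mid (h γ) (p γ) (q γ) (i γ)) h1 h1
    (((scale_R hB).mul hpos).add (scale_lift hB)) ((hpos.pow 2).add (scale_lift hB))
    (hang hk hB hp hq hi)

lemma ray_left (hk : PolyTime μ e fun γ => .int (s γ).k)
    (hB : PolyTime μ e fun γ => .int (s γ).B) (hh : PolyTime μ e fun γ => .int (h γ))
    (hp : PolyTime μ e fun γ => .int (p γ)) (hq : PolyTime μ e fun γ => .int (q γ))
    (hi : PolyTime μ e fun γ => .int (i γ)) :
    PolyTime μ e fun γ => ((Spec.left (h γ) (p γ) (q γ) (i γ)).ray (s γ)).encode := by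
  have h0 := const hk.size_left 0
  have h2 := const hk.size_left 2
  have h1 : PolyTime μ e fun γ => .int ((h γ + 1 : ℕ) : ℤ) :=
    (hh.add (const hk.size_left 1)).congr fun γ => by push_cast; rfl
  have hZ := scale_Z hB
  exact ray hk hB (σ := fun γ => .left (h γ) (p γ) (q γ) (i γ)) hh h1
    (((scale_R hB).mul (hp.sub hi)).add h0)
    (((hq.pow 2).add (hZ.mul ((hq.sub hp).add hi))).sub (hi.pow 2))
    (((h2.mul hZ).mul (hq.sub hp)).mul (scale_R hB)).neg

lemma ray_right (hk : PolyTime μ e fun γ => .int (s γ).k)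
    (hB : PolyTime μ e fun γ => .int (s γ).B) (hh : PolyTime μ e fun γ => .int (h γ))
    (hp : PolyTime μ e fun γ => .int (p γ)) (hq : PolyTime μ e fun γ => .int (q γ))
    (hi : PolyTime μ e fun γ => .int (i γ)) :
    PolyTime μ e fun γ => ((Spec.right (h γ) (p γ) (q γ) (i γ)).ray (s γ)).encode := by
  have h0 := const hk.size_left 0
  have h2 := const hk.size_left 2
  have h4k := (const hk.size_left 4).mul hk
  have h1 : PolyTime μ e fun γ => .int ((h γ + 1 : ℕ) : ℤ) :=
    (hh.add (const hk.size_left 1)).congr fun γ => by push_cast; rfl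
  have hZ := (scale_Z hB).sub (h2.mul hi)
  exact ray hk hB (σ := fun γ => .right (h γ) (p γ) (q γ) (i γ)) hh h1
    (((scale_R hB).mul ((hq.sub h4k).add hi)).add h0)
    ((((hq.pow 2).add (hi.pow 2)).add ((h2.mul hi).mul (hq.sub hp))).add (hZ.mul (h4k.sub hi)))
    (hZ.mul ((scale_M hk).mul (scale_R hB))).neg

end scale

end PolyTime
end RayGraph

namespace RayGraph

open Data

/-! ### Reading the input and traversing the tree -/

/-- An instance of the problem. The lemmas `Inst.time_*` state what can be computed from the input
of an instance in time polynomial in its number of vertices. -/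
structure Inst where
  m : ℕ
  k : ℕ
  T : EmbeddedTree (Fin m)
  L : List (List (Fin m ⊕ Fin k))
  isLinkSystem : T.IsLinkSystem L

lemma idxOf_map {α β : Type*} [DecidableEq α] [DecidableEq β] {f : α → β}
    (hf : Function.Injective f) (l : List α) (a : α) : (l.map f).idxOf (f a) = l.idxOf a := by
  induction l with
  | nil => rfl
  | cons b l ih =>
    have : (f b == f a) = (b == a) := by rw [Bool.eq_iff_iff]; simp [hf.eq_iff]
    rw [List.map_cons, List.idxOf_cons, List.idxOf_cons, ih, this]

namespace Inst

/-- The number of vertices. -/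
def n (I : Inst) : ℕ := I.m + I.k

/-- The input of the algorithm. -/
def input (I : Inst) : Data := encodeInput I.T I.L

lemma input_eq (I : Inst) : I.input = ofList [.int I.m, .int I.k, .int (I.T.root : ℕ),
    .int (I.T.second : ℕ),
    ofList ((List.finRange I.m).map fun v : Fin _ =>
      ofList ((I.T.rot v).map fun w : Fin _ => .int (w : ℕ))),
    ofList (I.L.map fun p => ofList (p.map fun x => .int (vertexNumber x)))] := by
  -- in the definition of the input, the list of neighbours is coerced to a list of numbers by a
  -- monadic bind
  have h : ∀ v, ofList ((do let a ← I.T.rot v; pure (a : ℕ) : List ℕ).map Data.ofNat) =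
      ofList ((I.T.rot v).map fun w : Fin _ => .int (w : ℕ)) := fun v => by
    rw [List.bind_eq_flatMap, List.map_flatMap]
    conv_rhs => rw [List.map_eq_flatMap]
    rfl
  unfold input encodeInput
  rw [funext h]
  rfl

/-- The scale of the construction. -/
def s (I : Inst) : Scale := EmbeddedTree.scaleOf I.m I.k

lemma fitsLinks (I : Inst) : I.T.FitsLinks I.s I.L := by
  have := EmbeddedTree.fitsLinks_scaleOf I.isLinkSystem
  rwa [Fintype.card_fin, Fintype.card_fin] at this

/-- The combinatorial description of the ray of a vertex of the tree. -/
noncomputable def treeSpec (I : Inst) (v : Fin I.m) : Spec := I.T.treeSpec I.s.M v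

lemma length_L_le (I : Inst) : I.L.length ≤ I.n + 1 := by
  have := I.fitsLinks.length_le
  simp only [s, EmbeddedTree.scaleOf] at this
  simp only [n]
  omega

lemma vertexNumber_lt {m k : ℕ} (x : Fin m ⊕ Fin k) : vertexNumber x < m + k := by
  rcases x with i | j
  · exact i.2.trans_le (Nat.le_add_right _ _)
  · exact Nat.add_lt_add_left j.2 _

lemma polyBound_m : PolyBound n m := PolyBound.self.mono fun _ => Nat.le_add_right _ _

lemma polyBound_k : PolyBound n k := PolyBound.self.mono fun _ => Nat.le_add_left _ _

lemma size_input : PolyBound n fun I => I.input.size := by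
  have hint : PolyBound n fun I => I.n + 2 := PolyBound.self.add (.const 2)
  have hnum : ∀ (I : Inst) (a : ℕ), a ≤ I.n → (Data.ofNat a).size ≤ I.n + 2 := fun I a h =>
    (size_nat_le a).trans (by omega)
  have hrow : PolyBound n fun I => (I.n + 4) * (I.n + 2 + 1) + 1 :=
    ((PolyBound.self.add (.const 4)).mul (hint.add (.const 1))).add (.const 1)
  have hrot : PolyBound n fun I => (ofList ((List.finRange I.m).map fun v : Fin _ =>
      ofList ((I.T.rot v).map fun w : Fin _ => .int (w : ℕ)))).size := by
    refine PolyBound.size_ofList PolyBound.self hrow ?_ ?_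
    · intro I; simp [n]
    · intro I d hd
      obtain ⟨v, -, rfl⟩ := List.mem_map.1 hd
      refine (size_ofList_le (b := I.n + 2) ?_).trans ?_
      · intro d hd
        obtain ⟨w, -, rfl⟩ := List.mem_map.1 hd
        exact hnum I _ (by have := w.2; simp only [n]; omega)
      · gcongr
        have := (I.T.rot_nodup v).length_le_card
        rw [Fintype.card_fin] at this
        simp only [List.length_map, n]; omega
  have hlink : PolyBound n fun I => (ofList (I.L.map fun p =>
      .ofList (p.map fun x => .ofNat (vertexNumber x)))).size := by
    refine PolyBound.size_ofList (PolyBound.self.add (.const 1)) hrow ?_ ?_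
    · intro I; simpa using I.length_L_le
    · intro I d hd
      obtain ⟨p, hp, rfl⟩ := List.mem_map.1 hd
      refine (size_ofList_le (b := I.n + 2) ?_).trans ?_
      · intro d hd
        obtain ⟨w, -, rfl⟩ := List.mem_map.1 hd
        exact hnum I _ (vertexNumber_lt w).le
      · gcongr
        obtain ⟨_, _, -, -, -, ⟨_, rfl⟩ | ⟨_, _, -, rfl⟩⟩ := I.isLinkSystem.isLink p hp <;> simp
  have h1 : ∀ a : Inst → ℕ, (∀ I, a I ≤ I.n) → PolyBound n fun I => (Data.ofNat (a I)).size :=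
    fun a h => hint.mono fun I => hnum I _ (h I)
  simp only [input_eq]
  refine (h1 m fun I => by simp [n]).size_pair ((h1 k fun I => by simp [n]).size_pair
    ((h1 (fun I => I.T.root) fun I => ?_).size_pair
    ((h1 (fun I => I.T.second) fun I => ?_).size_pair
    (hrot.size_pair (hlink.size_pair (.const (Data.int 0).size))))))
  · have := I.T.root.2; simp only [n]; omega
  · have := I.T.second.2; simp only [n]; omega

lemma time_input : PolyTime n input fun I => ofList [.int I.m, .int I.k, .int (I.T.root : ℕ),
    .int (I.T.second : ℕ),
    ofList ((List.finRange I.m).map fun v : Fin _ =>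
      ofList ((I.T.rot v).map fun w : Fin _ => .int (w : ℕ))),
    ofList (I.L.map fun p => ofList (p.map fun x => .int (vertexNumber x)))] :=
  (PolyTime.refl size_input).congr input_eq

lemma time_m : PolyTime n input fun I => .int I.m := time_input.fst

lemma time_k : PolyTime n input fun I => .int I.k := time_input.snd.fst

lemma time_root : PolyTime n input fun I => .int (I.T.root : ℕ) :=
  time_input.snd.snd.fst

lemma time_second : PolyTime n input fun I => .int (I.T.second : ℕ) :=
  time_input.snd.snd.snd.fst

lemma time_rot : PolyTime n input fun I => ofList ((List.finRange I.m).map fun v : Fin _ =>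
    ofList ((I.T.rot v).map fun w : Fin _ => .int (w : ℕ))) :=
  time_input.snd.snd.snd.snd.fst

lemma time_links : PolyTime n input fun I => ofList (I.L.map fun p =>
    ofList (p.map fun x => .int (vertexNumber x))) :=
  time_input.snd.snd.snd.snd.snd.fst

lemma time_s_k : PolyTime n input fun I => .int I.s.k := by
  refine ((PolyTime.const size_input 2).mul
    ((time_m.add time_k).add (PolyTime.const size_input 1))).congr fun I => ?_
  simp [s, EmbeddedTree.scaleOf]

lemma time_s_M : PolyTime n input fun I => .int I.s.M := PolyTime.scale_M time_s_k

/-- The bound on the positions, a power with variable exponent, is computed by repeated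
multiplication. -/
lemma time_s_B : PolyTime n input fun I => .int I.s.B := by
  have hM := time_s_M
  obtain ⟨f, hf⟩ : ∃ f : Inst → ℕ → Data, f = fun I i => .int ((I.s.M * I.s.M) ^ i) := ⟨_, rfl⟩
  have hpow : PolyTime n input fun I => f I I.m := by
    refine PolyTime.natRec polyBound_m time_m ?_ ?_
    · exact (PolyTime.const size_input 1).congr fun I => by simp [hf]
    · have h : PolyTime (fun p : {p : Inst × ℕ // p.2 < p.1.m} => p.1.1.n)
          (fun p => .pair p.1.1.input (.pair (f p.1.1 p.1.2) (.int (p.1.1.m - 1 - p.1.2))))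
          (fun p => .pair p.1.1.input (.pair (f p.1.1 p.1.2) (.int (p.1.1.m - 1 - p.1.2)))) := by
        refine PolyTime.refl ((size_input.reindex _).size_pair (PolyBound.size_pair ?_ ?_))
        · refine ((((polyBound_m.add (.const 1)).mul (hM.mul hM).size_right).add
            (.const 1)).reindex fun p : {p : Inst × ℕ // p.2 < p.1.m} => p.1.1).mono fun p => ?_
          simp only [hf]
          refine (size_pow_le _ _).trans ?_
          gcongr
          exact p.2.le
        · refine (time_m.size_right.reindex
            fun p : {p : Inst × ℕ // p.2 < p.1.m} => p.1.1).mono fun p => ?_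
          have := p.2
          apply size_le_of_natAbs_le
          omega
      have h1 := hM.reindex fun p : {p : Inst × ℕ // p.2 < p.1.m} => p.1.1
      have h2 := h.fst.trans (h1.mul h1)
      have h3 := h.snd.fst
      simp only [hf] at h3 h2 ⊢
      exact (h3.mul h2).congr fun p => by rw [pow_succ]
  simp only [hf] at hpow
  refine (hpow.mul (hM.mul hM)).congr fun I => ?_
  refine congrArg Data.int ?_
  simp only [s, EmbeddedTree.scaleOf, Scale.M]
  rw [← pow_succ, ← pow_two, ← pow_mul]
  congr 1
  ring

/-- The lists of neighbours, each together with the number of its vertex. -/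
lemma time_rotTable : PolyTime n input fun I => ofList ((List.finRange I.m).map fun v : Fin _ =>
    .pair (.int (v : ℕ)) (ofList ((I.T.rot v).map fun w : Fin _ => .int (w : ℕ)))) := by
  have h0 := time_rot
  have h : PolyTime (fun i : ListIdx (fun I : Inst => List.finRange I.m) => i.base.n)
      (fun i => .pair i.base.input (.pair
        (ofList ((i.base.T.rot i.cur).map fun w : Fin _ => .int (w : ℕ)))
        (.int i.pre.length)))
      (fun i => .pair i.base.input (.pair
        (ofList ((i.base.T.rot i.cur).map fun w : Fin _ => .int (w : ℕ)))
        (.int i.pre.length))) := by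
    refine PolyTime.refl ((size_input.reindex _).size_pair (PolyBound.size_pair ?_ ?_))
    · exact (h0.size_right.reindex ListIdx.base).mono fun i =>
        size_le_size_ofList (List.mem_map_of_mem
          (f := fun v => ofList ((i.base.T.rot v).map fun w : Fin _ => .int (w : ℕ))) i.mem)
    · refine ((polyBound_m.add (.const 1)).reindex ListIdx.base).mono fun i =>
        (size_nat_le _).trans ?_
      exact Nat.succ_le_succ (i.length_pre_lt.le.trans_eq List.length_finRange)
  refine (PolyTime.mapIdx (g := fun I v j =>
    .pair (.int j) (ofList ((I.T.rot v).map fun w : Fin _ => .int (w : ℕ)))) h0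
    (h.snd.snd.pair h.snd.fst)).congr fun I => ?_
  congr 1
  apply List.ext_getElem
  · simp
  · intro i h1 h2
    simp

section scope

/-! The variables in scope contain the input and vertices of the tree. -/

variable {Δ : Type*} {r : Δ → Inst} {E : Δ → Data} {v p : ∀ δ, Fin (r δ).m}

lemma time_rot_apply (hE : PolyTime (fun δ => (r δ).n) E fun δ => (r δ).input)
    (hv : PolyTime (fun δ => (r δ).n) E fun δ => .int (v δ : ℕ)) :
    PolyTime (fun δ => (r δ).n) E fun δ =>
      ofList (((r δ).T.rot (v δ)).map fun w : Fin _ => .int (w : ℕ)) := by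
  refine PolyTime.lookup (l := fun δ => List.finRange (r δ).m)
    (key := fun _ (w : Fin _) => ((w : ℕ) : ℤ))
    (hE.trans (time_rotTable.reindex r)) hv (fun δ => ⟨v δ, List.mem_finRange _, rfl⟩) ?_
  intro δ x _ hx
  have : x = v δ := Fin.ext (by exact_mod_cast hx)
  rw [this]

lemma time_rotate (hE : PolyTime (fun δ => (r δ).n) E fun δ => (r δ).input)
    (hv : PolyTime (fun δ => (r δ).n) E fun δ => .int (v δ : ℕ))
    (hp : PolyTime (fun δ => (r δ).n) E fun δ => .int (p δ : ℕ))
    (hvp : ∀ δ, (r δ).T.graph.Adj (v δ) (p δ)) :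
    PolyTime (fun δ => (r δ).n) E fun δ => ofList ((((r δ).T.rot (v δ)).rotate
      (((r δ).T.rot (v δ)).idxOf (p δ))).map fun w : Fin _ => .int (w : ℕ)) := by
  have h := PolyTime.rotate (l := fun δ => ((r δ).T.rot (v δ)).map fun w : Fin _ => ((w : ℕ) : ℤ))
    ((time_rot_apply hE hv).congr fun δ => by rw [List.map_map]; rfl) hp
    fun δ => List.mem_map_of_mem (((r δ).T.mem_rot _ _).2 (hvp δ))
  refine h.congr fun δ => ?_
  have hinj : Function.Injective fun w : Fin (r δ).m => ((w : ℕ) : ℤ) := fun a b hab =>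
    Fin.ext (by simpa using hab)
  rw [idxOf_map hinj, ← List.map_rotate, List.map_map]
  rfl

lemma time_children (hE : PolyTime (fun δ => (r δ).n) E fun δ => (r δ).input)
    (hv : PolyTime (fun δ => (r δ).n) E fun δ => .int (v δ : ℕ))
    (hp : PolyTime (fun δ => (r δ).n) E fun δ => .int (p δ : ℕ))
    (hvp : ∀ δ, (r δ).T.graph.Adj (v δ) (p δ)) :
    PolyTime (fun δ => (r δ).n) E fun δ =>
      ofList (((r δ).T.children (p δ) (v δ)).map fun w : Fin _ => .int (w : ℕ)) := by
  refine ((time_rotate hE hv hp hvp).congr (g := fun δ => .pair (.int (p δ : ℕ))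
    (ofList (((r δ).T.children (p δ) (v δ)).map fun w : Fin _ => .int (w : ℕ)))) fun δ => ?_).snd
  have hm : p δ ∈ (r δ).T.rot (v δ) := ((r δ).T.mem_rot _ _).2 (hvp δ)
  have hlt := List.idxOf_lt_length_of_mem hm
  have h1 : ((r δ).T.rot (v δ)).rotate (((r δ).T.rot (v δ)).idxOf (p δ)) =
      p δ :: (r δ).T.children (p δ) (v δ) := by
    unfold EmbeddedTree.children
    rw [← List.rotate_rotate]
    cases h2 : ((r δ).T.rot (v δ)).rotate (((r δ).T.rot (v δ)).idxOf (p δ)) with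
    | nil =>
      rw [List.rotate_eq_nil_iff] at h2
      rw [h2] at hm; cases hm
    | cons a t =>
      have h3 := List.head?_rotate hlt
      rw [h2, List.getElem?_eq_getElem hlt, List.getElem_idxOf hlt] at h3
      simp only [List.head?_cons, Option.some.injEq] at h3
      rw [h3]
      simp
  rw [h1]
  rfl

end scope

end Inst
end RayGraph

namespace RayGraph

open Data

/-! ### The table of the rays of the tree -/

namespace EmbeddedTree

variable {V : Type*} [DecidableEq V] (T : EmbeddedTree V)

/-- The table of the descriptions of the rays of the vertices up to a given level. -/
def specTable (M : ℤ) : ℕ → List (V × Spec)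
  | 0 => [(T.root, .root)]
  | i + 1 => (T.entries M i).map (fun x => (x.2.1, .tree i x.2.2.1 x.2.2.2)) ++ specTable M i

variable {T} {M : ℤ}

lemma eq_treeSpec_of_mem {i : ℕ} {x : V × Spec} (h : x ∈ T.specTable M i) :
    x.2 = T.treeSpec M x.1 := by
  induction i with
  | zero =>
    obtain rfl := List.mem_singleton.1 h
    exact (treeSpec_root M).symm
  | succ i ih =>
    rcases List.mem_append.1 h with h | h
    · obtain ⟨y, hy, rfl⟩ := List.mem_map.1 h
      exact (treeSpec_of_mem hy).symm
    · exact ih h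

lemma treeSpec_mem_specTable {i : ℕ} {v : V} (h : T.depth v ≤ i) :
    (v, T.treeSpec M v) ∈ T.specTable M i := by
  induction i with
  | zero =>
    rw [Nat.le_zero, T.depth_eq_zero] at h
    rw [h, treeSpec_root]
    exact List.mem_singleton_self _
  | succ i ih =>
    refine List.mem_append.2 ?_
    rcases h.lt_or_eq with h | h
    · exact Or.inr (ih (by omega))
    · left
      obtain ⟨u, hu, hd⟩ := T.exists_parent (v := v) (by
        rintro rfl; rw [T.depth_root] at h; omega)
      obtain ⟨x, hx, -, rfl⟩ := exists_entry M hu hd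
      obtain rfl : T.depth u = i := by omega
      exact List.mem_map.2 ⟨x, hx, by rw [treeSpec_of_mem hx]⟩

lemma length_entries_le [Fintype V] (M : ℤ) (i : ℕ) :
    (T.entries M i).length ≤ Fintype.card V := by
  have h := (T.level_nodup (i + 1)).length_le_card
  rwa [← T.map_entries_snd M, List.length_map] at h

lemma length_specTable_le [Fintype V] (M : ℤ) (i : ℕ) :
    (T.specTable M i).length ≤ i * Fintype.card V + 1 := by
  induction i with
  | zero => simp [specTable]
  | succ i ih =>
    have := T.length_entries_le M i
    rw [specTable, List.length_append, List.length_map, add_mul, one_mul]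
    omega

end EmbeddedTree

/-- A vertex of the tree as a value, with its parent, the position of the parent and the signed
child number. -/
def encodeEntry {m : ℕ} (x : Fin m × Fin m × ℤ × ℤ) : Data :=
  .pair (.pair (.int (x.1 : ℕ)) (.int (x.2.1 : ℕ))) (.pair (.int x.2.2.1) (.int x.2.2.2))

/-- The level, the position and the ray of a vertex, as a value. -/
def encodeSpec (s : Scale) (σ : Spec) : Data :=
  .pair (.pair (.int σ.loc) (.int (σ.pos s))) (σ.ray s).encode

namespace Inst

/-- A vertex of level `i + 1` of the tree of an instance. -/
structure EntryIdx where
  I : Inst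
  i : ℕ
  x : Fin I.m × Fin I.m × ℤ × ℤ
  mem : x ∈ I.T.entries I.s.M i

/-- The variables in scope when a vertex is treated. -/
def EntryIdx.env (a : EntryIdx) : Data :=
  .pair a.I.input (.pair (.pair (.int a.i) (.int ((-1) ^ a.i))) (encodeEntry a.x))

lemma size_fin : PolyBound (fun a : (I : Inst) × Fin I.m => a.1.n) fun a =>
    (Data.int (a.2 : ℕ)).size :=
  (PolyBound.self.add (.const 1)).mono fun a => (size_nat_le _).trans (by
    have := a.2.2; simp only [n]; omega)

lemma size_sign (i : ℕ) : (Data.int ((-1) ^ i)).size = 2 := by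
  simp only [size, Int.natAbs_pow, Int.natAbs_neg, Int.natAbs_one, one_pow]
  decide

lemma size_env : PolyBound (fun a : EntryIdx => a.I.n) fun a => a.env.size := by
  have hB : PolyBound (fun a : EntryIdx => a.I.n) fun a => (Data.int a.I.s.B).size :=
    time_s_B.size_right.reindex EntryIdx.I
  refine PolyBound.size_pair (size_input.reindex EntryIdx.I) (PolyBound.size_pair
    (PolyBound.size_pair ?_ ?_) (PolyBound.size_pair (PolyBound.size_pair ?_ ?_)
    (PolyBound.size_pair ?_ ?_)))
  · refine (PolyBound.self.add (.const 1)).mono fun a => (size_nat_le _).trans ?_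
    have h := (EmbeddedTree.adj_of_mem_entries a.mem).2.2
    have h2 := a.I.T.depth_lt_card a.x.2.1
    rw [h, Fintype.card_fin] at h2
    simp only [n]; omega
  · exact (PolyBound.const 2).mono fun a => (size_sign _).le
  · exact size_fin.reindex fun a : EntryIdx => ⟨a.I, a.x.1⟩
  · exact size_fin.reindex fun a : EntryIdx => ⟨a.I, a.x.2.1⟩
  · refine hB.mono fun a => size_le_of_abs_le ?_
    have h := a.I.fitsLinks.toFits
    have h1 := h.positions.abs_bound (EmbeddedTree.entry_bounds h.length_rot_le a.mem).1
    have := abs_nonneg a.x.2.2.1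
    omega
  · refine hB.mono fun a => size_le_of_abs_le ?_
    have h := a.I.fitsLinks.toFits
    have h1 := (EmbeddedTree.entry_bounds h.length_rot_le a.mem).2
    have h2 := a.I.s.one_le_k
    have h3 := a.I.s.k_le_B
    nlinarith

lemma time_env : PolyTime (fun a : EntryIdx => a.I.n) EntryIdx.env EntryIdx.env :=
  PolyTime.refl size_env

/-- The description of the ray of a vertex. -/
lemma time_entrySpec : PolyTime (fun a : EntryIdx => a.I.n) EntryIdx.env fun a =>
    .pair (.int (a.x.2.1 : ℕ)) (encodeSpec a.I.s (.tree a.i a.x.2.2.1 a.x.2.2.2)) := by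
  have h := time_env
  have hk := h.fst.trans (time_s_k.reindex EntryIdx.I)
  have hB := h.fst.trans (time_s_B.reindex EntryIdx.I)
  have hi := h.snd.fst.fst
  have hp := h.snd.snd.snd.fst
  have hb := h.snd.snd.snd.snd
  refine h.snd.snd.fst.snd.pair (PolyTime.pair (PolyTime.pair ?_ ?_) ?_)
  · exact (hi.add (PolyTime.const h.size_left 1)).congr fun a => by
      simp only [Spec.loc]; push_cast; rfl
  · exact ((PolyTime.scale_M hk).mul ((hp.add hp).add hb)).neg
  · exact PolyTime.ray_tree hk hB hi hp hb

/-- The children of a vertex. -/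
lemma time_entryChildren : PolyTime (fun a : EntryIdx => a.I.n) EntryIdx.env fun a =>
    ofList (((a.I.T.children a.x.1 a.x.2.1).zipIdx.map fun y =>
      encodeEntry (a.x.2.1, y.1, EmbeddedTree.entryPos a.I.s.M a.x,
        (-1) ^ (a.i + 1) * (y.2 : ℤ)))) := by
  have h := time_env
  have hc := time_children (r := EntryIdx.I) (v := fun a => a.x.2.1) (p := fun a => a.x.1)
    h.fst h.snd.snd.fst.snd h.snd.snd.fst.fst fun a =>
      (EmbeddedTree.adj_of_mem_entries a.mem).1.symm
  have hpos : PolyTime (fun a : EntryIdx => a.I.n) EntryIdx.env fun a =>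
      .int (EmbeddedTree.entryPos a.I.s.M a.x) :=
    ((h.fst.trans (time_s_M.reindex EntryIdx.I)).mul
      ((h.snd.snd.snd.fst.add h.snd.snd.snd.fst).add h.snd.snd.snd.snd)).neg
  refine PolyTime.mapIdx (l := fun a : EntryIdx => a.I.T.children a.x.1 a.x.2.1)
    (enc := fun a (w : Fin _) => .int (w : ℕ)) (g := fun a y j =>
      encodeEntry (a.x.2.1, y, EmbeddedTree.entryPos a.I.s.M a.x, (-1) ^ (a.i + 1) * (j : ℤ))) hc ?_
  obtain ⟨r, hr⟩ : ∃ r : ListIdx (fun a : EntryIdx => a.I.T.children a.x.1 a.x.2.1) → EntryIdx,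
    r = ListIdx.base := ⟨_, rfl⟩
  have hB : PolyTime (fun i : ListIdx (fun a : EntryIdx => a.I.T.children a.x.1 a.x.2.1) =>
        i.base.I.n)
      (fun i => .pair i.base.env (.pair (.int (i.cur : ℕ)) (.int i.pre.length)))
      (fun i => .pair i.base.env (.pair (.int (i.cur : ℕ)) (.int i.pre.length))) := by
    refine PolyTime.refl ((size_env.reindex ListIdx.base).size_pair (PolyBound.size_pair
      (size_fin.reindex fun i : ListIdx (fun a : EntryIdx => a.I.T.children a.x.1 a.x.2.1) =>
        ⟨i.base.I, i.cur⟩) ?_))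
    refine (((PolyTime.length_bound hc).add (.const 1)).reindex ListIdx.base).mono fun i =>
      (size_nat_le _).trans ?_
    exact Nat.succ_le_succ i.length_pre_lt.le
  have h1 := hB.fst.trans (h.reindex ListIdx.base)
  have h2 := hB.fst.trans (hpos.reindex ListIdx.base)
  refine (h1.snd.snd.fst.snd.pair hB.snd.fst).pair (h2.pair
    ((h1.snd.fst.snd.neg.mul hB.snd.snd).congr fun i => ?_))
  simp only [pow_succ]
  congr 1
  ring

/-- The state of the traversal of the tree after `i` levels: the number `i` and its sign, the
vertices of level `i + 1`, and the table of the rays up to level `i`. -/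
def state (I : Inst) (i : ℕ) : Data :=
  .pair (.pair (.int i) (.int ((-1) ^ i))) (.pair (ofList ((I.T.entries I.s.M i).map encodeEntry))
    (ofList ((I.T.specTable I.s.M i).map fun x =>
      .pair (.int (x.1 : ℕ)) (encodeSpec I.s x.2))))

lemma time_state_zero : PolyTime n input fun I => state I 0 := by
  have h0 := PolyTime.refl size_input
  have hk := time_s_k
  have hB := time_s_B
  have hz := PolyTime.const size_input 0
  have hroot : PolyTime n input fun I => encodeSpec I.s .root :=
    (hz.pair hz).pair (PolyTime.ray_root hk hB)
  refine PolyTime.pair (hz.pair (PolyTime.const size_input 1)) (PolyTime.pair ?_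
    ((time_root.pair hroot).cons (PolyTime.nil size_input)))
  have hr := time_rotate (r := fun I : Inst => I) (v := fun I => I.T.root)
    (p := fun I => I.T.second) h0 time_root time_second fun I => I.T.root_adj_second
  refine (PolyTime.mapIdx (l := fun I : Inst => (I.T.rot I.T.root).rotate
    ((I.T.rot I.T.root).idxOf I.T.second)) (enc := fun I (w : Fin _) => .int (w : ℕ))
    (g := fun I y j => encodeEntry (I.T.root, y, 0, (j : ℤ))) hr ?_).congr fun I => ?_
  · have hE : PolyTime (fun i : ListIdx (fun I : Inst => (I.T.rot I.T.root).rotate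
          ((I.T.rot I.T.root).idxOf I.T.second)) => i.base.n)
        (fun i => .pair i.base.input (.pair (.int (i.cur : ℕ)) (.int i.pre.length)))
        (fun i => .pair i.base.input (.pair (.int (i.cur : ℕ)) (.int i.pre.length))) := by
      refine PolyTime.refl ((size_input.reindex ListIdx.base).size_pair (PolyBound.size_pair
        (size_fin.reindex fun i : ListIdx (fun I : Inst => (I.T.rot I.T.root).rotate
          ((I.T.rot I.T.root).idxOf I.T.second)) => ⟨i.base, i.cur⟩) ?_))
      refine (((PolyTime.length_bound hr).add (.const 1)).reindex ListIdx.base).mono fun i =>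
        (size_nat_le _).trans ?_
      exact Nat.succ_le_succ i.length_pre_lt.le
    exact ((hE.fst.trans (time_root.reindex ListIdx.base)).pair hE.snd.fst).pair
      ((PolyTime.const hE.size_left 0).pair hE.snd.snd)
  · rw [EmbeddedTree.entries, List.map_map]
    rfl

/-- The descriptions of the rays of the vertices of the tree have polynomial size. -/
lemma size_treeSpec : PolyBound (fun a : (I : Inst) × Fin I.m => a.1.n) fun a =>
    (Data.pair (.int (a.2 : ℕ)) (encodeSpec a.1.s (a.1.treeSpec a.2))).size := by
  obtain ⟨q, hq⟩ := time_entrySpec.size_right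
  obtain ⟨q', hq'⟩ := time_state_zero.size_right
  refine ⟨q + q', ?_⟩
  rintro ⟨I, v⟩
  simp only [Polynomial.eval_add]
  have h1 := hq' I
  rcases EmbeddedTree.isTreeSpec_treeSpec (T := I.T) I.s.M v with ⟨rfl, h⟩ | ⟨i, x, hx, rfl, h⟩
  · rw [treeSpec, h]
    simp only [state, EmbeddedTree.specTable, List.map_cons, List.map_nil, ofList, size] at h1 ⊢
    omega
  · rw [treeSpec, h]
    have h2 := hq ⟨I, i, x, hx⟩
    simp only at h2
    omega

lemma size_state : PolyBound (fun p : {p : Inst × ℕ // p.2 < p.1.m} => p.1.1.n)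
    fun p => (state p.1.1 p.1.2).size := by
  have hn : PolyBound (fun p : {p : Inst × ℕ // p.2 < p.1.m} => p.1.1.n) fun p => p.1.1.n :=
    PolyBound.self
  obtain ⟨q, hq⟩ := size_env
  obtain ⟨q', hq'⟩ := size_treeSpec
  refine PolyBound.size_pair (PolyBound.size_pair ?_ ?_) (PolyBound.size_pair
    (PolyBound.size_ofList hn (b := fun p => q.eval p.1.1.n) ⟨q, fun _ => le_rfl⟩ ?_ ?_)
    (PolyBound.size_ofList ((hn.mul hn).add (.const 1)) (b := fun p => q'.eval p.1.1.n)
      ⟨q', fun _ => le_rfl⟩ ?_ ?_))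
  · refine (hn.add (.const 1)).mono fun p => (size_nat_le _).trans ?_
    have := p.2
    simp only [n]; omega
  · exact (PolyBound.const 2).mono fun p => (size_sign _).le
  · intro p
    have := p.1.1.T.length_entries_le p.1.1.s.M p.1.2
    rw [Fintype.card_fin] at this
    rw [List.length_map]
    simp only [n]; omega
  · intro p d hd
    obtain ⟨x, hx, rfl⟩ := List.mem_map.1 hd
    have := hq ⟨p.1.1, p.1.2, x, hx⟩
    simp only [EntryIdx.env, size] at this
    omega
  · intro p
    have h1 := p.1.1.T.length_specTable_le p.1.1.s.M p.1.2
    rw [Fintype.card_fin] at h1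
    rw [List.length_map]
    have h2 : p.1.2 * p.1.1.m ≤ p.1.1.n * p.1.1.n := by
      have := p.2
      gcongr <;> simp only [n] <;> omega
    omega
  · intro p d hd
    obtain ⟨x, hx, rfl⟩ := List.mem_map.1 hd
    rw [EmbeddedTree.eq_treeSpec_of_mem hx]
    exact hq' ⟨p.1.1, x.1⟩

/-- The traversal of the tree, level by level. -/
lemma time_state : PolyTime n input fun I => state I I.m := by
  refine PolyTime.natRec polyBound_m time_m time_state_zero ?_
  have h : PolyTime (fun p : {p : Inst × ℕ // p.2 < p.1.m} => p.1.1.n)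
      (fun p => .pair p.1.1.input (.pair (state p.1.1 p.1.2) (.int (p.1.1.m - 1 - p.1.2))))
      (fun p => .pair p.1.1.input (.pair (state p.1.1 p.1.2) (.int (p.1.1.m - 1 - p.1.2)))) := by
    refine PolyTime.refl ((size_input.reindex _).size_pair (size_state.size_pair ?_))
    refine (time_m.size_right.reindex
      fun p : {p : Inst × ℕ // p.2 < p.1.m} => p.1.1).mono fun p => ?_
    have := p.2
    apply size_le_of_natAbs_le
    omega
  have hin := h.fst
  have hi := h.snd.fst.fst
  have hcur := h.snd.fst.snd.fst
  have htab := h.snd.fst.snd.snd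
  obtain ⟨l, hl⟩ : ∃ l : ∀ p : {p : Inst × ℕ // p.2 < p.1.m},
      List (Fin p.1.1.m × Fin p.1.1.m × ℤ × ℤ),
      l = fun p => p.1.1.T.entries p.1.1.s.M p.1.2 := ⟨_, rfl⟩
  have hcur' : PolyTime (fun p : {p : Inst × ℕ // p.2 < p.1.m} => p.1.1.n)
      (fun p => .pair p.1.1.input (.pair (state p.1.1 p.1.2) (.int (p.1.1.m - 1 - p.1.2))))
      fun p => ofList ((l p).map encodeEntry) := hcur.congr fun p => by rw [hl]
  obtain ⟨r, hr⟩ : ∃ r : ListIdx l → EntryIdx, r = fun i =>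
    ⟨i.base.1.1, i.base.1.2, i.cur,
      (congrFun hl i.base).subst (motive := fun L => i.cur ∈ L) i.mem⟩ := ⟨_, rfl⟩
  have henv : PolyTime (fun i : ListIdx l => i.base.1.1.n)
      (fun i => .pair (.pair i.base.1.1.input (.pair (state i.base.1.1 i.base.1.2)
        (.int (i.base.1.1.m - 1 - i.base.1.2)))) (encodeEntry i.cur))
      fun i => (r i).env := by
    have h1 := PolyTime.refl (PolyBound.size_pair (h.size_left.reindex (ListIdx.base (l := l)))
      (b := fun i => encodeEntry i.cur)
      ((hcur'.size_right.reindex (ListIdx.base (l := l))).mono fun i =>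
        size_le_size_ofList (List.mem_map_of_mem i.mem)))
    have h2 := h1.fst.trans (hin.reindex (ListIdx.base (l := l)))
    have h3 := h1.fst.trans (hi.reindex (ListIdx.base (l := l)))
    exact (h2.pair (h3.pair h1.snd)).congr fun i => by rw [hr]; rfl
  have hn : (fun i : ListIdx l => i.base.1.1.n) = fun i => (r i).I.n := by rw [hr]
  rw [hn] at henv
  have hnext := PolyTime.flatMap (l := l) (g := fun p x =>
    (p.1.1.T.children x.1 x.2.1).zipIdx.map fun y => encodeEntry
      (x.2.1, y.1, EmbeddedTree.entryPos p.1.1.s.M x, (-1) ^ (p.1.2 + 1) * (y.2 : ℤ))) hcur' (by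
    rw [hn]
    exact (henv.trans (time_entryChildren.reindex r)).congr fun i => by rw [hr])
  have hspec := PolyTime.map (l := l) (g := fun p x => .pair (.int (x.2.1 : ℕ))
      (encodeSpec p.1.1.s (.tree p.1.2 x.2.2.1 x.2.2.2))) hcur' (by
    rw [hn]
    exact (henv.trans (time_entrySpec.reindex r)).congr fun i => by rw [hr])
  refine (((hi.fst.add (PolyTime.const h.size_left 1)).pair hi.snd.neg).pair
    (hnext.pair (hspec.append htab))).congr fun p => ?_
  simp only [state, EmbeddedTree.entries, EmbeddedTree.specTable, hl, List.map_append,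
    List.map_map, List.map_flatMap, pow_succ]
  congr 2
  exact congrArg Data.int (by ring)

/-- The table of the vertices of the tree. -/
lemma time_treeTable : PolyTime n input fun I => ofList ((I.T.specTable I.s.M I.m).map fun x =>
    .pair (.int (x.1 : ℕ)) (encodeSpec I.s x.2)) :=
  time_state.snd.snd

lemma treeSpec_mem (I : Inst) (v : Fin I.m) :
    (v, I.treeSpec v) ∈ I.T.specTable I.s.M I.m := by
  apply EmbeddedTree.treeSpec_mem_specTable
  have := I.T.depth_lt_card v
  rw [Fintype.card_fin] at this
  exact this.le

/-- The description of the ray of a given vertex is found by a search in the table. -/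
lemma time_treeSpec {Δ : Type*} {r : Δ → Inst} {E : Δ → Data} {v : ∀ δ, Fin (r δ).m}
    (hE : PolyTime (fun δ => (r δ).n) E fun δ => (r δ).input)
    (hv : PolyTime (fun δ => (r δ).n) E fun δ => .int (v δ : ℕ)) :
    PolyTime (fun δ => (r δ).n) E fun δ => encodeSpec (r δ).s ((r δ).treeSpec (v δ)) := by
  refine PolyTime.lookup (l := fun δ => (r δ).T.specTable (r δ).s.M (r δ).m)
    (key := fun _ x => ((x.1 : ℕ) : ℤ)) (hE.trans (time_treeTable.reindex r)) hv
    (fun δ => ⟨_, (r δ).treeSpec_mem (v δ), rfl⟩) ?_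
  intro δ x hx hxv
  have h : x.1 = v δ := Fin.ext (by exact_mod_cast hxv)
  rw [EmbeddedTree.eq_treeSpec_of_mem hx, h]
  rfl

end Inst
end RayGraph

namespace RayGraph

open Data

/-! ### The rays of the paths and the output -/

lemma vertexNumber_injective {m k : ℕ} :
    Function.Injective (vertexNumber : Fin m ⊕ Fin k → ℕ) := by
  rintro (i | i) (j | j) h <;> simp only [vertexNumber] at h
  · exact congrArg _ (Fin.ext h)
  · have := i.2; omega
  · have := j.2; omega
  · exact congrArg _ (Fin.ext (by omega))

namespace Inst

/-- The rays of the internal vertices of a path, as a value. -/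
noncomputable def linkData (I : Inst) (p : List (Fin I.m ⊕ Fin I.k)) (j : ℕ) : List Data :=
  (linkEntries I.s I.treeSpec (I.s.k / 2 + 1 + (j : ℤ)) p).map fun x =>
    .pair (.int (vertexNumber (.inr x.1 : Fin I.m ⊕ Fin I.k))) (x.2.ray I.s).encode

/-- The rays of a path are computed from the levels and positions of its endpoints; the paths with
three and with four vertices are distinguished by their lengths. -/
lemma time_linkData : PolyTime (fun i : ListIdx (fun I : Inst => I.L) => i.base.n)
    (fun i => .pair i.base.input (.pair (ofList (i.cur.map fun x => .int (vertexNumber x)))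
      (.int i.pre.length)))
    fun i => ofList (i.base.linkData i.cur i.pre.length) := by
  classical
  have hE : PolyTime (fun i : ListIdx (fun I : Inst => I.L) => i.base.n)
      (fun i => .pair i.base.input (.pair (ofList (i.cur.map fun x => .int (vertexNumber x)))
        (.int i.pre.length)))
      (fun i => .pair i.base.input (.pair (ofList (i.cur.map fun x => .int (vertexNumber x)))
        (.int i.pre.length))) := by
    refine PolyTime.refl ((size_input.reindex ListIdx.base).size_pair (PolyBound.size_pair
      ((time_links.size_right.reindex ListIdx.base).mono fun i => ?_) ?_))
    · exact size_le_size_ofList (List.mem_map_of_mem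
        (f := fun p : List (Fin i.base.m ⊕ Fin i.base.k) =>
          ofList (p.map fun x => .int (vertexNumber x))) i.mem)
    · refine (((PolyTime.length_bound time_links).add (.const 1)).reindex ListIdx.base).mono
        fun i => (size_nat_le _).trans ?_
      exact Nat.succ_le_succ i.length_pre_lt.le
  have hin := hE.fst
  have hk := hin.trans (time_s_k.reindex ListIdx.base)
  have hB := hin.trans (time_s_B.reindex ListIdx.base)
  have hi := ((hk.div (PolyTime.const hE.size_left 2)).add (PolyTime.const hE.size_left 1)).add
    hE.snd.snd
  have hshape : ∀ i : ListIdx (fun I : Inst => I.L),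
      (∃ u w v, i.cur = [.inl u, .inr w, .inl v]) ∨
        ∃ u w w' v, i.cur = [.inl u, .inr w, .inr w', .inl v] := by
    intro i
    obtain ⟨u, v, -, -, -, ⟨w, h⟩ | ⟨w, w', -, h⟩⟩ := i.base.isLinkSystem.isLink i.cur i.mem
    · exact Or.inl ⟨u, w, v, h⟩
    · exact Or.inr ⟨u, w, w', v, h⟩
  have htest : PolyTime (fun i : ListIdx (fun I : Inst => I.L) => i.base.n)
      (fun i => .pair i.base.input (.pair (ofList (i.cur.map fun x => .int (vertexNumber x)))
        (.int i.pre.length)))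
      fun i => .int (if ∃ u w v, i.cur = [.inl u, .inr w, .inl v] then 1 else 0) := by
    -- a path has at least four vertices if something is left after three vertices
    have h1 := hE.snd.fst.op_snd.op_snd.op_snd.isPair
    refine ((PolyTime.const hE.size_left 1).sub (h1.congr (g := fun i => .int
      (if ∃ u w v, i.cur = [.inl u, .inr w, .inl v] then 0 else 1)) fun i => ?_)).congr fun i => ?_
    · rcases hshape i with ⟨u, w, v, h⟩ | ⟨u, w, w', v, h⟩
      · rw [if_pos ⟨u, w, v, h⟩, h]; rfl
      · rw [if_neg (by rw [h]; simp), h]; rfl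
    · split_ifs <;> rfl
  refine (PolyTime.ite_of_subtype htest
    (f := fun i => ofList (i.base.linkData i.cur i.pre.length))
    (g := fun i => ofList (i.base.linkData i.cur i.pre.length)) ?_ ?_).congr fun i => ite_self _
  · choose u w v huv using fun i : {i : ListIdx (fun I : Inst => I.L) //
      ∃ u w v, i.cur = [.inl u, .inr w, .inl v]} => i.2
    have hp := (hE.snd.fst.reindex Subtype.val).congr (g := fun i => .pair (.int (u i : ℕ))
      (.pair (.int (vertexNumber (.inr (w i) : Fin i.1.base.m ⊕ Fin i.1.base.k)))
      (.pair (.int (v i : ℕ)) (.int 0)))) fun i => by rw [huv i]; rfl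
    have hin' := hin.reindex (Subtype.val : {i : ListIdx (fun I : Inst => I.L) //
      ∃ u w v, i.cur = [.inl u, .inr w, .inl v]} → _)
    have hk' := hk.reindex (Subtype.val : {i : ListIdx (fun I : Inst => I.L) //
      ∃ u w v, i.cur = [.inl u, .inr w, .inl v]} → _)
    have hB' := hB.reindex (Subtype.val : {i : ListIdx (fun I : Inst => I.L) //
      ∃ u w v, i.cur = [.inl u, .inr w, .inl v]} → _)
    have hi' := hi.reindex (Subtype.val : {i : ListIdx (fun I : Inst => I.L) //
      ∃ u w v, i.cur = [.inl u, .inr w, .inl v]} → _)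
    have hu := time_treeSpec hin' hp.fst
    have hv := time_treeSpec hin' hp.snd.snd.fst
    have hnil := PolyTime.nil hp.size_left
    refine (PolyTime.ite (hu.fst.snd.lt hv.fst.snd)
      ((hp.snd.fst.pair (PolyTime.ray_mid hk' hB' hu.fst.fst hu.fst.snd hv.fst.snd hi')).cons hnil)
      ((hp.snd.fst.pair
        (PolyTime.ray_mid hk' hB' hu.fst.fst hv.fst.snd hu.fst.snd hi')).cons hnil)).congr
      fun i => ?_
    rw [huv i]
    simp only [linkData, linkEntries]
    split_ifs <;> rfl
  · choose u w w' v huv using fun i : {i : ListIdx (fun I : Inst => I.L) //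
      ¬ ∃ u w v, i.cur = [.inl u, .inr w, .inl v]} => (hshape i.1).resolve_left i.2
    have hp := (hE.snd.fst.reindex Subtype.val).congr (g := fun i => .pair (.int (u i : ℕ))
      (.pair (.int (vertexNumber (.inr (w i) : Fin i.1.base.m ⊕ Fin i.1.base.k)))
      (.pair (.int (vertexNumber (.inr (w' i) : Fin i.1.base.m ⊕ Fin i.1.base.k)))
      (.pair (.int (v i : ℕ)) (.int 0))))) fun i => by rw [huv i]; rfl
    have hin' := hin.reindex (Subtype.val : {i : ListIdx (fun I : Inst => I.L) //
      ¬ ∃ u w v, i.cur = [.inl u, .inr w, .inl v]} → _)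
    have hk' := hk.reindex (Subtype.val : {i : ListIdx (fun I : Inst => I.L) //
      ¬ ∃ u w v, i.cur = [.inl u, .inr w, .inl v]} → _)
    have hB' := hB.reindex (Subtype.val : {i : ListIdx (fun I : Inst => I.L) //
      ¬ ∃ u w v, i.cur = [.inl u, .inr w, .inl v]} → _)
    have hi' := hi.reindex (Subtype.val : {i : ListIdx (fun I : Inst => I.L) //
      ¬ ∃ u w v, i.cur = [.inl u, .inr w, .inl v]} → _)
    have hu := time_treeSpec hin' hp.fst
    have hv := time_treeSpec hin' hp.snd.snd.snd.fst
    have hnil := PolyTime.nil hp.size_left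
    have hl := PolyTime.ray_left hk' hB' hu.fst.fst hu.fst.snd hv.fst.snd hi'
    have hr := PolyTime.ray_right hk' hB' hu.fst.fst hu.fst.snd hv.fst.snd hi'
    have hl' := PolyTime.ray_left hk' hB' hu.fst.fst hv.fst.snd hu.fst.snd hi'
    have hr' := PolyTime.ray_right hk' hB' hu.fst.fst hv.fst.snd hu.fst.snd hi'
    refine (PolyTime.ite (hu.fst.snd.lt hv.fst.snd)
      ((hp.snd.fst.pair hl).cons ((hp.snd.snd.fst.pair hr).cons hnil))
      ((hp.snd.snd.fst.pair hl').cons ((hp.snd.fst.pair hr').cons hnil))).congr fun i => ?_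
    rw [huv i]
    simp only [linkData, linkEntries]
    split_ifs <;> rfl

/-- The table of the rays of all the vertices. -/
noncomputable def rayTable (I : Inst) : List ((Fin I.m ⊕ Fin I.k) × Spec) :=
  (I.T.specTable I.s.M I.m).map (fun x => (.inl x.1, x.2)) ++
    (I.L.zipIdx.flatMap fun y =>
      linkEntries I.s I.treeSpec (I.s.k / 2 + 1 + (y.2 : ℤ)) y.1).map fun x => (.inr x.1, x.2)

lemma time_rayTable : PolyTime n input fun I => ofList (I.rayTable.map fun x =>
    .pair (.int (vertexNumber x.1)) (x.2.ray I.s).encode) := by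
  have hlink := PolyTime.flatten (l := fun I : Inst =>
    I.L.zipIdx.map fun x => I.linkData x.1 x.2)
    ((PolyTime.mapIdx (g := fun I p j => ofList (I.linkData p j)) time_links time_linkData).congr
      fun I => by rw [List.map_map]; rfl)
  have hE : PolyTime (fun i : ListIdx (fun I : Inst => I.T.specTable I.s.M I.m) => i.base.n)
      (fun i => .pair i.base.input (.pair (.int (i.cur.1 : ℕ)) (encodeSpec i.base.s i.cur.2)))
      (fun i => .pair i.base.input (.pair (.int (i.cur.1 : ℕ)) (encodeSpec i.base.s i.cur.2))) := by
    refine PolyTime.refl ((size_input.reindex ListIdx.base).size_pair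
      ((time_treeTable.size_right.reindex ListIdx.base).mono fun i => ?_))
    exact size_le_size_ofList (List.mem_map_of_mem (f := fun x : Fin i.base.m × Spec =>
      Data.pair (.int (x.1 : ℕ)) (encodeSpec i.base.s x.2)) i.mem)
  have htree := PolyTime.map (l := fun I : Inst => I.T.specTable I.s.M I.m)
    (g := fun I x => .pair (.int (x.1 : ℕ)) (x.2.ray I.s).encode) time_treeTable
    (hE.snd.fst.pair hE.snd.snd.snd)
  refine (htree.append hlink).congr fun I => ?_
  rw [rayTable, List.map_append, List.map_map, List.map_map, List.map_flatMap, List.flatMap]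
  rfl

/-- The rays of the output. -/
noncomputable def ray (I : Inst) (x : Fin I.m ⊕ Fin I.k) : IntRay := (I.T.spec I.s I.L x).ray I.s

lemma eq_spec_of_mem {I : Inst} {x : (Fin I.m ⊕ Fin I.k) × Spec} (h : x ∈ I.rayTable) :
    x.2 = I.T.spec I.s I.L x.1 := by
  rcases List.mem_append.1 h with h | h
  · obtain ⟨y, hy, rfl⟩ := List.mem_map.1 h
    exact EmbeddedTree.eq_treeSpec_of_mem hy
  · obtain ⟨y, hy, rfl⟩ := List.mem_map.1 h
    obtain ⟨z, hz, hyz⟩ := List.mem_flatMap.1 hy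
    exact (I.fitsLinks.spec_inr_eq I.isLinkSystem ⟨z, hz, hyz⟩).symm

lemma spec_mem (I : Inst) (x : Fin I.m ⊕ Fin I.k) : (x, I.T.spec I.s I.L x) ∈ I.rayTable := by
  refine List.mem_append.2 ?_
  rcases x with v | w
  · exact Or.inl (List.mem_map.2 ⟨_, I.treeSpec_mem v, rfl⟩)
  · obtain ⟨z, hz, hwz⟩ := I.fitsLinks.isLinkSpec_spec I.isLinkSystem w
    exact Or.inr (List.mem_map.2 ⟨_, List.mem_flatMap.2 ⟨z, hz, hwz⟩, rfl⟩)

lemma time_ray {Δ : Type*} {r : Δ → Inst} {E : Δ → Data} {x : ∀ δ, Fin (r δ).m ⊕ Fin (r δ).k}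
    (hE : PolyTime (fun δ => (r δ).n) E fun δ => (r δ).input)
    (hx : PolyTime (fun δ => (r δ).n) E fun δ => .int (vertexNumber (x δ))) :
    PolyTime (fun δ => (r δ).n) E fun δ => ((r δ).ray (x δ)).encode := by
  refine PolyTime.lookup (l := fun δ => (r δ).rayTable)
    (key := fun _ y => (vertexNumber y.1 : ℤ)) (hE.trans (time_rayTable.reindex r)) hx
    (fun δ => ⟨_, (r δ).spec_mem (x δ), rfl⟩) ?_
  intro δ y hy hyx
  have h : y.1 = x δ := vertexNumber_injective (by exact_mod_cast hyx)
  rw [eq_spec_of_mem hy, h]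
  rfl

lemma time_finRange {a : Inst → ℕ} (ha : PolyBound n a)
    (h : PolyTime n input fun I => .int (a I)) :
    PolyTime n input fun I => ofList ((List.finRange (a I)).map fun v : Fin _ => .int (v : ℕ)) := by
  have hl : ∀ j : ℕ, (List.range j).map (fun i : ℕ => Data.int i) =
      (List.finRange j).map fun v : Fin _ => .int (v : ℕ) := by
    intro j
    apply List.ext_getElem
    · rw [List.length_map, List.length_map, List.length_range, List.length_finRange]
    · intro i h1 h2
      rw [List.getElem_map, List.getElem_map, List.getElem_range, List.getElem_finRange]
      rfl
  exact (PolyTime.range ha h).congr fun I => by rw [hl]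

lemma time_output : PolyTime n input fun I => encodeOutput I.ray := by
  have hm := time_finRange polyBound_m time_m
  have hk := time_finRange polyBound_k time_k
  have hEm : PolyTime (fun i : ListIdx (fun I : Inst => List.finRange I.m) => i.base.n)
      (fun i => .pair i.base.input (.int (i.cur : ℕ)))
      (fun i => .pair i.base.input (.int (i.cur : ℕ))) :=
    PolyTime.refl ((size_input.reindex ListIdx.base).size_pair
      (size_fin.reindex fun i : ListIdx (fun I : Inst => List.finRange I.m) => ⟨i.base, i.cur⟩))
  have hEk : PolyTime (fun i : ListIdx (fun I : Inst => List.finRange I.k) => i.base.n)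
      (fun i => .pair i.base.input (.int (i.cur : ℕ)))
      (fun i => .pair i.base.input (.int (i.cur : ℕ))) :=
    PolyTime.refl ((size_input.reindex ListIdx.base).size_pair
      ((PolyBound.self.add (.const 1)).mono fun i => (size_nat_le _).trans (by
        have := i.cur.2; simp only [n]; omega)))
  have hrm := time_ray (r := fun i : ListIdx (fun I : Inst => List.finRange I.m) => i.base)
    (E := fun i => .pair i.base.input (.int (i.cur : ℕ))) (x := fun i => Sum.inl i.cur)
    hEm.fst hEm.snd
  have hrk := time_ray (r := fun i : ListIdx (fun I : Inst => List.finRange I.k) => i.base)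
    (E := fun i => .pair i.base.input (.int (i.cur : ℕ))) (x := fun i => Sum.inr i.cur) hEk.fst
    (((hEk.fst.trans (time_m.reindex ListIdx.base)).add hEk.snd).congr fun i =>
      congrArg Data.int (Nat.cast_add _ _).symm)
  have hA := PolyTime.map (g := fun I v => (I.ray (.inl v)).encode) hm hrm
  have hB := PolyTime.map (g := fun I v => (I.ray (.inr v)).encode) hk hrk
  refine (hA.append hB).congr fun I => ?_
  rw [encodeOutput]

lemma size_ray_le (I : Inst) (x : Fin I.m ⊕ Fin I.k) :
    (I.ray x).encode.size ≤ (encodeOutput I.ray).size := by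
  apply size_le_size_ofList
  rcases x with v | w
  · exact List.mem_append_left _ (List.mem_map_of_mem (List.mem_finRange v))
  · exact List.mem_append_right _ (List.mem_map_of_mem (List.mem_finRange w))

end Inst

lemma IntRay.bitsLE_of_size_le {ρ : IntRay} {b : ℕ} (h : ρ.encode.size ≤ b) : ρ.BitsLE b := by
  simp only [encode, size] at h
  unfold BitsLE
  omega

end RayGraph

theorem mainTheorem3 :
    (∀ (V N : Type*) [Finite V] [Finite N] [DecidableEq V]
      (T : RayGraph.EmbeddedTree V) (P : SimpleGraph (V ⊕ N)),
      T.IsAdmissibleExtension P → RayGraph.IsRayIntersectionGraph (T.plus P)ᶜ) ∧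
    (∃ (A : RayGraph.Prog) (q : Polynomial ℕ),
      ∀ (m k : ℕ) (T : RayGraph.EmbeddedTree (Fin m)) (L : List (List (Fin m ⊕ Fin k))),
        T.IsLinkSystem L →
        ∃ (ρ : Fin m ⊕ Fin k → RayGraph.IntRay) (t : ℕ),
          RayGraph.Run A (RayGraph.encodeInput T L) (RayGraph.encodeOutput ρ) t ∧
          t ≤ q.eval (m + k) ∧
          (∀ x, (ρ x).BitsLE (q.eval (m + k))) ∧
          RayGraph.IsIntersectionGraph (T.plus (RayGraph.pathUnion L))ᶜ
            (fun x => (ρ x).toSet)) := by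
  refine ⟨fun V N _ _ _ T P hP => T.isRayIntersectionGraph_compl_plus hP, ?_⟩
  obtain ⟨A, b, ⟨q, hq⟩, h⟩ := RayGraph.Inst.time_output
  refine ⟨A, q, fun m k T L hL => ?_⟩
  obtain ⟨t, ht, hr⟩ := h ⟨m, k, T, L, hL⟩
  have htq := ht.trans (hq ⟨m, k, T, L, hL⟩)
  refine ⟨_, t, hr, htq, fun x => ?_, RayGraph.EmbeddedTree.FitsLinks.isIntersectionGraph
    (RayGraph.Inst.fitsLinks ⟨m, k, T, L, hL⟩) hL⟩
  exact RayGraph.IntRay.bitsLE_of_size_le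
    (((RayGraph.Inst.size_ray_le ⟨m, k, T, L, hL⟩ x).trans hr.size_le.2).trans htq)
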